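/- Let $k$ be a field of any characteristic. For $i=1,2$ let $d_i,e_i\ge 1$ be integers, let $P_i(X,Z)\in k[X,Z]$ be monic in $Z$ with $r_i=\deg_Z P_i$, let $Q_i(X,Y,Z)\in k[X,Y,Z]$ be monic in $Y$ with $s_i=\deg_Y Q_i$, and put $$B_i=\frac{k[X,Y,Z,T]}{(X^{d_i}Y-P_i(X,Z),\;X^{e_i}T-Q_i(X,Y,Z))},$$ with $x_i,y_i,z_i,t_i$ the images of $X,Y,Z,T$ in $B_i$. Assume that for $i=1,2$ one of the following holds: $r_i\ge2$ and $s_i\ge2$; or $r_i\ge 2$ and $s_i=1$; or $r_i=1$, $s_i\ge2$ and $e_i\ge2$. Let $\psi:B_2\to B_1$ be a $k$-algebra isomorphism, and suppose $r_1,r_2>1$. Then: (I) $(r_1,s_1)=(r_2,s_2)=:(r,s)$, and there exist $\lambda,\gamma\in k^*$ and $\delta(X)\in k[X]$ such that $\psi(x_2)=\lambda x_1$ and $\psi(z_2)=\gamma z_1+\delta(x_1)$. (II) If $s>1$, then $(d_1,e_1)=(d_2,e_2)=:(d,e)$, and, for these $\lambda,\gamma,\delta$, there exists $f(X,Z)\in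 k[X,Z]$ with $\deg_Z f<r$ such that (i) $\psi(y_2)=\nu y_1+g(x_1,z_1)$, where $\nu=\lambda^{-d}\gamma^r$ and $g=\lambda^{-d}f$; (ii) $P_2(\lambda X,\gamma Z+\delta(X))=\gamma^rP_1(X,Z)+X^df(X,Z)$; in particular $P_2(0,\gamma Z+\delta(0))=\gamma^rP_1(0,Z)$. Moreover, setting $X_2=\lambda X$, $Y_2=\nu Y+g(X,Z)$, $Z_2=\gamma Z+\delta(X)$ and $G=P_1(X,Z)-X^dY$, one has (a) $k[X,Y,Z]=k[X_2,Y_2,Z_2]$; (b) $P_2(X_2,Z_2)-X_2^dY_2=\gamma^rG$; (c) $(Q_2(X_2,Y_2,Z_2),\,P_2(X_2,Z_2)-X_2^dY_2,\,X_2^e)=(Q_1(X,Y,Z),\,G,\,X^e)$ as ideals of $k[X,Y,Z]$; and in particular $Q_2(0,\nu Y+g(0,Z),\gamma Z+\delta(0))=\nu^sQ_1(0,Y,Z)+h(Y,Z)P_1(0,Z)$ for some $h\in k[Y,Z]$ with $\deg_Yh<s$. Conversely, suppose $(r_1,s_1)=(r_2,s_2)=:(r,s)$ with $s>1$, $(d_1,e_1)=(d_2,e_2)=:(d,e)$,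 and there are $\lambda,\gamma\in k^*$, $\delta\in k[X]$ and $f\in k[X,Z]$ with $\deg_Zf<r$ such that the identity $P_2(\lambda X,\gamma Z+\delta(X))=\gamma^rP_1(X,Z)+X^df(X,Z)$ and the equality of ideals (c) hold, where $\nu=\lambda^{-d}\gamma^r$, $g=\lambda^{-d}f$ and $X_2,Y_2,Z_2,G$ are defined as above. Then $B_1\cong B_2$ as $k$-algebras. -/

import Mathlib

/-- The value `p(x, z)` in a `k`-algebra of a polynomial `p(X, Z)`. The polynomial ring `k[X, Z]` is
represented as `k[X][Z]`, so that "monic in `Z`" and "degree in `Z`" are `Polynomial.Monic` and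
`Polynomial.degree`. -/
noncomputable def evalXZ {k A : Type*} [CommRing k] [CommRing A] [Algebra k A] (x z : A)
    (p : Polynomial (Polynomial k)) : A :=
  p.eval₂ (Polynomial.aeval (R := k) x).toRingHom z

/-- The value `q(x, y, z)` in a `k`-algebra of a polynomial `q(X, Y, Z)`. The polynomial ring
`k[X, Y, Z]`, where degrees in `Y` matter, is represented as `k[X][Z][Y]`: the inner variable is `X`,
the middle one is `Z` and the outer one is `Y`. -/
noncomputable def evalXYZ {k A : Type*} [CommRing k] [CommRing A] [Algebra k A] (x y z : A)
    (q : Polynomial (Polynomial (Polynomial k))) : A :=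
  q.eval₂ (Polynomial.eval₂RingHom (Polynomial.aeval (R := k) x).toRingHom z) y

/-- The data `(d, e, P, Q)` defining a double Danielewski surface: positive integers `d`, `e`, a
polynomial `P(X, Z)` monic in `Z` and a polynomial `Q(X, Y, Z)` monic in `Y`. -/
structure DoubleDanielewski (k : Type*) [Field k] where
  d : ℕ
  e : ℕ
  P : Polynomial (Polynomial k)
  Q : Polynomial (Polynomial (Polynomial k))
  d_pos : 0 < d
  e_pos : 0 < e
  P_monic : P.Monic
  Q_monic : Q.Monic

namespace DoubleDanielewski

variable {k : Type*} [Field k] (S : DoubleDanielewski k)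

/-- `r`, the degree of `P` in `Z`. -/
noncomputable def r : ℕ := S.P.natDegree

/-- `s`, the degree of `Q` in `Y`. -/
noncomputable def s : ℕ := S.Q.natDegree

/-- The condition on `r`, `s`, `e` under which the Makar-Limanov invariant is `k[x]`. -/
def MLCondition : Prop :=
  (2 ≤ S.r ∧ 2 ≤ S.s) ∨ (2 ≤ S.r ∧ S.s = 1) ∨ (S.r = 1 ∧ 2 ≤ S.s ∧ 2 ≤ S.e)

/-- The ideal `(X^d Y - P(X, Z), X^e T - Q(X, Y, Z))` of `k[X, Y, Z, T]`; the variables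
`X`, `Y`, `Z`, `T` are numbered `0`, `1`, `2`, `3`. -/
noncomputable def relIdeal : Ideal (MvPolynomial (Fin 4) k) :=
  Ideal.span
    {MvPolynomial.X 0 ^ S.d * MvPolynomial.X 1 - evalXZ (MvPolynomial.X 0) (MvPolynomial.X 2) S.P,
     MvPolynomial.X 0 ^ S.e * MvPolynomial.X 3 -
      evalXYZ (MvPolynomial.X 0) (MvPolynomial.X 1) (MvPolynomial.X 2) S.Q}

/-- The coordinate ring `B = k[X, Y, Z, T] / (X^d Y - P(X, Z), X^e T - Q(X, Y, Z))`. -/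
abbrev B : Type _ := MvPolynomial (Fin 4) k ⧸ S.relIdeal

/-- The image of `X` in `B`. -/
noncomputable def x : S.B := Ideal.Quotient.mk S.relIdeal (MvPolynomial.X 0)

/-- The image of `Y` in `B`. -/
noncomputable def y : S.B := Ideal.Quotient.mk S.relIdeal (MvPolynomial.X 1)

/-- The image of `Z` in `B`. -/
noncomputable def z : S.B := Ideal.Quotient.mk S.relIdeal (MvPolynomial.X 2)

/-- `P(a, c) - a^d b`. -/
noncomputable def polyG {A : Type*} [CommRing A] [Algebra k A] (a b c : A) : A :=
  evalXZ a c S.P - a ^ S.d * b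

/-- The ideal `(Q(a, b, c), P(a, c) - a^d b, a^e)`. -/
noncomputable def tripleIdeal {A : Type*} [CommRing A] [Algebra k A] (a b c : A) : Ideal A :=
  Ideal.span {evalXYZ a b c S.Q, S.polyG a b c, a ^ S.e}

end DoubleDanielewski

namespace NewCoord

variable {k : Type*} [Field k]

/-- `X₂ = lam X` in `k[X, Y, Z]`, whose variables `X`, `Y`, `Z` are numbered `0`, `1`, `2`. -/
noncomputable def X₂ (lam : k) : MvPolynomial (Fin 3) k := lam • MvPolynomial.X 0

/-- `Y₂ = nu Y + g(X, Z)` in `k[X, Y, Z]`. -/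
noncomputable def Y₂ (nu : k) (g : Polynomial (Polynomial k)) : MvPolynomial (Fin 3) k :=
  nu • MvPolynomial.X 1 + evalXZ (MvPolynomial.X 0) (MvPolynomial.X 2) g

/-- `Z₂ = gam Z + delta(X)` in `k[X, Y, Z]`. -/
noncomputable def Z₂ (gam : k) (delta : Polynomial k) : MvPolynomial (Fin 3) k :=
  gam • MvPolynomial.X 2 + Polynomial.aeval (MvPolynomial.X 0) delta

end NewCoord

/-! The proof rests on a valuation on $B$ whose values are the weights of a monomial basis. After
multiplying $Q$ by a factor congruent to $1$ modulo $x$ and changing $t$ accordingly, the second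
relation becomes $x^e t' = y^s + w$, where $w$ is a combination of monomials $x^l z^i y^j$ with
$i<r$, $j<s$ (`exists_reduced_generator`). Then the monomials $x^l z^i y^j t'^m$ with $i<r$, $j<s$
span $B$. Map $B$ to Hahn series with exponents in lexicographic $\mathbb{Q}^2$, where $x$ and $z$
have orders $(0,1)$ and $(-1,0)$. Then $y$ and $t'$ get orders $(-r,-d)$ and $(-rs,-(ds+e))$, and
the spanning monomials have pairwise distinct orders. Hence the map is injective, and the order of
every nonzero element is the weight of such a monomial (`exists_lexModel`,
`exists_monomial_expansion`).

The ring of invariants of any nontrivial exponential map is contained in $k[x]$ when $r\ge2$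
(`exists_eq_aeval_of_invariant`). The map is replaced by its leading part for the valuation; because
each weight occurs once up to scalars, this is recorded by one polynomial over $k$ for each element,
multiplicative in the element. A further invariant would make the leading polynomials of $x$ and $z$
powers, with coprime exponents $p=rs$ and $q=ds+e$, of a common polynomial. One of $p,q$ is nonzero
in $k$, and expanding the corresponding power produces a weight on which a certain linear form takes
the value $1$; but that form takes only values at least $2$, or $0$, on the weights that occur.

Since $z\mapsto z+x^{d+e}U$ extends to an exponential map fixing $x$, an isomorphism sends $x_2$
into $k[x_1]$, and by symmetry to $\lambda x_1+b$. The fibres of $x_1$ over nonzero points are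
lines, on which $P_2(0,z_2)=0$ would force $z_2$ to be constant; this excludes $b\ne0$. Comparing
orders makes $\psi(z_2)$ linear in $z_1$ over $k[x_1]$, with unit leading coefficient. Such a map
preserves weights, and the two sets of weights determine $r$ and $s$, and also $d$ and $e$ when
$s>1$ (`WeightsDominated.antisymm`).

The formula for $\psi(y_2)$ follows by dividing by $x^d$ in low $z$-degree. Finally, the ideal in
(c) is the kernel of $k[X,Y,Z]\to B/(x^e)$, so it is carried along by isomorphisms. Conversely, a
coordinate change matching these ideals and $G$ up to a unit extends to $B$. -/

section Evaluation

/-! ### Evaluation of polynomials in two and three variables -/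

variable {k A A' : Type*} [CommRing k] [CommRing A] [Algebra k A] [CommRing A'] [Algebra k A']

/-- Evaluation `p ↦ p(x, z)` as an algebra homomorphism. -/
noncomputable def evalXZHom (x z : A) : Polynomial (Polynomial k) →ₐ[k] A :=
  Polynomial.eval₂AlgHom (Polynomial.aeval x) z fun _ => Commute.all _ _

theorem evalXZHom_apply (x z : A) (p : Polynomial (Polynomial k)) :
    evalXZHom x z p = evalXZ x z p := rfl

@[simp] theorem evalXZ_C (x z : A) (p : Polynomial k) :
    evalXZ x z (Polynomial.C p) = Polynomial.aeval x p := by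
  simp [evalXZ]

@[simp] theorem evalXZ_X (x z : A) : evalXZ (k := k) x z Polynomial.X = z := by
  simp [evalXZ]

theorem evalXZ_add (x z : A) (p q : Polynomial (Polynomial k)) :
    evalXZ x z (p + q) = evalXZ x z p + evalXZ x z q := map_add (evalXZHom x z) p q

theorem evalXZ_sub (x z : A) (p q : Polynomial (Polynomial k)) :
    evalXZ x z (p - q) = evalXZ x z p - evalXZ x z q := map_sub (evalXZHom x z) p q

theorem evalXZ_mul (x z : A) (p q : Polynomial (Polynomial k)) :
    evalXZ x z (p * q) = evalXZ x z p * evalXZ x z q := map_mul (evalXZHom x z) p q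

theorem evalXZ_pow (x z : A) (p : Polynomial (Polynomial k)) (n : ℕ) :
    evalXZ x z (p ^ n) = evalXZ x z p ^ n := map_pow (evalXZHom x z) p n

theorem evalXZ_smul (x z : A) (c : k) (p : Polynomial (Polynomial k)) :
    evalXZ x z (c • p) = c • evalXZ x z p := map_smul (evalXZHom x z) c p

theorem evalXZ_eq_sum (x z : A) (p : Polynomial (Polynomial k)) :
    evalXZ x z p = ∑ i ∈ Finset.range (p.natDegree + 1), Polynomial.aeval x (p.coeff i) * z ^ i :=
  Polynomial.eval₂_eq_sum_range _ _

theorem evalXZ_monic {x z : A} {p : Polynomial (Polynomial k)} (hp : p.Monic) :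
    evalXZ x z p =
      z ^ p.natDegree + ∑ i ∈ Finset.range p.natDegree, Polynomial.aeval x (p.coeff i) * z ^ i := by
  rw [evalXZ_eq_sum, Finset.sum_range_succ, hp.coeff_natDegree]
  simp [add_comm]

theorem evalXYZ_monic {x y z : A} {q : Polynomial (Polynomial (Polynomial k))} (hq : q.Monic) :
    evalXYZ x y z q =
      y ^ q.natDegree + ∑ j ∈ Finset.range q.natDegree, evalXZ x z (q.coeff j) * y ^ j := by
  have : evalXYZ x y z q =
      ∑ j ∈ Finset.range (q.natDegree + 1), evalXZ x z (q.coeff j) * y ^ j :=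
    Polynomial.eval₂_eq_sum_range _ _
  rw [this, Finset.sum_range_succ, hq.coeff_natDegree]
  simp [add_comm, ← evalXZHom_apply]

theorem algHom_evalXZ (f : A →ₐ[k] A') (x z : A) (p : Polynomial (Polynomial k)) :
    f (evalXZ x z p) = evalXZ (f x) (f z) p := by
  rw [evalXZ_eq_sum, evalXZ_eq_sum, map_sum]
  simp [Polynomial.aeval_algHom_apply]

theorem algHom_evalXYZ (f : A →ₐ[k] A') (x y z : A)
    (q : Polynomial (Polynomial (Polynomial k))) :
    f (evalXYZ x y z q) = evalXYZ (f x) (f y) (f z) q := by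
  have h : evalXYZ x y z q =
      ∑ j ∈ Finset.range (q.natDegree + 1), evalXZ x z (q.coeff j) * y ^ j :=
    Polynomial.eval₂_eq_sum_range _ _
  have h' : evalXYZ (f x) (f y) (f z) q =
      ∑ j ∈ Finset.range (q.natDegree + 1), evalXZ (f x) (f z) (q.coeff j) * (f y) ^ j :=
    Polynomial.eval₂_eq_sum_range _ _
  rw [h, h', map_sum]
  simp [algHom_evalXZ]

theorem aeval_mem_subalgebra (T : Subalgebra k A) {x : A} (hx : x ∈ T) (p : Polynomial k) :
    Polynomial.aeval x p ∈ T := by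
  have := Polynomial.aeval_algHom_apply T.val (⟨x, hx⟩ : T) p
  simp only [Subalgebra.coe_val] at this
  rw [this]
  exact Subtype.property _

theorem evalXZ_mem_subalgebra (T : Subalgebra k A) {x z : A} (hx : x ∈ T) (hz : z ∈ T)
    (p : Polynomial (Polynomial k)) : evalXZ x z p ∈ T := by
  have := algHom_evalXZ (k := k) T.val (⟨x, hx⟩ : T) ⟨z, hz⟩ p
  simp only [Subalgebra.coe_val] at this
  rw [← this]
  exact Subtype.property _

theorem evalXYZ_mem_subalgebra (T : Subalgebra k A) {x y z : A} (hx : x ∈ T) (hy : y ∈ T)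
    (hz : z ∈ T) (q : Polynomial (Polynomial (Polynomial k))) : evalXYZ x y z q ∈ T := by
  have := algHom_evalXYZ T.val (⟨x, hx⟩ : T) ⟨y, hy⟩ ⟨z, hz⟩ q
  simp only [Subalgebra.coe_val] at this
  rw [← this]
  exact Subtype.property _

end Evaluation

/-! ### Multipliers of a subspace -/

section Stabilizer

variable {k A : Type*} [CommRing k] [CommRing A] [Algebra k A]

/-- The subalgebra of all multipliers that map a submodule into itself. -/
def Submodule.multipliers (N : Submodule k A) : Subalgebra k A where
  carrier := {a | ∀ n ∈ N, a * n ∈ N}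
  mul_mem' ha hb n hn := by rw [mul_assoc]; exact ha _ (hb _ hn)
  add_mem' ha hb n hn := by rw [add_mul]; exact N.add_mem (ha _ hn) (hb _ hn)
  algebraMap_mem' c n hn := by rw [← Algebra.smul_def]; exact N.smul_mem _ hn

theorem Submodule.mem_multipliers_span {s : Set A} {a : A}
    (h : ∀ b ∈ s, a * b ∈ Submodule.span k s) : a ∈ (Submodule.span k s).multipliers := by
  intro n hn
  induction hn using Submodule.span_induction with
  | mem b hb => exact h b hb
  | zero => simp
  | add b c _ _ hb hc => rw [mul_add]; exact Submodule.add_mem _ hb hc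
  | smul c b _ hb => rw [mul_smul_comm]; exact Submodule.smul_mem _ _ hb

/-- A subspace containing $1$ and stable under the generators is stable under the whole subalgebra.
Spanning statements thereby reduce to rewriting one generator times one monomial. -/
theorem Submodule.adjoin_le_of_mem_multipliers {N : Submodule k A} {s : Set A} (h1 : (1 : A) ∈ N)
    (hs : ∀ a ∈ s, a ∈ N.multipliers) : ∀ a ∈ Algebra.adjoin k s, a ∈ N := by
  intro a ha
  have := Algebra.adjoin_le (S := N.multipliers) hs ha
  simpa using this 1 h1

end Stabilizer

/-! ### Reduction of the second relation and a monomial spanning set -/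

section NormalForm

variable {k A : Type*} [Field k] [CommRing A] [Algebra k A]

/-- The span of the monomials `x ^ l * z ^ i * y ^ j` with `i < r` and `j < s`. -/
def boxSpan (k : Type*) {A : Type*} [Field k] [CommRing A] [Algebra k A] (r s : ℕ) (x y z : A) :
    Submodule k A :=
  Submodule.span k {a | ∃ l i j, i < r ∧ j < s ∧ a = x ^ l * z ^ i * y ^ j}

/-- The span of the monomials `x ^ l * z ^ i * y ^ j * t ^ m` with `i < r` and `j < s`. -/
def stripSpan (k : Type*) {A : Type*} [Field k] [CommRing A] [Algebra k A] (r s : ℕ)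
    (x y z t : A) : Submodule k A :=
  Submodule.span k {a | ∃ l i j m, i < r ∧ j < s ∧ a = x ^ l * z ^ i * y ^ j * t ^ m}

variable {r s d e : ℕ} {x y z t : A}

theorem monomial_mem_boxSpan (l : ℕ) {i j : ℕ} (hi : i < r) (hj : j < s) :
    x ^ l * z ^ i * y ^ j ∈ boxSpan k r s x y z :=
  Submodule.subset_span ⟨l, i, j, hi, hj, rfl⟩

theorem x_mem_multipliers_boxSpan : x ∈ (boxSpan k r s x y z).multipliers := by
  refine Submodule.mem_multipliers_span ?_
  rintro _ ⟨l, i, j, hi, hj, rfl⟩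
  exact Submodule.subset_span ⟨l + 1, i, j, hi, hj, by ring⟩

/-- The multiples of `a` by elements of a subalgebra. -/
def Subalgebra.multiples (C : Subalgebra k A) (a : A) : Submodule k A :=
  (Subalgebra.toSubmodule C).map (LinearMap.mulLeft k a)

theorem Subalgebra.mem_multiples {C : Subalgebra k A} {a b : A} :
    b ∈ C.multiples a ↔ ∃ c ∈ C, a * c = b := by
  simp [Subalgebra.multiples]

theorem Subalgebra.mem_multipliers_multiples {C : Subalgebra k A} {a c : A} (hc : c ∈ C) :
    c ∈ (C.multiples a).multipliers := by
  rintro n hn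
  obtain ⟨b, hb, rfl⟩ := Subalgebra.mem_multiples.1 hn
  exact Subalgebra.mem_multiples.2 ⟨c * b, mul_mem hc hb, by ring⟩

theorem Submodule.mem_multipliers_sup {N N' : Submodule k A} {a : A}
    (h : ∀ n ∈ N, a * n ∈ N ⊔ N') (h' : a ∈ N'.multipliers) : a ∈ (N ⊔ N').multipliers := by
  intro n hn
  obtain ⟨b, hb, c, hc, rfl⟩ := Submodule.mem_sup.1 hn
  rw [mul_add]
  exact Submodule.add_mem _ (h b hb) (Submodule.mem_sup_right (h' c hc))

variable {P : Polynomial (Polynomial k)} {Q : Polynomial (Polynomial (Polynomial k))}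

/-- Modulo $x$ the relation $x^dy=P(x,z)$ expresses $z^r$ through lower powers of $z$, because
$d>0$. -/
theorem z_mem_multipliers_box_sup (hd : 0 < d) (hP : P.Monic) (hPr : P.natDegree = r)
    (h1 : x ^ d * y = evalXZ x z P) :
    z ∈ (boxSpan k r s x y z ⊔ (Algebra.adjoin k {x, y, z}).multiples x).multipliers := by
  have hx : x ∈ Algebra.adjoin k {x, y, z} := Algebra.subset_adjoin (by simp)
  have hy : y ∈ Algebra.adjoin k {x, y, z} := Algebra.subset_adjoin (by simp)
  have hz : z ∈ Algebra.adjoin k {x, y, z} := Algebra.subset_adjoin (by simp)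
  refine Submodule.mem_multipliers_sup ?_ (Subalgebra.mem_multipliers_multiples hz)
  intro n hn
  induction hn using Submodule.span_induction with
  | zero => simp
  | add b c _ _ hb hc => rw [mul_add]; exact Submodule.add_mem _ hb hc
  | smul c b _ hb => rw [mul_smul_comm]; exact Submodule.smul_mem _ _ hb
  | mem b hb =>
    obtain ⟨l, i, j, hi, hj, rfl⟩ := hb
    by_cases hi' : i + 1 < r
    · refine Submodule.mem_sup_left (Submodule.subset_span ⟨l, i + 1, j, hi', hj, by ring⟩)
    · obtain rfl : r = i + 1 := by omega
      have e1 : z ^ (i + 1) = x ^ d * y -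
          ∑ n ∈ Finset.range (i + 1), Polynomial.aeval x (P.coeff n) * z ^ n := by
        rw [h1, evalXZ_monic hP, hPr]; ring
      have e2 : z * (x ^ l * z ^ i * y ^ j) =
          x * (x ^ (d - 1) * x ^ l * y ^ (j + 1)) -
          ∑ n ∈ Finset.range (i + 1), Polynomial.aeval x (P.coeff n) *
            (x ^ l * z ^ n * y ^ j) := by
        obtain ⟨d, rfl⟩ : ∃ d', d = d' + 1 := ⟨d - 1, by omega⟩
        calc z * (x ^ l * z ^ i * y ^ j) = z ^ (i + 1) * (x ^ l * y ^ j) := by ring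
          _ = _ := by
            rw [e1, sub_mul, Finset.sum_mul]
            congr 1
            · simp; ring
            · exact Finset.sum_congr rfl fun _ _ => by ring
      rw [e2]
      refine Submodule.sub_mem _ (Submodule.mem_sup_right (Subalgebra.mem_multiples.2
        ⟨_, mul_mem (mul_mem (pow_mem hx _) (pow_mem hx _)) (pow_mem hy _), rfl⟩)) ?_
      refine Submodule.sum_mem _ fun n hn => Submodule.mem_sup_left ?_
      exact aeval_mem_subalgebra _ x_mem_multipliers_boxSpan _ _
        (monomial_mem_boxSpan l (Finset.mem_range.1 hn) hj)

theorem x_mem_multipliers_box_sup :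
    x ∈ (boxSpan k r s x y z ⊔ (Algebra.adjoin k {x, y, z}).multiples x).multipliers :=
  Submodule.mem_multipliers_sup
    (fun n hn => Submodule.mem_sup_left (x_mem_multipliers_boxSpan n hn))
    (Subalgebra.mem_multipliers_multiples (Algebra.subset_adjoin (by simp)))

theorem eval_sub_pow_mem_box_sup (hd : 0 < d) (hr : 0 < r) (hP : P.Monic) (hPr : P.natDegree = r)
    (h1 : x ^ d * y = evalXZ x z P) (hQ : Q.Monic) (hQs : Q.natDegree = s) :
    evalXYZ x y z Q - y ^ s ∈
      boxSpan k r s x y z ⊔ (Algebra.adjoin k {x, y, z}).multiples x := by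
  rw [evalXYZ_monic hQ, hQs, add_sub_cancel_left]
  refine Submodule.sum_mem _ fun j hj => ?_
  refine evalXZ_mem_subalgebra _ x_mem_multipliers_box_sup
    (z_mem_multipliers_box_sup hd hP hPr h1) _ _ (Submodule.mem_sup_left ?_)
  simpa using monomial_mem_boxSpan (k := k) (x := x) (z := z) (y := y) 0 hr (Finset.mem_range.1 hj)

/-- Division with remainder in $k[x,y,z]$ modulo $x$ and $Q$: the first relation reduces powers of
$z$, and $Q$, monic in $y$, reduces powers of $y$. -/
theorem mem_box_sup_sup (hd : 0 < d) (hr : 0 < r) (hs : 0 < s) (hP : P.Monic)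
    (hPr : P.natDegree = r) (h1 : x ^ d * y = evalXZ x z P) (hQ : Q.Monic)
    (hQs : Q.natDegree = s) : ∀ c ∈ Algebra.adjoin k {x, y, z},
      c ∈ (boxSpan k r s x y z ⊔ (Algebra.adjoin k {x, y, z}).multiples x) ⊔
        (Algebra.adjoin k {x, y, z}).multiples (evalXYZ x y z Q) := by
  have hx : x ∈ Algebra.adjoin k {x, y, z} := Algebra.subset_adjoin (by simp)
  have hy : y ∈ Algebra.adjoin k {x, y, z} := Algebra.subset_adjoin (by simp)
  have hz : z ∈ Algebra.adjoin k {x, y, z} := Algebra.subset_adjoin (by simp)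
  have mx := Submodule.mem_multipliers_sup
    (N := boxSpan k r s x y z ⊔ (Algebra.adjoin k {x, y, z}).multiples x) (N' := (Algebra.adjoin k {x, y, z}).multiples (evalXYZ x y z Q))
    (fun n hn => Submodule.mem_sup_left (x_mem_multipliers_box_sup (r := r) (s := s) n hn))
    (Subalgebra.mem_multipliers_multiples hx)
  have mz := Submodule.mem_multipliers_sup
    (N' := (Algebra.adjoin k {x, y, z}).multiples (evalXYZ x y z Q))
    (fun n hn => Submodule.mem_sup_left
      (z_mem_multipliers_box_sup (s := s) hd hP hPr h1 n hn))
    (Subalgebra.mem_multipliers_multiples hz)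
  refine Submodule.adjoin_le_of_mem_multipliers ?_ ?_
  · refine Submodule.mem_sup_left (Submodule.mem_sup_left ?_)
    simpa using monomial_mem_boxSpan (k := k) (x := x) (z := z) (y := y) 0 hr hs
  · rintro a (rfl | rfl | rfl)
    · exact mx
    · refine Submodule.mem_multipliers_sup ?_ (Subalgebra.mem_multipliers_multiples hy)
      intro n hn
      obtain ⟨b, hb, c, hc, rfl⟩ := Submodule.mem_sup.1 hn
      rw [mul_add]
      refine Submodule.add_mem _ ?_ (Submodule.mem_sup_left (Submodule.mem_sup_right
        (Subalgebra.mem_multipliers_multiples hy _ hc)))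
      clear hn hc c
      induction hb using Submodule.span_induction with
      | zero => simp
      | add b c _ _ hb hc => rw [mul_add]; exact Submodule.add_mem _ hb hc
      | smul c b _ hb => rw [mul_smul_comm]; exact Submodule.smul_mem _ _ hb
      | mem b hb =>
        obtain ⟨l, i, j, hi, hj, rfl⟩ := hb
        by_cases hj' : j + 1 < s
        · exact Submodule.mem_sup_left (Submodule.mem_sup_left
            (Submodule.subset_span ⟨l, i, j + 1, hi, hj', by ring⟩))
        · obtain rfl : s = j + 1 := by omega
          have e2 : a * (x ^ l * z ^ i * a ^ j) = x ^ l * z ^ i *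
              (evalXYZ x a z Q * 1 - (evalXYZ x a z Q - a ^ (j + 1))) := by ring
          rw [e2]
          refine mul_mem (pow_mem mx l) (pow_mem mz i) _ (Submodule.sub_mem _ ?_ ?_)
          · exact Submodule.mem_sup_right (Subalgebra.mem_multiples.2 ⟨1, one_mem _, rfl⟩)
          · exact Submodule.mem_sup_left (eval_sub_pow_mem_box_sup hd hr hP hPr h1 hQ hQs)
    · exact mz

/-- Up to a factor congruent to `1` modulo `x`, the polynomial `Q` agrees modulo any power of `x`
with a polynomial that is monic in `y` and reduced with respect to `z`. -/
theorem exists_mul_eval_eq (hd : 0 < d) (hr : 0 < r) (hs : 0 < s) (hP : P.Monic)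
    (hPr : P.natDegree = r) (h1 : x ^ d * y = evalXZ x z P) (hQ : Q.Monic)
    (hQs : Q.natDegree = s) (n : ℕ) : ∃ a ∈ Algebra.adjoin k {x, y, z},
      ∃ w ∈ boxSpan k r s x y z, ∃ c ∈ Algebra.adjoin k {x, y, z},
        (1 + x * a) * evalXYZ x y z Q = y ^ s + w + x ^ (n + 1) * c := by
  induction n with
  | zero =>
    obtain ⟨w, hw, b, hb, hwb⟩ := Submodule.mem_sup.1
      (eval_sub_pow_mem_box_sup hd hr hP hPr h1 hQ hQs)
    obtain ⟨c, hc, rfl⟩ := Subalgebra.mem_multiples.1 hb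
    exact ⟨0, zero_mem _, w, hw, c, hc, by linear_combination -hwb⟩
  | succ n ih =>
    obtain ⟨a, ha, w, hw, c, hc, h⟩ := ih
    obtain ⟨u, hu, v, hv, huv⟩ := Submodule.mem_sup.1
      (mem_box_sup_sup hd hr hs hP hPr h1 hQ hQs c hc)
    obtain ⟨w', hw', b, hb, hwb⟩ := Submodule.mem_sup.1 hu
    obtain ⟨c', hc', rfl⟩ := Subalgebra.mem_multiples.1 hb
    obtain ⟨b', hb', rfl⟩ := Subalgebra.mem_multiples.1 hv
    have hx : x ∈ Algebra.adjoin k {x, y, z} := Algebra.subset_adjoin (by simp)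
    -- The multiple of $Q$ occurring in the error term moves to the left, where $x^{n+1}b' = x\cdot
    -- x^nb'$ only changes the cofactor $a$.
    refine ⟨a - x ^ n * b', sub_mem ha (mul_mem (pow_mem hx _) hb'),
      w + x ^ (n + 1) * w', Submodule.add_mem _ hw
        (pow_mem (x_mem_multipliers_boxSpan (k := k)) (n + 1) w' hw'), c', hc', ?_⟩
    linear_combination h - x ^ (n + 1) * huv - x ^ (n + 1) * hwb

/-- In general $Q$ has lower terms of large $z$-degree that could dominate $y^s$. Working to
precision $x^e$ makes the remaining error $x^ec$, which is absorbed into $t'=(1+xa)t-c$. -/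
theorem exists_reduced_generator (hd : 0 < d) (he : 0 < e) (hr : 0 < r) (hs : 0 < s)
    (hP : P.Monic) (hPr : P.natDegree = r) (h1 : x ^ d * y = evalXZ x z P) (hQ : Q.Monic)
    (hQs : Q.natDegree = s) (h2 : x ^ e * t = evalXYZ x y z Q) :
    ∃ t' : A, t ∈ Algebra.adjoin k {x, y, z, t'} ∧
      ∃ w ∈ boxSpan k r s x y z, x ^ e * t' = y ^ s + w := by
  obtain ⟨n, rfl⟩ : ∃ n, e = n + 1 := ⟨e - 1, by omega⟩
  obtain ⟨a, ha, w, hw, c, hc, h⟩ := exists_mul_eval_eq hd hr hs hP hPr h1 hQ hQs n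
  refine ⟨(1 + x * a) * t - c, ?_, w, hw, by linear_combination h + (1 + x * a) * h2⟩
  set t' := (1 + x * a) * t - c with ht'
  have hle : Algebra.adjoin k {x, y, z} ≤ Algebra.adjoin k {x, y, z, t'} :=
    Algebra.adjoin_mono (by intro u; simp; tauto)
  have hx : x ∈ Algebra.adjoin k {x, y, z, t'} := Algebra.subset_adjoin (by simp)
  have hy : y ∈ Algebra.adjoin k {x, y, z, t'} := Algebra.subset_adjoin (by simp)
  have hz : z ∈ Algebra.adjoin k {x, y, z, t'} := Algebra.subset_adjoin (by simp)
  have htm : t' ∈ Algebra.adjoin k {x, y, z, t'} := Algebra.subset_adjoin (by simp)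
  -- To recover $t$ from $t'$, invert $1+xa$ by a geometric series. After $e$ steps the remainder
  -- contains $x^et=Q(x,y,z)$, which already lies in $k[x,y,z]$.
  have key : ∀ m : ℕ, ∃ u ∈ Algebra.adjoin k {x, y, z, t'}, t = u + (-(x * a)) ^ m * t := by
    intro m
    induction m with
    | zero => exact ⟨0, zero_mem _, by simp⟩
    | succ m ih =>
      obtain ⟨u, hu, h⟩ := ih
      refine ⟨u + (-(x * a)) ^ m * (t' + c), add_mem hu (mul_mem (pow_mem (neg_mem
        (mul_mem hx (hle ha))) _) (add_mem htm (hle hc))), ?_⟩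
      linear_combination h - (-(x * a)) ^ m * ht'
  obtain ⟨u, hu, h'⟩ := key (n + 1)
  rw [h', show (-(x * a)) ^ (n + 1) * t = (-a) ^ (n + 1) * (x ^ (n + 1) * t) by
    rw [← mul_neg, mul_pow]; ring, h2]
  exact add_mem hu (mul_mem (pow_mem (neg_mem (hle ha)) _) (evalXYZ_mem_subalgebra _ hx hy hz _))

/-- Both relations act as rewriting rules: $z^r$ becomes $x^dy$ minus lower powers of $z$, and $y^s$
becomes $x^et-w$. -/
theorem stripSpan_eq_top (hr : 0 < r) (hs : 0 < s) (hP : P.Monic)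
    (hPr : P.natDegree = r) (h1 : x ^ d * y = evalXZ x z P) {w : A}
    (hw : w ∈ boxSpan k r s x y z) (h2 : x ^ e * t = y ^ s + w) :
    ∀ a ∈ Algebra.adjoin k {x, y, z, t}, a ∈ stripSpan k r s x y z t := by
  have mx : x ∈ (stripSpan k r s x y z t).multipliers := by
    refine Submodule.mem_multipliers_span ?_
    rintro _ ⟨l, i, j, m, hi, hj, rfl⟩
    exact Submodule.subset_span ⟨l + 1, i, j, m, hi, hj, by ring⟩
  have mt : t ∈ (stripSpan k r s x y z t).multipliers := by
    refine Submodule.mem_multipliers_span ?_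
    rintro _ ⟨l, i, j, m, hi, hj, rfl⟩
    exact Submodule.subset_span ⟨l, i, j, m + 1, hi, hj, by ring⟩
  have hbox : ∀ a ∈ boxSpan k r s x y z, a ∈ stripSpan k r s x y z t := by
    intro a ha
    refine Submodule.span_mono ?_ ha
    rintro _ ⟨l, i, j, hi, hj, rfl⟩
    exact ⟨l, i, j, 0, hi, hj, by ring⟩
  -- The exponent $j=s$ is included because both rewriting rules can raise the exponent of $y$ from
  -- $s-1$ to $s$.
  have hyj : ∀ j ≤ s, y ^ j ∈ stripSpan k r s x y z t := by
    intro j hj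
    rcases hj.lt_or_eq with hj | rfl
    · exact Submodule.subset_span ⟨0, 0, j, 0, hr, hj, by ring⟩
    · rw [show y ^ j = x ^ e * (t * 1) - w by linear_combination -h2]
      refine Submodule.sub_mem _ (pow_mem mx e _ (mt 1 ?_)) (hbox w hw)
      exact Submodule.subset_span ⟨0, 0, 0, 0, hr, hs, by ring⟩
  have mz : z ∈ (stripSpan k r s x y z t).multipliers := by
    refine Submodule.mem_multipliers_span ?_
    rintro _ ⟨l, i, j, m, hi, hj, rfl⟩
    by_cases hi' : i + 1 < r
    · exact Submodule.subset_span ⟨l, i + 1, j, m, hi', hj, by ring⟩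
    · obtain rfl : r = i + 1 := by omega
      have e1 : z ^ (i + 1) = x ^ d * y -
          ∑ n ∈ Finset.range (i + 1), Polynomial.aeval x (P.coeff n) * z ^ n := by
        rw [h1, evalXZ_monic hP, hPr]; ring
      have e2 : z * (x ^ l * z ^ i * y ^ j * t ^ m) =
          x ^ (d + l) * (t ^ m * y ^ (j + 1)) -
          ∑ n ∈ Finset.range (i + 1), Polynomial.aeval x (P.coeff n) *
            (x ^ l * z ^ n * y ^ j * t ^ m) := by
        calc z * (x ^ l * z ^ i * y ^ j * t ^ m) = z ^ (i + 1) * (x ^ l * y ^ j * t ^ m) := by ring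
          _ = _ := by
            rw [e1, sub_mul, Finset.sum_mul]
            congr 1
            · ring
            · exact Finset.sum_congr rfl fun _ _ => by ring
      rw [e2]
      refine Submodule.sub_mem _ (pow_mem mx _ _ (pow_mem mt _ _ (hyj _ hj))) ?_
      refine Submodule.sum_mem _ fun n hn => aeval_mem_subalgebra _ mx _ _ ?_
      exact Submodule.subset_span ⟨l, n, j, m, Finset.mem_range.1 hn, hj, rfl⟩
  refine Submodule.adjoin_le_of_mem_multipliers ?_ ?_
  · simpa using hyj 0 (Nat.zero_le _)
  · rintro a (rfl | rfl | rfl | rfl)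
    · exact mx
    · refine Submodule.mem_multipliers_span ?_
      rintro _ ⟨l, i, j, m, hi, hj, rfl⟩
      rw [show a * (x ^ l * z ^ i * a ^ j * t ^ m) = x ^ l * (z ^ i * (t ^ m * a ^ (j + 1))) by
        ring]
      exact pow_mem mx _ _ (pow_mem mz _ _ (pow_mem mt _ _ (hyj _ hj)))
    · exact mz
    · exact mt

end NormalForm

/-! ### Orders of lexicographic Hahn series -/

section LexHahn

open HahnSeries

variable {k : Type*} [Field k]

theorem HahnSeries.lt_orderTop_add {Γ R : Type*} [LinearOrder Γ] [AddMonoid R]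
    {f g : HahnSeries Γ R} {γ : WithTop Γ} (hf : γ < f.orderTop) (hg : γ < g.orderTop) :
    γ < (f + g).orderTop :=
  (lt_min hf hg).trans_le min_orderTop_le_orderTop_add

theorem HahnSeries.le_orderTop_add {Γ R : Type*} [LinearOrder Γ] [AddMonoid R]
    {f g : HahnSeries Γ R} {γ : WithTop Γ} (hf : γ ≤ f.orderTop) (hg : γ ≤ g.orderTop) :
    γ ≤ (f + g).orderTop :=
  (le_min hf hg).trans min_orderTop_le_orderTop_add

theorem HahnSeries.lt_orderTop_sum {Γ R ι : Type*} [LinearOrder Γ] [AddCommMonoid R]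
    {f : ι → HahnSeries Γ R} {s : Finset ι} {γ : Γ}
    (h : ∀ i ∈ s, (γ : WithTop Γ) < (f i).orderTop) : γ < (∑ i ∈ s, f i).orderTop := by
  classical
  induction s using Finset.induction_on with
  | empty => simp
  | insert a s ha ih =>
    rw [Finset.sum_insert ha]
    exact lt_orderTop_add (h a (by simp)) (ih fun i hi => h i (by simp [hi]))

theorem HahnSeries.le_orderTop_sum {Γ R ι : Type*} [LinearOrder Γ] [AddCommMonoid R]
    {f : ι → HahnSeries Γ R} {s : Finset ι} {γ : WithTop Γ}
    (h : ∀ i ∈ s, γ ≤ (f i).orderTop) : γ ≤ (∑ i ∈ s, f i).orderTop := by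
  classical
  induction s using Finset.induction_on with
  | empty => simp
  | insert a s ha ih =>
    rw [Finset.sum_insert ha]
    exact le_orderTop_add (h a (by simp)) (ih fun i hi => h i (by simp [hi]))

/-- The order of a finite sum of series with pairwise distinct orders is the least of these. -/
theorem HahnSeries.exists_orderTop_sum_eq {Γ R ι : Type*} [LinearOrder Γ] [AddCommMonoid R]
    {f : ι → HahnSeries Γ R} {W : ι → Γ} {s : Finset ι} (hs : s.Nonempty)
    (hW : ∀ i ∈ s, (f i).orderTop = W i) (inj : Set.InjOn W s) :
    ∃ i ∈ s, (∀ j ∈ s, W i ≤ W j) ∧ (∑ j ∈ s, f j).orderTop = W i := by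
  classical
  obtain ⟨i, hi, hmin⟩ := s.exists_min_image W hs
  refine ⟨i, hi, hmin, ?_⟩
  rw [← Finset.add_sum_erase s f hi, orderTop_add_eq_left, hW i hi]
  rw [hW i hi]
  refine lt_orderTop_sum fun j hj => ?_
  rw [Finset.mem_erase] at hj
  rw [hW j hj.2, WithTop.coe_lt_coe]
  exact lt_of_le_of_ne (hmin j hj.2) fun h => hj.1 (inj hj.2 hi h.symm)

/-- The series `X`, of order `(0, 1)`. -/
noncomputable def lexX (k : Type*) [Field k] : HahnSeries (ℚ ×ₗ ℚ) k := single (toLex (0, 1)) 1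

/-- The series `Z`, of order `(-1, 0)`. -/
noncomputable def lexZ (k : Type*) [Field k] : HahnSeries (ℚ ×ₗ ℚ) k := single (toLex (-1, 0)) 1

theorem orderTop_lexX : (lexX k).orderTop = ((toLex (0, 1) : ℚ ×ₗ ℚ) : WithTop (ℚ ×ₗ ℚ)) :=
  orderTop_single one_ne_zero

theorem orderTop_lexZ : (lexZ k).orderTop = ((toLex (-1, 0) : ℚ ×ₗ ℚ) : WithTop (ℚ ×ₗ ℚ)) :=
  orderTop_single one_ne_zero

theorem lex_add (u v u' v' : ℚ) :
    (toLex (u, v) : ℚ ×ₗ ℚ) + toLex (u', v') = toLex (u + u', v + v') := rfl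

theorem lex_nsmul (n : ℕ) (u v : ℚ) : n • (toLex (u, v) : ℚ ×ₗ ℚ) = toLex (n * u, n * v) := by
  induction n with
  | zero => simp; rfl
  | succ n ih =>
    rw [succ_nsmul, ih, lex_add]
    push_cast
    ring_nf

theorem orderTop_pow_of_eq {h : HahnSeries (ℚ ×ₗ ℚ) k} {u v : ℚ}
    (hh : h.orderTop = ((toLex (u, v) : ℚ ×ₗ ℚ) : WithTop (ℚ ×ₗ ℚ))) (n : ℕ) :
    (h ^ n).orderTop = ((toLex (n * u, n * v) : ℚ ×ₗ ℚ) : WithTop (ℚ ×ₗ ℚ)) := by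
  induction n with
  | zero => simp
  | succ n ih =>
    rw [pow_succ, orderTop_mul, ih, hh, ← WithTop.coe_add, lex_add]
    push_cast
    ring_nf

theorem orderTop_mul_of_eq {h h' : HahnSeries (ℚ ×ₗ ℚ) k} {u v u' v' : ℚ}
    (hh : h.orderTop = ((toLex (u, v) : ℚ ×ₗ ℚ) : WithTop (ℚ ×ₗ ℚ)))
    (hh' : h'.orderTop = ((toLex (u', v') : ℚ ×ₗ ℚ) : WithTop (ℚ ×ₗ ℚ))) :
    (h * h').orderTop = ((toLex (u + u', v + v') : ℚ ×ₗ ℚ) : WithTop (ℚ ×ₗ ℚ)) := by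
  rw [orderTop_mul, hh, hh', ← WithTop.coe_add, lex_add]

theorem orderTop_smul_of_ne_zero {Γ : Type*} [LinearOrder Γ] {c : k} (hc : c ≠ 0)
    (h : HahnSeries Γ k) : (c • h).orderTop = h.orderTop := by
  refine le_antisymm ?_ (orderTop_le_orderTop_smul c h)
  simpa [smul_smul, hc] using orderTop_le_orderTop_smul c⁻¹ (c • h)

theorem orderTop_aeval_lexX {p : Polynomial k} (hp : p ≠ 0) :
    (Polynomial.aeval (lexX k) p).orderTop =
      ((toLex (0, (p.natTrailingDegree : ℚ)) : ℚ ×ₗ ℚ) : WithTop (ℚ ×ₗ ℚ)) := by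
  obtain ⟨m, hm, hmin, h⟩ := exists_orderTop_sum_eq (s := p.support)
    (f := fun i => p.coeff i • lexX k ^ i) (W := fun i : ℕ => (toLex (0, (i : ℚ)) : ℚ ×ₗ ℚ))
    (Polynomial.support_nonempty.2 hp) (fun i hi => by
      rw [orderTop_smul_of_ne_zero (Polynomial.mem_support_iff.1 hi),
        orderTop_pow_of_eq orderTop_lexX]
      simp) (fun i _ j _ h => by
      simpa using h)
  have hm' : m = p.natTrailingDegree := by
    refine le_antisymm ?_ (Polynomial.natTrailingDegree_le_of_mem_supp m hm)
    have := hmin _ (Polynomial.natTrailingDegree_mem_support_of_nonzero hp)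
    rw [Prod.Lex.toLex_le_toLex] at this
    simpa using this
  rw [← hm', ← h, Polynomial.aeval_def, Polynomial.eval₂_eq_sum]
  simp [Polynomial.sum_def, Algebra.smul_def]

/-- The order of `q(X, h)` when `h` has negative first exponent. -/
theorem orderTop_evalXZ {h : HahnSeries (ℚ ×ₗ ℚ) k} {n v : ℚ} (hn : 0 < n)
    (hh : h.orderTop = ((toLex (-n, v) : ℚ ×ₗ ℚ) : WithTop (ℚ ×ₗ ℚ)))
    {q : Polynomial (Polynomial k)} (hq : q ≠ 0) :
    (evalXZ (lexX k) h q).orderTop = ((toLex (-(q.natDegree * n),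
      q.leadingCoeff.natTrailingDegree + q.natDegree * v) : ℚ ×ₗ ℚ) : WithTop (ℚ ×ₗ ℚ)) := by
  obtain ⟨i, hi, hmin, h⟩ := exists_orderTop_sum_eq (s := q.support)
    (f := fun i => Polynomial.aeval (lexX k) (q.coeff i) * h ^ i)
    (W := fun i : ℕ => (toLex (-(i * n), (q.coeff i).natTrailingDegree + i * v) : ℚ ×ₗ ℚ))
    (Polynomial.support_nonempty.2 hq) (fun i hi => by
      rw [orderTop_mul_of_eq (orderTop_aeval_lexX (Polynomial.mem_support_iff.1 hi))
        (orderTop_pow_of_eq hh i)]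
      simp) (fun i _ j _ h => by
      have := congrArg (fun a : ℚ ×ₗ ℚ => (ofLex a).1) h
      simpa [hn.ne'] using this)
  have hid : i = q.natDegree := by
    refine le_antisymm (Polynomial.le_natDegree_of_mem_supp i hi) ?_
    have := hmin _ (Polynomial.natDegree_mem_support_of_nonzero hq)
    rw [Prod.Lex.toLex_le_toLex] at this
    have h2 : (q.natDegree : ℚ) * n ≤ i * n := by
      rcases this with h | ⟨h, -⟩ <;> dsimp only at h <;> linarith
    exact_mod_cast le_of_mul_le_mul_right h2 hn
  subst hid
  rw [Polynomial.leadingCoeff, ← h, evalXZ, Polynomial.eval₂_eq_sum, Polynomial.sum_def]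
  rfl

end LexHahn

/-! ### Monomial bases with distinct orders -/

open HahnSeries in
/-- A presentation of the `k`-algebra `A` as the span of the monomials `x ^ l * z ^ i * y ^ j * t ^ m`
with `i < r`, `j < s`, together with a homomorphism to a ring of Hahn series under which these
monomials have pairwise distinct orders. -/
structure LexModel (k A : Type*) [Field k] [CommRing A] [Algebra k A] (d e r s : ℕ) where
  x : A
  y : A
  z : A
  t : A
  toHahn : A →ₐ[k] HahnSeries (ℚ ×ₗ ℚ) k
  map_x : toHahn x = lexX k
  map_z : toHahn z = lexZ k
  orderTop_y : (toHahn y).orderTop =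
    ((toLex (-(r : ℚ), -(d : ℚ)) : ℚ ×ₗ ℚ) : WithTop (ℚ ×ₗ ℚ))
  orderTop_t : (toHahn t).orderTop =
    ((toLex (-(r * s : ℚ), -(d * s + e : ℚ)) : ℚ ×ₗ ℚ) : WithTop (ℚ ×ₗ ℚ))
  mem_stripSpan : ∀ a, a ∈ stripSpan k r s x y z t

/-- The order of the monomial `x ^ l * z ^ i * y ^ j * t ^ m`. -/
def lexWeight (d e r s l i j m : ℕ) : ℚ ×ₗ ℚ :=
  toLex (-(i + r * j + r * s * m : ℚ), (l - d * j - (d * s + e) * m : ℚ))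

/-- The first exponent is, up to sign, $i+r(j+sm)$, a mixed radix expansion that determines $i$, $j$
and $m$; the second exponent then determines $l$. -/
theorem lexWeight_injective {d e r s l i j m l' i' j' m' : ℕ} (hi : i < r) (hj : j < s)
    (hi' : i' < r) (hj' : j' < s)
    (h : lexWeight d e r s l i j m = lexWeight d e r s l' i' j' m') :
    l = l' ∧ i = i' ∧ j = j' ∧ m = m' := by
  have h0 := congrArg ofLex h
  simp only [lexWeight, ofLex_toLex, Prod.mk.injEq, neg_inj] at h0
  obtain ⟨h1, h2⟩ := h0
  have h1 : i + r * (j + s * m) = i' + r * (j' + s * m') := by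
    have : (i + r * j + r * s * m : ℚ) = ((i + r * (j + s * m) : ℕ) : ℚ) := by push_cast; ring
    rw [this] at h1
    have : (i' + r * j' + r * s * m' : ℚ) = ((i' + r * (j' + s * m') : ℕ) : ℚ) := by
      push_cast; ring
    rw [this] at h1
    exact_mod_cast h1
  have hii : i = i' := by
    have := congrArg (· % r) h1
    simpa [Nat.add_mul_mod_self_left, Nat.mod_eq_of_lt hi, Nat.mod_eq_of_lt hi'] using this
  subst hii
  have h3 : j + s * m = j' + s * m' :=
    Nat.eq_of_mul_eq_mul_left (by omega : 0 < r) (by omega)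
  have hjj : j = j' := by
    have := congrArg (· % s) h3
    simpa [Nat.add_mul_mod_self_left, Nat.mod_eq_of_lt hj, Nat.mod_eq_of_lt hj'] using this
  subst hjj
  have hmm : m = m' := Nat.eq_of_mul_eq_mul_left (by omega : 0 < s) (by omega)
  subst hmm
  refine ⟨?_, rfl, rfl, rfl⟩
  have : (l : ℚ) = l' := by linarith
  exact_mod_cast this

namespace LexModel

open HahnSeries

variable {k A : Type*} [Field k] [CommRing A] [Algebra k A] {d e r s : ℕ}
  (M : LexModel k A d e r s)

theorem orderTop_x : (M.toHahn M.x).orderTop =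
    ((toLex (0, 1) : ℚ ×ₗ ℚ) : WithTop (ℚ ×ₗ ℚ)) := by
  rw [M.map_x, orderTop_lexX]

theorem orderTop_z : (M.toHahn M.z).orderTop =
    ((toLex (-1, 0) : ℚ ×ₗ ℚ) : WithTop (ℚ ×ₗ ℚ)) := by
  rw [M.map_z, orderTop_lexZ]

theorem orderTop_monomial (l i j m : ℕ) :
    (M.toHahn (M.x ^ l * M.z ^ i * M.y ^ j * M.t ^ m)).orderTop = lexWeight d e r s l i j m := by
  simp only [map_mul, map_pow]
  rw [orderTop_mul_of_eq (orderTop_mul_of_eq (orderTop_mul_of_eq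
    (orderTop_pow_of_eq M.orderTop_x l) (orderTop_pow_of_eq M.orderTop_z i))
    (orderTop_pow_of_eq M.orderTop_y j)) (orderTop_pow_of_eq M.orderTop_t m), lexWeight]
  congr 3 <;> ring

/-- Every nonzero element is a combination of monomials, the least of which gives its order. -/
theorem exists_monomial_expansion {a : A} (ha : a ≠ 0) :
    ∃ c : (ℕ × ℕ × ℕ × ℕ) →₀ k,
      (∀ n ∈ c.support, n.2.1 < r ∧ n.2.2.1 < s) ∧
      a = ∑ n ∈ c.support, c n • (M.x ^ n.1 * M.z ^ n.2.1 * M.y ^ n.2.2.1 * M.t ^ n.2.2.2) ∧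
      ∃ n₀ ∈ c.support,
        (M.toHahn a).orderTop = lexWeight d e r s n₀.1 n₀.2.1 n₀.2.2.1 n₀.2.2.2 ∧
        ∀ n ∈ c.support, lexWeight d e r s n₀.1 n₀.2.1 n₀.2.2.1 n₀.2.2.2 ≤
          lexWeight d e r s n.1 n.2.1 n.2.2.1 n.2.2.2 := by
  have hset : {b | ∃ l i j m, i < r ∧ j < s ∧ b = M.x ^ l * M.z ^ i * M.y ^ j * M.t ^ m} =
      (fun n : ℕ × ℕ × ℕ × ℕ => M.x ^ n.1 * M.z ^ n.2.1 * M.y ^ n.2.2.1 * M.t ^ n.2.2.2) ''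
        {n | n.2.1 < r ∧ n.2.2.1 < s} := by
    ext b
    constructor
    · rintro ⟨l, i, j, m, hi, hj, rfl⟩
      exact ⟨(l, i, j, m), ⟨hi, hj⟩, rfl⟩
    · rintro ⟨⟨l, i, j, m⟩, ⟨hi, hj⟩, rfl⟩
      exact ⟨l, i, j, m, hi, hj, rfl⟩
  have h := M.mem_stripSpan a
  rw [stripSpan, hset, Finsupp.mem_span_image_iff_linearCombination] at h
  obtain ⟨c, hc, hca⟩ := h
  have hsup : ∀ n ∈ c.support, n.2.1 < r ∧ n.2.2.1 < s := fun n hn => hc hn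
  rw [Finsupp.linearCombination_apply, Finsupp.sum] at hca
  refine ⟨c, hsup, hca.symm, ?_⟩
  have hne : c.support.Nonempty := by
    rw [Finset.nonempty_iff_ne_empty]
    intro h0
    rw [h0] at hca
    exact ha (by simpa using hca.symm)
  obtain ⟨n₀, hn₀, hmin, h⟩ := exists_orderTop_sum_eq hne
    (f := fun n => M.toHahn (c n • (M.x ^ n.1 * M.z ^ n.2.1 * M.y ^ n.2.2.1 * M.t ^ n.2.2.2)))
    (W := fun n => lexWeight d e r s n.1 n.2.1 n.2.2.1 n.2.2.2)
    (fun n hn => by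
      rw [map_smul, orderTop_smul_of_ne_zero (Finsupp.mem_support_iff.1 hn),
        M.orderTop_monomial])
    (fun n hn n' hn' h => by
      obtain ⟨h1, h2, h3, h4⟩ := lexWeight_injective (hsup n hn).1 (hsup n hn).2
        (hsup n' hn').1 (hsup n' hn').2 h
      ext <;> assumption)
  exact ⟨n₀, hn₀, by rw [← h, ← map_sum, hca], hmin⟩

theorem exists_orderTop_eq {a : A} (ha : a ≠ 0) : ∃ l i j m, i < r ∧ j < s ∧
    (M.toHahn a).orderTop = lexWeight d e r s l i j m := by
  obtain ⟨c, hc, -, n, hn, h, -⟩ := M.exists_monomial_expansion ha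
  exact ⟨_, _, _, _, (hc n hn).1, (hc n hn).2, h⟩

theorem toHahn_injective : Function.Injective M.toHahn := by
  rw [injective_iff_map_eq_zero]
  intro a h
  by_contra ha
  obtain ⟨l, i, j, m, -, -, h'⟩ := M.exists_orderTop_eq ha
  rw [h] at h'
  simp at h'

theorem isDomain (M : LexModel k A d e r s) : IsDomain A :=
  Function.Injective.isDomain M.toHahn.toRingHom M.toHahn_injective

theorem x_ne_zero : M.x ≠ 0 := by
  intro h
  have := M.orderTop_x
  rw [h] at this
  simp at this

/-- Elements of `z`-degree less than `n ≤ r` are polynomials in `x` and `z`. -/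
theorem exists_eq_evalXZ {n : ℕ} (hn : n ≤ r) {a : A}
    (ha : ∀ v : ℚ, ((toLex (-(n : ℚ), v) : ℚ ×ₗ ℚ) : WithTop (ℚ ×ₗ ℚ)) <
      (M.toHahn a).orderTop) :
    ∃ f : Polynomial (Polynomial k), f.degree < n ∧ a = evalXZ M.x M.z f := by
  by_cases h0 : a = 0
  · exact ⟨0, by simp, by simp [h0, ← evalXZHom_apply]⟩
  obtain ⟨c, hc, hca, n₀, hn₀, h, hmin⟩ := M.exists_monomial_expansion h0
  have key : a ∈ ((Polynomial.degreeLT (Polynomial k) n).restrictScalars k).map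
      (evalXZHom M.x M.z).toLinearMap := by
    rw [hca]
    refine Submodule.sum_mem _ fun b hb => Submodule.smul_mem _ _ ?_
    -- Choosing $v$ to be the second exponent of the monomial itself rules out a tie in the first
    -- exponent.
    have h1 := ha (lexWeight d e r s b.1 b.2.1 b.2.2.1 b.2.2.2 |> ofLex |>.2)
    rw [h] at h1
    have h2 := (WithTop.coe_lt_coe.1 h1).trans_le (hmin b hb)
    rw [lexWeight, Prod.Lex.toLex_lt_toLex] at h2
    simp only [ofLex_toLex, lt_self_iff_false, and_false, or_false] at h2
    have h3 : b.2.1 + r * (b.2.2.1 + s * b.2.2.2) < n := by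
      have : ((b.2.1 + r * (b.2.2.1 + s * b.2.2.2) : ℕ) : ℚ) < n := by push_cast; linarith
      exact_mod_cast this
    have h4 : b.2.2.1 + s * b.2.2.2 = 0 := by
      by_contra h5
      have := Nat.le_mul_of_pos_right r (Nat.pos_of_ne_zero h5)
      omega
    have h5 : b.2.2.1 = 0 := by omega
    have h6 : b.2.2.2 = 0 := by
      have hs : 0 < s := by have := (hc b hb).2; omega
      rw [h5, zero_add] at h4
      exact (Nat.mul_eq_zero.1 h4).resolve_left hs.ne'
    have h7 : b.2.1 < n := by rw [h4] at h3; simpa using h3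
    refine ⟨Polynomial.C (Polynomial.X ^ b.1) * Polynomial.X ^ b.2.1, ?_, ?_⟩
    · simp only [Submodule.coe_restrictScalars, SetLike.mem_coe, Polynomial.mem_degreeLT]
      refine (Polynomial.degree_C_mul_X_pow_le _ _).trans_lt ?_
      exact_mod_cast h7
    · simp [evalXZHom_apply, evalXZ_mul, evalXZ_pow, h5, h6]
  obtain ⟨f, hf, hfa⟩ := key
  exact ⟨f, Polynomial.mem_degreeLT.1 hf, hfa.symm⟩

end LexModel

/-! ### The coordinate ring and its Hahn series model -/

namespace DoubleDanielewski

variable {k : Type*} [Field k] (S : DoubleDanielewski k)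

/-- The image of `T` in `B`. -/
noncomputable def t : S.B := Ideal.Quotient.mk S.relIdeal (MvPolynomial.X 3)

theorem algHom_mk_evalXZ (p : Polynomial (Polynomial k)) :
    Ideal.Quotient.mk S.relIdeal (evalXZ (MvPolynomial.X 0) (MvPolynomial.X 2) p) =
      evalXZ S.x S.z p :=
  algHom_evalXZ (Ideal.Quotient.mkₐ k S.relIdeal) _ _ p

theorem algHom_mk_evalXYZ (q : Polynomial (Polynomial (Polynomial k))) :
    Ideal.Quotient.mk S.relIdeal
      (evalXYZ (MvPolynomial.X 0) (MvPolynomial.X 1) (MvPolynomial.X 2) q) =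
      evalXYZ S.x S.y S.z q :=
  algHom_evalXYZ (Ideal.Quotient.mkₐ k S.relIdeal) _ _ _ q

theorem x_pow_mul_y : S.x ^ S.d * S.y = evalXZ S.x S.z S.P := by
  rw [← algHom_mk_evalXZ, ← sub_eq_zero]
  have h : Ideal.Quotient.mk S.relIdeal (MvPolynomial.X 0 ^ S.d * MvPolynomial.X 1 -
      evalXZ (MvPolynomial.X 0) (MvPolynomial.X 2) S.P) = 0 :=
    Ideal.Quotient.eq_zero_iff_mem.2 (Ideal.subset_span (Set.mem_insert _ _))
  rw [map_sub, map_mul, map_pow] at h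
  exact h

theorem x_pow_mul_t : S.x ^ S.e * S.t = evalXYZ S.x S.y S.z S.Q := by
  rw [← algHom_mk_evalXYZ, ← sub_eq_zero]
  have h : Ideal.Quotient.mk S.relIdeal (MvPolynomial.X 0 ^ S.e * MvPolynomial.X 3 -
      evalXYZ (MvPolynomial.X 0) (MvPolynomial.X 1) (MvPolynomial.X 2) S.Q) = 0 :=
    Ideal.Quotient.eq_zero_iff_mem.2 (Ideal.subset_span (Set.mem_insert_of_mem _ rfl))
  rw [map_sub, map_mul, map_pow] at h
  exact h

section Lift

variable {A : Type*} [CommRing A] [Algebra k A]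

/-- The homomorphism from `B` given by the images of the generators. -/
noncomputable def lift (a b c w : A) (h1 : a ^ S.d * b = evalXZ a c S.P)
    (h2 : a ^ S.e * w = evalXYZ a b c S.Q) : S.B →ₐ[k] A :=
  Ideal.Quotient.liftₐ S.relIdeal (MvPolynomial.aeval ![a, b, c, w]) (by
    have : S.relIdeal ≤ RingHom.ker (MvPolynomial.aeval (R := k) ![a, b, c, w]) := by
      refine Ideal.span_le.2 ?_
      rintro _ (rfl | rfl)
      · simp [RingHom.mem_ker, algHom_evalXZ, h1]
      · simp [RingHom.mem_ker, algHom_evalXYZ, h2]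
    exact fun p hp => this hp)

variable {a b c w : A} {h1 : a ^ S.d * b = evalXZ a c S.P} {h2 : a ^ S.e * w = evalXYZ a b c S.Q}

@[simp] theorem lift_x : S.lift a b c w h1 h2 S.x = a := by
  change MvPolynomial.aeval ![a, b, c, w] (MvPolynomial.X 0) = a
  simp

@[simp] theorem lift_y : S.lift a b c w h1 h2 S.y = b := by
  change MvPolynomial.aeval ![a, b, c, w] (MvPolynomial.X 1) = b
  simp

@[simp] theorem lift_z : S.lift a b c w h1 h2 S.z = c := by
  change MvPolynomial.aeval ![a, b, c, w] (MvPolynomial.X 2) = c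
  simp

end Lift

theorem adjoin_eq_top : Algebra.adjoin k {S.x, S.y, S.z, S.t} = ⊤ := by
  rw [eq_top_iff]
  rintro b -
  obtain ⟨p, rfl⟩ := Ideal.Quotient.mk_surjective b
  induction p using MvPolynomial.induction_on with
  | C a => exact Subalgebra.algebraMap_mem _ a
  | add p q hp hq => rw [map_add]; exact add_mem hp hq
  | mul_X p i hp =>
    rw [map_mul]
    refine mul_mem hp (Algebra.subset_adjoin ?_)
    fin_cases i <;> simp [x, y, z, t]

/-- Homomorphisms from `B` are determined by the images of `x` and `z` when the image of `x` is not
a zero divisor. -/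
theorem hom_ext {A : Type*} [CommRing A] [Algebra k A] {f g : S.B →ₐ[k] A}
    (hx : f S.x = g S.x) (hz : f S.z = g S.z) (hreg : IsLeftRegular (f S.x)) : f = g := by
  have hy : f S.y = g S.y := by
    refine (hreg.pow S.d) ?_
    change f S.x ^ S.d * f S.y = f S.x ^ S.d * g S.y
    conv_rhs => rw [hx]
    rw [← map_pow, ← map_mul, ← map_pow, ← map_mul, x_pow_mul_y, algHom_evalXZ, algHom_evalXZ,
      hx, hz]
  have ht : f S.t = g S.t := by
    refine (hreg.pow S.e) ?_
    change f S.x ^ S.e * f S.t = f S.x ^ S.e * g S.t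
    conv_rhs => rw [hx]
    rw [← map_pow, ← map_mul, ← map_pow, ← map_mul, x_pow_mul_t, algHom_evalXYZ, algHom_evalXYZ,
      hx, hy, hz]
  refine AlgHom.ext_of_adjoin_eq_top S.adjoin_eq_top ?_
  rintro _ (rfl | rfl | rfl | rfl) <;> assumption

open HahnSeries

theorem single_mul_lexX_pow (n : ℕ) (h : HahnSeries (ℚ ×ₗ ℚ) k) :
    lexX k ^ n * (single (toLex (0, -(n : ℚ))) 1 * h) = h := by
  rw [← mul_assoc, lexX, single_pow, lex_nsmul, single_mul_single, lex_add]
  have : (toLex ((n : ℚ) * 0 + 0, (n : ℚ) * 1 + -(n : ℚ)) : ℚ ×ₗ ℚ) = 0 := by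
    simp
  rw [this]
  simp

/-- The coordinate ring embeds into Hahn series, compatibly with a monomial basis. -/
theorem exists_lexModel (hr : 0 < S.r) (hs : 0 < S.s) :
    ∃ M : LexModel k S.B S.d S.e S.r S.s, M.x = S.x ∧ M.y = S.y ∧ M.z = S.z := by
  -- The series $X$ is invertible, so both relations can be solved for the images of $y$ and $t$.
  set Y : HahnSeries (ℚ ×ₗ ℚ) k :=
    single (toLex (0, -(S.d : ℚ))) 1 * evalXZ (lexX k) (lexZ k) S.P
  set φ := S.lift (lexX k) Y (lexZ k)
    (single (toLex (0, -(S.e : ℚ))) 1 * evalXYZ (lexX k) Y (lexZ k) S.Q)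
    (single_mul_lexX_pow _ _) (single_mul_lexX_pow _ _) with hφ
  have hx : φ S.x = lexX k := by simp [hφ]
  have hz : φ S.z = lexZ k := by simp [hφ]
  have hy : (φ S.y).orderTop =
      ((toLex (-(S.r : ℚ), -(S.d : ℚ)) : ℚ ×ₗ ℚ) : WithTop (ℚ ×ₗ ℚ)) := by
    have e1 : φ S.y = Y := by simp [hφ]
    have h := orderTop_evalXZ (k := k) one_pos orderTop_lexZ S.P_monic.ne_zero
    rw [S.P_monic.leadingCoeff] at h
    rw [e1, orderTop_mul_of_eq (orderTop_single one_ne_zero) h]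
    simp [r]
  obtain ⟨t', ht', w, hw, hw'⟩ := exists_reduced_generator S.d_pos S.e_pos hr hs S.P_monic rfl
    S.x_pow_mul_y S.Q_monic rfl S.x_pow_mul_t
  -- Every monomial of $w$ has order greater than that of $y^s$, since $i+rj<rs$. Thus $y^s$ alone
  -- determines the order of $x^et'$.
  have hwt : ((toLex ((S.s : ℚ) * -(S.r : ℚ), (S.s : ℚ) * -(S.d : ℚ)) : ℚ ×ₗ ℚ) :
      WithTop (ℚ ×ₗ ℚ)) < (φ w).orderTop := by
    clear hw'
    induction hw using Submodule.span_induction with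
    | zero => simp
    | add b c _ _ hb hc => rw [map_add]; exact lt_orderTop_add hb hc
    | smul c b _ hb => rw [map_smul]; exact hb.trans_le (orderTop_le_orderTop_smul c _)
    | mem b hb =>
      obtain ⟨l, i, j, hi, hj, rfl⟩ := hb
      simp only [map_mul, map_pow]
      rw [orderTop_mul_of_eq (orderTop_mul_of_eq
        (orderTop_pow_of_eq (hx ▸ orderTop_lexX) l) (orderTop_pow_of_eq (hz ▸ orderTop_lexZ) i))
        (orderTop_pow_of_eq hy j), WithTop.coe_lt_coe, Prod.Lex.toLex_lt_toLex]
      left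
      have h1 : (i : ℚ) + 1 ≤ S.r := by exact_mod_cast hi
      have h2 : (j : ℚ) + 1 ≤ S.s := by exact_mod_cast hj
      have h3 : (0 : ℚ) ≤ S.r := by positivity
      simp only
      nlinarith
  have ht : (φ t').orderTop = ((toLex (-(S.r * S.s : ℚ), -(S.d * S.s + S.e : ℚ)) : ℚ ×ₗ ℚ) :
      WithTop (ℚ ×ₗ ℚ)) := by
    have h := congrArg (fun b => (φ b).orderTop) hw'
    simp only [map_mul, map_pow, map_add] at h
    have hs' := orderTop_pow_of_eq hy S.s
    rw [orderTop_add_eq_left (hs' ▸ hwt), hs', orderTop_mul,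
      orderTop_pow_of_eq (hx ▸ orderTop_lexX) S.e] at h
    cases hc : (φ t').orderTop with
    | top => rw [hc] at h; simp at h
    | coe a =>
      rw [hc, ← WithTop.coe_add, WithTop.coe_inj] at h
      rw [WithTop.coe_inj]
      refine add_left_cancel (h.trans ?_)
      rw [lex_add]
      congr 2 <;> ring
  have htop : ∀ a, a ∈ Algebra.adjoin k {S.x, S.y, S.z, t'} := by
    intro a
    have : (⊤ : Subalgebra k S.B) ≤ Algebra.adjoin k {S.x, S.y, S.z, t'} := by
      rw [← S.adjoin_eq_top]
      refine Algebra.adjoin_le ?_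
      rintro _ (rfl | rfl | rfl | rfl)
      · exact Algebra.subset_adjoin (by simp)
      · exact Algebra.subset_adjoin (by simp)
      · exact Algebra.subset_adjoin (by simp)
      · exact ht'
    exact this trivial
  exact ⟨⟨S.x, S.y, S.z, t', φ, hx, hz, hy, ht, fun a =>
    stripSpan_eq_top hr hs S.P_monic rfl S.x_pow_mul_y hw hw' a (htop a)⟩, rfl, rfl, rfl⟩

end DoubleDanielewski

/-! ### Powers of polynomials in one variable -/

section PolynomialPowers

open Polynomial

variable {k : Type*} [Field k]

/-- If `ℓ ≠ 0` in `k` and `E` is not a monomial multiple of its top term, then `E ^ ℓ` has a nonzero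
coefficient in one of the degrees just below the top one. -/
theorem exists_coeff_pow_ne_zero {E : k[X]} {N l : ℕ} (hN : E.natDegree = N) (hN0 : 0 < N)
    (h0 : E.coeff 0 ≠ 0) (hl : (l : k) ≠ 0) :
    ∃ i < N, (E ^ l).coeff ((l - 1) * N + i) ≠ 0 := by
  have hE0 : E ≠ 0 := by rintro rfl; simp at h0
  set a := E.leadingCoeff
  have ha : a ≠ 0 := leadingCoeff_ne_zero.2 hE0
  set T : k[X] := C a * X ^ N with hT
  have hTd : T.natDegree = N := natDegree_C_mul_X_pow N a ha
  set D := E - T with hD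
  have hDe : D = E.eraseLead := by
    rw [hD, hT, ← hN, ← self_sub_C_mul_X_pow]
  have hD0 : D ≠ 0 := by
    intro h
    have : D.coeff 0 = E.coeff 0 := by
      rw [hDe, eraseLead_coeff_of_ne]
      omega
    rw [h] at this
    exact h0 (by simpa using this.symm)
  have hDN : D.natDegree < N := by
    rw [hDe]
    have := eraseLead_natDegree_lt_or_eraseLead_eq_zero E
    rcases this with h | h
    · omega
    · exact absurd (hDe.trans h) hD0
  refine ⟨D.natDegree, hDN, ?_⟩
  have hl1 : 1 ≤ l := by
    rcases Nat.eq_zero_or_pos l with rfl | h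
    · simp at hl
    · exact h
  -- Write $E=T+D$ with $T$ the top term, of coefficient $a$. In $E^l-T^l=(\sum E^iT^{l-1-i})D$ the
  -- sum has degree $(l-1)N$ with coefficient $l\,a^{l-1}\neq0$, so degree $(l-1)N+\deg D$ survives;
  -- $T^l$ lives only in degree $lN$.
  have hsum := geom_sum₂_mul E T l
  have hpow : E ^ l = (∑ i ∈ Finset.range l, E ^ i * T ^ (l - 1 - i)) * D + T ^ l := by
    rw [hsum]; ring
  have hterm : ∀ i ∈ Finset.range l, (E ^ i * T ^ (l - 1 - i)).natDegree = (l - 1) * N ∧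
      (E ^ i * T ^ (l - 1 - i)).leadingCoeff = a ^ (l - 1) := by
    intro i hi
    have hi' : i + (l - 1 - i) = l - 1 := by have := Finset.mem_range.1 hi; omega
    have hT0 : T ≠ 0 := by
      intro h; rw [h] at hTd; simp at hTd; omega
    constructor
    · rw [natDegree_mul (pow_ne_zero _ hE0) (pow_ne_zero _ hT0), natDegree_pow, natDegree_pow, hN,
        hTd, ← add_mul, hi']
    · rw [leadingCoeff_mul, leadingCoeff_pow, leadingCoeff_pow, hT, leadingCoeff_C_mul_X_pow,
        ← pow_add, hi']
  rw [hpow, coeff_add, coeff_mul_add_eq_of_natDegree_le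
    (natDegree_sum_le_of_forall_le _ _ fun i hi => (hterm i hi).1.le) le_rfl]
  have h1 : (∑ i ∈ Finset.range l, E ^ i * T ^ (l - 1 - i)).coeff ((l - 1) * N) =
      l * a ^ (l - 1) := by
    rw [finsetSum_coeff, Finset.sum_congr rfl fun i hi => ?_, Finset.sum_const,
      Finset.card_range, nsmul_eq_mul]
    rw [← (hterm i hi).1, coeff_natDegree, (hterm i hi).2]
  have h2 : (T ^ l).coeff ((l - 1) * N + D.natDegree) = 0 := by
    rw [hT, mul_pow, ← pow_mul, ← C_pow, coeff_C_mul, coeff_X_pow, if_neg, mul_zero]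
    obtain ⟨l, rfl⟩ : ∃ n, l = n + 1 := ⟨l - 1, by omega⟩
    simp only [Nat.add_sub_cancel]
    nlinarith
  rw [h1, h2, add_zero]
  exact mul_ne_zero (mul_ne_zero hl (pow_ne_zero _ ha)) (leadingCoeff_ne_zero.2 hD0)

/-- The common root is $E=F^a/G^b$. It is a polynomial because $(G^b)^p$ is associated to $F^{qb}$,
which divides $F^{qb+1}=(F^a)^p$, and $k[X]$ is integrally closed. -/
theorem exists_associated_pow_of_coprime {F G : k[X]} (hF : F ≠ 0) (hG : G ≠ 0) {p q a b : ℕ}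
    (hp : p ≠ 0) (hab : p * a = q * b + 1) (h : Associated (G ^ p) (F ^ q)) :
    ∃ E : k[X], Associated F (E ^ p) ∧ Associated G (E ^ q) := by
  have h1 : (G ^ b) ^ p ∣ (F ^ a) ^ p := by
    have h2 : Associated ((G ^ b) ^ p) ((F ^ q) ^ b) := by
      rw [← pow_mul, mul_comm b p, pow_mul]
      exact h.pow_pow
    refine h2.dvd.trans ⟨F, ?_⟩
    rw [← pow_mul, ← pow_mul, ← pow_succ, mul_comm a p, hab]
  obtain ⟨E, hE⟩ : G ^ b ∣ F ^ a := (IsIntegrallyClosed.pow_dvd_pow_iff hp).1 h1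
  refine ⟨E, ?_, ?_⟩
  · have h3 : Associated ((F ^ q) ^ b * F) ((F ^ q) ^ b * E ^ p) := by
      have e1 : (F ^ q) ^ b * F = (G ^ p) ^ b * E ^ p := by
        rw [← pow_mul, ← pow_succ, ← hab, mul_comm p a, pow_mul, hE]
        ring
      rw [e1]
      exact (h.pow_pow).mul_right _
    exact h3.of_mul_left (Associated.refl _) (pow_ne_zero _ (pow_ne_zero _ hF))
  · have h3 : Associated ((G ^ q) ^ b * G) ((G ^ q) ^ b * E ^ q) := by
      have e1 : (F ^ q) ^ a = (G ^ q) ^ b * E ^ q := by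
        rw [← pow_mul, mul_comm q a, pow_mul, hE]
        ring
      have e2 : (G ^ p) ^ a = (G ^ q) ^ b * G := by
        rw [← pow_mul, ← pow_mul, hab, pow_succ]
      rw [← e1, ← e2]
      exact h.pow_pow
    exact h3.of_mul_left (Associated.refl _) (pow_ne_zero _ (pow_ne_zero _ hG))

end PolynomialPowers

/-! ### Exponential maps and their slopes -/

open Polynomial in
/-- An exponential map on the `k`-algebra `A`: a coaction of the additive group. -/
structure IsExponential {k A : Type*} [Field k] [CommRing A] [Algebra k A]
    (φ : A →ₐ[k] A[X]) : Prop where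
  coeff_zero : ∀ a, (φ a).coeff 0 = a
  coeff_coeff : ∀ a i j, (φ ((φ a).coeff i)).coeff j = (i + j).choose i • (φ a).coeff (i + j)

namespace LexModel

open HahnSeries Polynomial

variable {k A : Type*} [Field k] [CommRing A] [Algebra k A] {d e r s : ℕ}

/-- Extension of coefficients from `k` to `k[V]`. -/
noncomputable def hahnC (k : Type*) [Field k] :
    HahnSeries (ℚ ×ₗ ℚ) k →+* HahnSeries (ℚ ×ₗ ℚ) k[X] where
  toFun h := h.map (Polynomial.C : k →+* k[X])
  map_one' := HahnSeries.map_one (Polynomial.C : k →+* k[X]).toMonoidWithZeroHom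
  map_zero' := by ext; simp
  map_add' f g := by ext; simp
  map_mul' f g := HahnSeries.map_mul (Polynomial.C : k →+* k[X]).toNonUnitalRingHom

theorem hahnC_coeff (h : HahnSeries (ℚ ×ₗ ℚ) k) (γ : ℚ ×ₗ ℚ) :
    (hahnC k h).coeff γ = Polynomial.C (h.coeff γ) := rfl

variable (M : LexModel k A d e r s) (φ : A →ₐ[k] A[X]) (μ : ℚ ×ₗ ℚ)

/-- The homomorphism `a ↦ ∑ φᵢ(a) τ ^ (-i μ) V ^ i`. -/
noncomputable def twist : A →+* HahnSeries (ℚ ×ₗ ℚ) k[X] :=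
  (Polynomial.eval₂RingHom ((hahnC k).comp M.toHahn.toRingHom) (single (-μ) X)).comp φ.toRingHom

theorem twist_coeff (a : A) (γ : ℚ ×ₗ ℚ) (i : ℕ) :
    ((M.twist φ μ a).coeff γ).coeff i = (M.toHahn ((φ a).coeff i)).coeff (γ + i • μ) := by
  have h1 : M.twist φ μ a = ∑ n ∈ (φ a).support,
      hahnC k (M.toHahn ((φ a).coeff n)) * single (n • (-μ)) (X ^ n) := by
    simp only [twist, RingHom.comp_apply, Polynomial.coe_eval₂RingHom, Polynomial.eval₂_eq_sum,
      Polynomial.sum_def, single_pow]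
    rfl
  rw [h1, HahnSeries.coeff_sum, Polynomial.finsetSum_coeff]
  simp only [coeff_mul_single, hahnC_coeff, Polynomial.coeff_C_mul, Polynomial.coeff_X_pow, mul_ite,
    mul_one, mul_zero]
  rw [Finset.sum_ite_eq]
  split_ifs with h
  · rw [neg_nsmul, sub_neg_eq_add]
  · rw [Polynomial.notMem_support_iff.1 h]; simp

theorem le_orderTop_twist {a : A}
    (h : ∀ i : ℕ, (M.toHahn a).orderTop + ((i • μ : ℚ ×ₗ ℚ) : WithTop (ℚ ×ₗ ℚ)) ≤
      (M.toHahn ((φ a).coeff i)).orderTop) :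
    (M.toHahn a).orderTop ≤ (M.twist φ μ a).orderTop := by
  rw [le_orderTop_iff_forall]
  intro γ hγ
  ext i
  rw [twist_coeff, Polynomial.coeff_zero]
  refine coeff_eq_zero_of_lt_orderTop (lt_of_lt_of_le ?_ (h i))
  rw [WithTop.coe_add]
  exact WithTop.add_lt_add_right WithTop.coe_ne_top hγ

theorem le_orderTop_twist_mul {a b : A}
    (ha : (M.toHahn a).orderTop ≤ (M.twist φ μ a).orderTop)
    (hb : (M.toHahn b).orderTop ≤ (M.twist φ μ b).orderTop) :
    (M.toHahn (a * b)).orderTop ≤ (M.twist φ μ (a * b)).orderTop := by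
  rw [map_mul, map_mul, orderTop_mul, orderTop_mul]
  exact add_le_add ha hb

/-- `μ` is the slope of `φ`: the largest vector for which all `φᵢ` shift orders by at least
`i μ` on the generators. -/
structure IsSlope : Prop where
  le : ∀ g ∈ ({M.x, M.y, M.z, M.t} : Set A), ∀ i : ℕ,
    (M.toHahn g).orderTop + ((i • μ : ℚ ×ₗ ℚ) : WithTop (ℚ ×ₗ ℚ)) ≤
      (M.toHahn ((φ g).coeff i)).orderTop
  exists_eq : ∃ g ∈ ({M.x, M.y, M.z, M.t} : Set A), ∃ i : ℕ, 0 < i ∧ (φ g).coeff i ≠ 0 ∧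
    (M.toHahn g).orderTop + ((i • μ : ℚ ×ₗ ℚ) : WithTop (ℚ ×ₗ ℚ)) =
      (M.toHahn ((φ g).coeff i)).orderTop

theorem adjoin_eq_top (M : LexModel k A d e r s) :
    Algebra.adjoin k {M.x, M.y, M.z, M.t} = ⊤ := by
  rw [eq_top_iff]
  rintro a -
  have hx : M.x ∈ Algebra.adjoin k {M.x, M.y, M.z, M.t} := Algebra.subset_adjoin (by simp)
  have hy : M.y ∈ Algebra.adjoin k {M.x, M.y, M.z, M.t} := Algebra.subset_adjoin (by simp)
  have hz : M.z ∈ Algebra.adjoin k {M.x, M.y, M.z, M.t} := Algebra.subset_adjoin (by simp)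
  have ht : M.t ∈ Algebra.adjoin k {M.x, M.y, M.z, M.t} := Algebra.subset_adjoin (by simp)
  have h := M.mem_stripSpan a
  induction h using Submodule.span_induction with
  | zero => exact zero_mem _
  | add b c _ _ hb hc => exact add_mem hb hc
  | smul c b _ hb => exact Subalgebra.smul_mem _ hb c
  | mem b hb =>
    obtain ⟨l, i, j, m, -, -, rfl⟩ := hb
    exact mul_mem (mul_mem (mul_mem (pow_mem hx _) (pow_mem hz _)) (pow_mem hy _)) (pow_mem ht _)

theorem generator_ne_zero : ∀ g ∈ ({M.x, M.y, M.z, M.t} : Set A), g ≠ 0 := by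
  have key : ∀ (g : A) (γ : ℚ ×ₗ ℚ), (M.toHahn g).orderTop = γ → g ≠ 0 := by
    rintro _ γ h rfl
    simp at h
  rintro g (rfl | rfl | rfl | rfl)
  · exact key _ _ M.orderTop_x
  · exact key _ _ M.orderTop_y
  · exact key _ _ M.orderTop_z
  · exact key _ _ M.orderTop_t

theorem orderTop_toHahn {a : A} (ha : a ≠ 0) :
    (M.toHahn a).orderTop = (M.toHahn a).order :=
  (order_eq_orderTop_of_ne_zero
    ((map_ne_zero_iff M.toHahn M.toHahn_injective).2 ha)).symm

/-- The slope is the least value of $(\mathrm{ord}\,\varphi_i(g)-\mathrm{ord}\,g)/i$ over the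
finitely many generators $g$ and $i>0$ with $\varphi_i(g)\ne0$. Nontriviality of $\varphi$ provides
such a pair, and rational exponents permit the division by $i$. -/
theorem exists_isSlope (hφ : IsExponential φ) (hne : ∃ a, φ a ≠ Polynomial.C a) :
    ∃ μ, M.IsSlope φ μ := by
  classical
  set G : Fin 4 → A := ![M.x, M.y, M.z, M.t] with hG
  have hGmem : ∀ g, g ∈ ({M.x, M.y, M.z, M.t} : Set A) ↔ ∃ n, G n = g := by
    intro g
    simp only [hG, Fin.exists_fin_succ, Set.mem_insert_iff, Set.mem_singleton_iff]
    simp [eq_comm]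
  set T : Finset (Fin 4 × ℕ) := (Finset.univ.sigma fun n => (φ (G n)).support.filter (0 < ·)).map
    (Equiv.sigmaEquivProd (Fin 4) ℕ).toEmbedding with hT
  have hTmem : ∀ n i, (n, i) ∈ T ↔ 0 < i ∧ (φ (G n)).coeff i ≠ 0 := by
    intro n i
    simp only [hT, Finset.mem_map_equiv, Finset.mem_sigma, Finset.mem_filter,
      Polynomial.mem_support_iff, Finset.mem_univ, true_and]
    exact and_comm
  have hTne : T.Nonempty := by
    by_contra hemp
    rw [Finset.not_nonempty_iff_eq_empty] at hemp
    obtain ⟨a, ha⟩ := hne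
    refine ha ?_
    have : φ = Polynomial.CAlgHom := by
      refine AlgHom.ext_of_adjoin_eq_top M.adjoin_eq_top fun g hg => ?_
      obtain ⟨n, rfl⟩ := (hGmem g).1 hg
      ext i
      rcases Nat.eq_zero_or_pos i with rfl | hi
      · simp [hφ.coeff_zero]
      · have : (n, i) ∉ T := by simp [hemp]
        rw [hTmem] at this
        simp only [hi, true_and, not_not] at this
        rw [this]
        simp [Polynomial.coeff_C, hi.ne']
    rw [this]
    rfl
  obtain ⟨⟨n₀, i₀⟩, h₀, hmin⟩ := T.exists_min_image (fun p => ((p.2 : ℚ)⁻¹ •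
    ((M.toHahn ((φ (G p.1)).coeff p.2)).order - (M.toHahn (G p.1)).order) : ℚ ×ₗ ℚ)) hTne
  have hsm : ∀ (i : ℕ), 0 < i → ∀ v : ℚ ×ₗ ℚ, i • ((i : ℚ)⁻¹ • v) = v := by
    intro i hi v
    have hi' : (i : ℚ) ≠ 0 := by exact_mod_cast hi.ne'
    rw [← Nat.cast_smul_eq_nsmul ℚ, smul_smul, mul_inv_cancel₀ hi', one_smul]
  have hG0 : ∀ n, G n ≠ 0 := fun n => M.generator_ne_zero _ ((hGmem _).2 ⟨n, rfl⟩)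
  refine ⟨((i₀ : ℚ)⁻¹ • ((M.toHahn ((φ (G n₀)).coeff i₀)).order - (M.toHahn (G n₀)).order)),
    ⟨?_, ⟨G n₀, (hGmem _).2 ⟨n₀, rfl⟩, i₀, ((hTmem _ _).1 h₀).1, ((hTmem _ _).1 h₀).2,
    ?_⟩⟩⟩
  · intro g hg i
    obtain ⟨n, rfl⟩ := (hGmem g).1 hg
    rcases Nat.eq_zero_or_pos i with rfl | hi
    · simp [hφ.coeff_zero]
    by_cases hc : (φ (G n)).coeff i = 0
    · rw [hc]; simp
    have h1 := nsmul_le_nsmul_right (hmin (n, i) ((hTmem _ _).2 ⟨hi, hc⟩)) i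
    rw [hsm i hi] at h1
    rw [M.orderTop_toHahn (hG0 n), M.orderTop_toHahn hc, ← WithTop.coe_add, WithTop.coe_le_coe]
    exact le_sub_iff_add_le'.1 h1
  · rw [hsm i₀ ((hTmem _ _).1 h₀).1, M.orderTop_toHahn (hG0 n₀),
      M.orderTop_toHahn ((hTmem _ _).1 h₀).2, ← WithTop.coe_add, add_sub_cancel]

variable {M φ μ}

namespace IsSlope

/-- The bound on generators passes to monomials because the twist is multiplicative, and to all
elements because no monomial in the expansion of $a$ has order below that of $a$. -/
theorem orderTop_le (h : M.IsSlope φ μ) (a : A) :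
    (M.toHahn a).orderTop ≤ (M.twist φ μ a).orderTop := by
  by_cases ha : a = 0
  · simp [ha]
  obtain ⟨c, hc, hca, n₀, hn₀, ho, hmin⟩ := M.exists_monomial_expansion ha
  have hpow : ∀ g ∈ ({M.x, M.y, M.z, M.t} : Set A), ∀ n : ℕ,
      (M.toHahn (g ^ n)).orderTop ≤ (M.twist φ μ (g ^ n)).orderTop := by
    intro g hg n
    induction n with
    | zero => simp
    | succ n ih =>
      rw [pow_succ]
      exact M.le_orderTop_twist_mul φ μ ih (M.le_orderTop_twist φ μ (h.le g hg))
  conv_rhs => rw [hca]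
  rw [map_sum]
  refine le_orderTop_sum fun n hn => ?_
  have h1 : (M.toHahn a).orderTop ≤
      (M.toHahn (M.x ^ n.1 * M.z ^ n.2.1 * M.y ^ n.2.2.1 * M.t ^ n.2.2.2)).orderTop := by
    rw [ho, M.orderTop_monomial, WithTop.coe_le_coe]
    exact hmin n hn
  have h2 := M.le_orderTop_twist_mul φ μ (M.le_orderTop_twist_mul φ μ (M.le_orderTop_twist_mul φ μ
    (hpow M.x (by simp) n.1) (hpow M.z (by simp) n.2.1)) (hpow M.y (by simp) n.2.2.1))
    (hpow M.t (by simp) n.2.2.2)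
  refine h1.trans (h2.trans ?_)
  rw [Algebra.smul_def, map_mul, orderTop_mul]
  have h3 : (0 : WithTop (ℚ ×ₗ ℚ)) ≤ (M.twist φ μ (algebraMap k A (c n))).orderTop := by
    have : M.twist φ μ (algebraMap k A (c n)) = single 0 (Polynomial.C (c n)) := by
      ext γ i
      rw [M.twist_coeff, AlgHom.commutes, Polynomial.algebraMap_apply, Polynomial.coeff_C]
      split_ifs with hi
      · subst hi
        rw [zero_smul, add_zero, AlgHom.commutes, HahnSeries.algebraMap_apply, HahnSeries.C_apply,
          HahnSeries.coeff_single, HahnSeries.coeff_single]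
        split_ifs <;> simp
      · rw [HahnSeries.coeff_single]
        split_ifs <;> simp [Polynomial.coeff_C, hi]
    rw [this]
    exact orderTop_single_le
  simpa using add_le_add_left h3 _

end IsSlope

end LexModel

/-! ### Leading forms of an exponential map -/

namespace LexModel

open HahnSeries Polynomial

variable {k A : Type*} [Field k] [CommRing A] [Algebra k A] {d e r s : ℕ}

section Weight

variable (M : LexModel k A d e r s)

/-- The order of (the series of) an element. -/
noncomputable def wt (a : A) : ℚ ×ₗ ℚ := (M.toHahn a).order

theorem wt_eq_of_orderTop {a : A} {γ : ℚ ×ₗ ℚ} (h : (M.toHahn a).orderTop = γ) : M.wt a = γ := by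
  have ha : a ≠ 0 := by rintro rfl; simp at h
  rw [M.orderTop_toHahn ha, WithTop.coe_inj] at h
  exact h

theorem monomial_ne_zero (l i j m : ℕ) : M.x ^ l * M.z ^ i * M.y ^ j * M.t ^ m ≠ 0 := by
  intro h
  have := M.orderTop_monomial l i j m
  rw [h] at this
  simp at this

theorem wt_monomial (l i j m : ℕ) :
    M.wt (M.x ^ l * M.z ^ i * M.y ^ j * M.t ^ m) = lexWeight d e r s l i j m :=
  M.wt_eq_of_orderTop (M.orderTop_monomial l i j m)

end Weight

/-- The leading form of `φ` at `a`, as a polynomial over `k`. -/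
noncomputable def leadPoly (M : LexModel k A d e r s) (φ : A →ₐ[k] A[X]) (μ : ℚ ×ₗ ℚ) (a : A) :
    k[X] := (M.twist φ μ a).leadingCoeff

variable {M : LexModel k A d e r s} {φ : A →ₐ[k] A[X]} {μ : ℚ ×ₗ ℚ}

theorem leadPoly_mul (a b : A) : M.leadPoly φ μ (a * b) = M.leadPoly φ μ a * M.leadPoly φ μ b := by
  rw [leadPoly, map_mul, HahnSeries.leadingCoeff_mul]; rfl

theorem leadPoly_pow (a : A) (n : ℕ) : M.leadPoly φ μ (a ^ n) = M.leadPoly φ μ a ^ n := by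
  induction n with
  | zero => simp [leadPoly]
  | succ n ih => rw [pow_succ, leadPoly_mul, ih, pow_succ]

namespace IsSlope

/-- The term $i=0$ of the twist is $a$ itself, so the lower bound given by the slope is attained. -/
theorem orderTop_twist (h : M.IsSlope φ μ) (hφ : IsExponential φ) {a : A} (ha : a ≠ 0) :
    (M.twist φ μ a).orderTop = M.wt a := by
  refine le_antisymm ?_ ?_
  · refine orderTop_le_of_coeff_ne_zero fun h0 => ?_
    have h1 := M.twist_coeff φ μ a (M.wt a) 0
    rw [h0, hφ.coeff_zero, zero_smul, add_zero, Polynomial.coeff_zero] at h1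
    exact (map_ne_zero_iff M.toHahn M.toHahn_injective).2 ha (coeff_order_eq_zero.1 h1.symm)
  · rw [wt, ← M.orderTop_toHahn ha]
    exact h.orderTop_le a

theorem twist_ne_zero (h : M.IsSlope φ μ) (hφ : IsExponential φ) {a : A} (ha : a ≠ 0) :
    M.twist φ μ a ≠ 0 := by
  rw [← orderTop_ne_top, h.orderTop_twist hφ ha]
  exact WithTop.coe_ne_top

theorem leadPoly_eq_coeff (h : M.IsSlope φ μ) (hφ : IsExponential φ) {a : A} (ha : a ≠ 0) :
    M.leadPoly φ μ a = (M.twist φ μ a).coeff (M.wt a) := by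
  have h1 := order_eq_orderTop_of_ne_zero (h.twist_ne_zero hφ ha)
  rw [h.orderTop_twist hφ ha, WithTop.coe_inj] at h1
  rw [leadPoly, leadingCoeff_eq, h1]

theorem leadPoly_coeff (h : M.IsSlope φ μ) (hφ : IsExponential φ) {a : A} (ha : a ≠ 0) (i : ℕ) :
    (M.leadPoly φ μ a).coeff i = (M.toHahn ((φ a).coeff i)).coeff (M.wt a + i • μ) := by
  rw [h.leadPoly_eq_coeff hφ ha, twist_coeff]

theorem leadPoly_coeff_zero (h : M.IsSlope φ μ) (hφ : IsExponential φ) {a : A} (ha : a ≠ 0) :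
    (M.leadPoly φ μ a).coeff 0 ≠ 0 := by
  rw [h.leadPoly_coeff hφ ha, hφ.coeff_zero, zero_smul, add_zero]
  exact fun h0 => (map_ne_zero_iff M.toHahn M.toHahn_injective).2 ha (coeff_order_eq_zero.1 h0)

theorem leadPoly_ne_zero (h : M.IsSlope φ μ) (hφ : IsExponential φ) {a : A} (ha : a ≠ 0) :
    M.leadPoly φ μ a ≠ 0 := fun h0 => h.leadPoly_coeff_zero hφ ha (by rw [h0]; simp)

theorem le_orderTop_coeff (h : M.IsSlope φ μ) {a : A} (ha : a ≠ 0) (i : ℕ) :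
    ((M.wt a + i • μ : ℚ ×ₗ ℚ) : WithTop (ℚ ×ₗ ℚ)) ≤ (M.toHahn ((φ a).coeff i)).orderTop := by
  rw [le_orderTop_iff_forall]
  intro γ hγ
  have h1 := M.twist_coeff φ μ a (γ - i • μ) i
  rw [sub_add_cancel] at h1
  rw [← h1, coeff_eq_zero_of_lt_orderTop, Polynomial.coeff_zero]
  refine lt_of_lt_of_le ?_ (h.orderTop_le a)
  rw [M.orderTop_toHahn ha, WithTop.coe_lt_coe]
  exact sub_lt_iff_lt_add.2 (WithTop.coe_lt_coe.1 hγ)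

theorem wt_coeff (h : M.IsSlope φ μ) (hφ : IsExponential φ) {a : A} (ha : a ≠ 0) {i : ℕ}
    (hi : (M.leadPoly φ μ a).coeff i ≠ 0) :
    (φ a).coeff i ≠ 0 ∧ M.wt ((φ a).coeff i) = M.wt a + i • μ := by
  rw [h.leadPoly_coeff hφ ha] at hi
  refine ⟨fun h0 => hi (by rw [h0]; simp), M.wt_eq_of_orderTop (le_antisymm ?_ ?_)⟩
  · exact orderTop_le_of_coeff_ne_zero hi
  · exact h.le_orderTop_coeff ha i

/-- A suitable combination $va-ub$ cancels the leading coefficients and has larger order, so its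
twist has no term at the common weight. Hence the leading forms of $a$ and $b$ are proportional: up
to a unit, a leading form depends only on the weight. -/
theorem leadPoly_associated (h : M.IsSlope φ μ) (hφ : IsExponential φ) {a b : A} (ha : a ≠ 0)
    (hb : b ≠ 0) (hab : M.wt a = M.wt b) : Associated (M.leadPoly φ μ a) (M.leadPoly φ μ b) := by
  have hla : (M.toHahn a).coeff (M.wt a) ≠ 0 := fun h0 =>
    (map_ne_zero_iff M.toHahn M.toHahn_injective).2 ha (coeff_order_eq_zero.1 h0)
  have hlb : (M.toHahn b).coeff (M.wt b) ≠ 0 := fun h0 =>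
    (map_ne_zero_iff M.toHahn M.toHahn_injective).2 hb (coeff_order_eq_zero.1 h0)
  set u := (M.toHahn a).coeff (M.wt a)
  set v := (M.toHahn b).coeff (M.wt b)
  have hlt : (M.wt a : WithTop (ℚ ×ₗ ℚ)) < (M.toHahn (v • a - u • b)).orderTop := by
    rw [← not_le]
    intro hle
    have hmin : (M.wt a : WithTop (ℚ ×ₗ ℚ)) ≤ (M.toHahn (v • a - u • b)).orderTop := by
      rw [map_sub, map_smul, map_smul]
      refine le_trans (le_min ?_ ?_) min_orderTop_le_orderTop_sub
      · rw [orderTop_smul_of_ne_zero hlb, M.orderTop_toHahn ha]; rfl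
      · rw [orderTop_smul_of_ne_zero hla, M.orderTop_toHahn hb, hab]; rfl
    have h1 := coeff_orderTop_ne (le_antisymm hle hmin)
    apply h1
    simp only [map_sub, map_smul, HahnSeries.coeff_sub, HahnSeries.coeff_smul, smul_eq_mul]
    rw [show (M.toHahn b).coeff (M.wt a) = v by rw [hab], mul_comm]
    exact sub_self _
  have h2 : (M.twist φ μ (v • a - u • b)).coeff (M.wt a) = 0 :=
    coeff_eq_zero_of_lt_orderTop (hlt.trans_le (h.orderTop_le _))
  have h3 : v • M.leadPoly φ μ a = u • M.leadPoly φ μ b := by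
    ext i
    have h4 := M.twist_coeff φ μ (v • a - u • b) (M.wt a) i
    rw [h2] at h4
    simp only [Polynomial.coeff_zero, map_sub, map_smul, Polynomial.coeff_sub,
      Polynomial.coeff_smul, HahnSeries.coeff_sub, HahnSeries.coeff_smul] at h4
    rw [Polynomial.coeff_smul, Polynomial.coeff_smul, h.leadPoly_coeff hφ ha,
      h.leadPoly_coeff hφ hb, ← hab]
    exact sub_eq_zero.1 h4.symm
  have e1 : Associated (M.leadPoly φ μ a) (v • M.leadPoly φ μ a) := by
    rw [Polynomial.smul_eq_C_mul]
    exact (associated_unit_mul_left _ _ (isUnit_C.2 hlb.isUnit)).symm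
  have e2 : Associated (M.leadPoly φ μ b) (u • M.leadPoly φ μ b) := by
    rw [Polynomial.smul_eq_C_mul]
    exact (associated_unit_mul_left _ _ (isUnit_C.2 hla.isUnit)).symm
  exact e1.trans (h3 ▸ e2.symm)

theorem associated_leadPoly_monomial (h : M.IsSlope φ μ) (hφ : IsExponential φ) {a : A}
    (ha : a ≠ 0) {l i j m : ℕ} (hw : M.wt a = lexWeight d e r s l i j m) :
    Associated (M.leadPoly φ μ a) (M.leadPoly φ μ M.x ^ l * M.leadPoly φ μ M.z ^ i *
      M.leadPoly φ μ M.y ^ j * M.leadPoly φ μ M.t ^ m) := by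
  have := h.leadPoly_associated hφ ha (M.monomial_ne_zero l i j m) (by rw [hw, M.wt_monomial])
  simpa only [leadPoly_mul, leadPoly_pow] using this

theorem natDegree_leadPoly (h : M.IsSlope φ μ) (hφ : IsExponential φ) {a : A}
    (ha : a ≠ 0) {l i j m : ℕ} (hw : M.wt a = lexWeight d e r s l i j m) :
    (M.leadPoly φ μ a).natDegree = l * (M.leadPoly φ μ M.x).natDegree +
      i * (M.leadPoly φ μ M.z).natDegree + j * (M.leadPoly φ μ M.y).natDegree +
      m * (M.leadPoly φ μ M.t).natDegree := by
  have hg := fun g hg => h.leadPoly_ne_zero hφ (M.generator_ne_zero g hg)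
  have hx := hg M.x (by simp)
  have hy := hg M.y (by simp)
  have hz := hg M.z (by simp)
  have ht := hg M.t (by simp)
  rw [natDegree_eq_of_degree_eq (degree_eq_degree_of_associated
      (h.associated_leadPoly_monomial hφ ha hw)),
    natDegree_mul (mul_ne_zero (mul_ne_zero (pow_ne_zero _ hx) (pow_ne_zero _ hz))
      (pow_ne_zero _ hy)) (pow_ne_zero _ ht),
    natDegree_mul (mul_ne_zero (pow_ne_zero _ hx) (pow_ne_zero _ hz)) (pow_ne_zero _ hy),
    natDegree_mul (pow_ne_zero _ hx) (pow_ne_zero _ hz)]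
  simp only [natDegree_pow]

/-- The top coefficient of the leading form is invariant under the leading form. -/
theorem natDegree_leadPoly_top (h : M.IsSlope φ μ) (hφ : IsExponential φ) {a : A} (ha : a ≠ 0) :
    (M.leadPoly φ μ ((φ a).coeff (M.leadPoly φ μ a).natDegree)).natDegree = 0 := by
  have hc : (M.leadPoly φ μ a).coeff (M.leadPoly φ μ a).natDegree ≠ 0 :=
    leadingCoeff_ne_zero.2 (h.leadPoly_ne_zero hφ ha)
  obtain ⟨h0, hw⟩ := h.wt_coeff hφ ha hc
  rw [Polynomial.natDegree_eq_zero_iff_degree_le_zero, Polynomial.degree_le_iff_coeff_zero]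
  intro j hj
  have hj : 0 < j := by exact_mod_cast hj
  -- Applying $\varphi_j$ to $\varphi_n(a)$ gives a multiple of $\varphi_{n+j}(a)$, whose leading
  -- part vanishes since $n$ is the degree of the leading form.
  rw [h.leadPoly_coeff hφ h0, hφ.coeff_coeff, hw, add_assoc, ← add_nsmul, map_nsmul]
  have h1 := h.leadPoly_coeff hφ ha ((M.leadPoly φ μ a).natDegree + j)
  rw [coeff_eq_zero_of_natDegree_lt (by omega)] at h1
  rw [HahnSeries.coeff_nsmul, Pi.smul_apply, ← h1, smul_zero]

end IsSlope

end LexModel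

/-! ### Invariants of exponential maps -/

namespace LexModel

open HahnSeries Polynomial

variable {k A : Type*} [Field k] [CommRing A] [Algebra k A] {d e r s : ℕ}
  {M : LexModel k A d e r s} {φ : A →ₐ[k] A[X]} {μ : ℚ ×ₗ ℚ}

/-- The linear form on exponents that vanishes on the exponent of `t`. -/
theorem lexWeight_form (l i j m : ℕ) :
    (r * s : ℚ) * (ofLex (lexWeight d e r s l i j m)).2 -
      (d * s + e : ℚ) * (ofLex (lexWeight d e r s l i j m)).1 =
      ((r * s * l + (d * s + e) * i + r * e * j : ℕ) : ℚ) := by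
  simp only [lexWeight, ofLex_toLex]
  push_cast
  ring

theorem ofLex_add_nsmul (γ : ℚ ×ₗ ℚ) (n : ℕ) :
    (ofLex (γ + n • μ)).1 = (ofLex γ).1 + n * (ofLex μ).1 ∧
      (ofLex (γ + n • μ)).2 = (ofLex γ).2 + n * (ofLex μ).2 := by
  have h1 : n • μ = toLex ((n : ℚ) * (ofLex μ).1, (n : ℚ) * (ofLex μ).2) := lex_nsmul n _ _
  rw [h1]
  exact ⟨rfl, rfl⟩

theorem wt_x : M.wt M.x = toLex (0, 1) := M.wt_eq_of_orderTop M.orderTop_x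

theorem wt_z : M.wt M.z = toLex (-1, 0) := M.wt_eq_of_orderTop M.orderTop_z

theorem wt_pow (a : A) (n : ℕ) : M.wt (a ^ n) = n • M.wt a := by
  simp [wt]

theorem exists_wt_eq {a : A} (ha : a ≠ 0) :
    ∃ l i j m, i < r ∧ j < s ∧ M.wt a = lexWeight d e r s l i j m := by
  obtain ⟨l, i, j, m, hi, hj, h⟩ := M.exists_orderTop_eq ha
  exact ⟨l, i, j, m, hi, hj, M.wt_eq_of_orderTop h⟩

/-- An element of nonnegative first exponent is a polynomial in `x`. -/
theorem exists_eq_aeval_x (hr : 0 < r) {a : A}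
    (ha : ∀ v : ℚ, ((toLex (-1, v) : ℚ ×ₗ ℚ) : WithTop (ℚ ×ₗ ℚ)) < (M.toHahn a).orderTop) :
    ∃ p : k[X], a = aeval M.x p := by
  obtain ⟨f, hf, rfl⟩ := M.exists_eq_evalXZ (n := 1) hr (by simpa using ha)
  have hf' : f = Polynomial.C (f.coeff 0) := by
    refine eq_C_of_degree_le_zero ?_
    rw [degree_le_iff_coeff_zero]
    intro n hn
    refine coeff_eq_zero_of_degree_lt (hf.trans_le ?_)
    exact_mod_cast Nat.succ_le_of_lt (by exact_mod_cast hn)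
  exact ⟨f.coeff 0, by rw [hf', evalXZ_C]; simp⟩

/-- Invariants of a nontrivial exponential map are polynomials in `x`. -/
theorem exists_eq_aeval_of_invariant (hr : 2 ≤ r) (hs : 0 < s) (hd : 0 < d) (he : 0 < e)
    (hφ : IsExponential φ) (hne : ∃ a, φ a ≠ Polynomial.C a) {f : A} (hf : φ f = Polynomial.C f) :
    ∃ p : k[X], f = aeval M.x p := by
  by_contra hcon
  have hf0 : f ≠ 0 := by
    rintro rfl
    exact hcon ⟨0, by simp⟩
  obtain ⟨μ, h⟩ := M.exists_isSlope φ hφ hne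
  have hg := fun g hg => M.generator_ne_zero g hg
  have hx0 := hg M.x (by simp)
  have hy0 := hg M.y (by simp)
  have hz0 := hg M.z (by simp)
  have ht0 := hg M.t (by simp)
  have := M.isDomain
  set νx := (M.leadPoly φ μ M.x).natDegree with hνx
  set νy := (M.leadPoly φ μ M.y).natDegree with hνy
  set νz := (M.leadPoly φ μ M.z).natDegree with hνz
  set νt := (M.leadPoly φ μ M.t).natDegree with hνt
  have wy : M.wt M.y = toLex (-(r : ℚ), -(d : ℚ)) := M.wt_eq_of_orderTop M.orderTop_y
  -- The elements $z^r$ and $x^dy$ have equal weights, as do $y^s$ and $x^et$, so the degrees of the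
  -- leading forms satisfy the corresponding linear relations.
  have rel1 : r * νz = d * νx + νy := by
    have := h.natDegree_leadPoly hφ (pow_ne_zero r hz0) (l := d) (i := 0) (j := 1) (m := 0) (by
      rw [wt_pow, wt_z, lex_nsmul, lexWeight]
      congr 2 <;> simp)
    rw [leadPoly_pow, natDegree_pow] at this
    simpa using this
  have rel2 : s * νy = e * νx + νt := by
    have := h.natDegree_leadPoly hφ (pow_ne_zero s hy0) (l := e) (i := 0) (j := 0) (m := 1) (by
      rw [wt_pow, wy, lex_nsmul, lexWeight]
      congr 2 <;> simp <;> ring)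
    rw [leadPoly_pow, natDegree_pow] at this
    simpa using this
  have hνf : (M.leadPoly φ μ f).natDegree = 0 := by
    rw [Polynomial.natDegree_eq_zero_iff_degree_le_zero, Polynomial.degree_le_iff_coeff_zero]
    intro j hj
    have hj : 0 < j := by exact_mod_cast hj
    rw [h.leadPoly_coeff hφ hf0, hf, Polynomial.coeff_C, if_neg hj.ne']
    simp
  -- the degree of the leading form at `t` vanishes, that at `x` does not
  have hνt0 : νt = 0 := by
    obtain ⟨l, i, j, m, hi, hj, hw⟩ := exists_wt_eq (M := M) hf0
    have h1 := h.natDegree_leadPoly hφ hf0 hw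
    rw [hνf, ← hνx, ← hνy, ← hνz, ← hνt] at h1
    have h2 : l * νx = 0 ∧ i * νz = 0 ∧ j * νy = 0 ∧ m * νt = 0 := by omega
    obtain ⟨-, h2, h3, h4⟩ := h2
    rcases Nat.eq_zero_or_pos m with rfl | hm
    · rcases Nat.eq_zero_or_pos j with rfl | hj
      · rcases Nat.eq_zero_or_pos i with rfl | hi
        · refine absurd (exists_eq_aeval_x (M := M) (by omega) (a := f) fun v => ?_) hcon
          rw [M.orderTop_toHahn hf0, WithTop.coe_lt_coe]
          change _ < M.wt f
          rw [hw, lexWeight, Prod.Lex.toLex_lt_toLex]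
          left
          simp
        · have : νz = 0 := (Nat.mul_eq_zero.1 h2).resolve_left hi.ne'
          rw [this] at rel1
          have : νy = 0 := by omega
          rw [this] at rel2
          omega
      · have : νy = 0 := (Nat.mul_eq_zero.1 h3).resolve_left hj.ne'
        rw [this] at rel2
        omega
    · exact (Nat.mul_eq_zero.1 h4).resolve_left hm.ne'
  have hνx0 : 0 < νx := by
    by_contra h0
    have h0 : νx = 0 := by omega
    have h1 : νy = 0 := by
      rw [h0, hνt0] at rel2
      exact (Nat.mul_eq_zero.1 (by simpa using rel2)).resolve_left hs.ne'
    have h2 : νz = 0 := by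
      rw [h0, h1] at rel1
      exact (Nat.mul_eq_zero.1 (by simpa using rel1)).resolve_left (by omega)
    obtain ⟨g, hgm, i, hi, hci, heq⟩ := h.exists_eq
    have hg0 := hg g hgm
    have hdeg : (M.leadPoly φ μ g).natDegree = 0 := by
      rcases hgm with rfl | rfl | rfl | rfl <;> assumption
    have h3 : (M.leadPoly φ μ g).coeff i ≠ 0 := by
      rw [h.leadPoly_coeff hφ hg0]
      rw [M.orderTop_toHahn hg0, ← WithTop.coe_add] at heq
      exact coeff_orderTop_ne heq.symm
    exact h3 (coeff_eq_zero_of_natDegree_lt (by omega))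
  have hνy0 : 0 < νy := by
    rcases Nat.eq_zero_or_pos νy with h0 | h0
    · rw [h0] at rel2
      have := Nat.mul_pos he hνx0
      omega
    · exact h0
  have hνz0 : 0 < νz := by
    rcases Nat.eq_zero_or_pos νz with h0 | h0
    · rw [h0] at rel1
      omega
    · exact h0
  -- the top coefficients have weights proportional to that of `t`
  have htop : ∀ a : A, a ≠ 0 → ∃ m : ℕ,
      M.wt a + (M.leadPoly φ μ a).natDegree • μ = lexWeight d e r s 0 0 0 m := by
    intro a ha
    have hc : (M.leadPoly φ μ a).coeff (M.leadPoly φ μ a).natDegree ≠ 0 :=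
      leadingCoeff_ne_zero.2 (h.leadPoly_ne_zero hφ ha)
    obtain ⟨h0, hw⟩ := h.wt_coeff hφ ha hc
    obtain ⟨l, i, j, m, hi, hj, hw'⟩ := exists_wt_eq (M := M) h0
    have h1 := h.natDegree_leadPoly hφ h0 hw'
    rw [h.natDegree_leadPoly_top hφ ha, ← hνx, ← hνy, ← hνz, ← hνt] at h1
    have h2 : l * νx = 0 ∧ i * νz = 0 ∧ j * νy = 0 := by omega
    obtain ⟨h2, h3, h4⟩ := h2
    have hl := (Nat.mul_eq_zero.1 h2).resolve_right hνx0.ne'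
    have hi := (Nat.mul_eq_zero.1 h3).resolve_right hνz0.ne'
    have hj := (Nat.mul_eq_zero.1 h4).resolve_right hνy0.ne'
    subst hl hi hj
    exact ⟨m, hw.symm.trans hw'⟩
  obtain ⟨β, hβ⟩ := htop M.x hx0
  obtain ⟨β', hβ'⟩ := htop M.z hz0
  rw [wt_x, ← hνx] at hβ
  rw [wt_z, ← hνz] at hβ'
  obtain ⟨ex1, ex2⟩ := ofLex_add_nsmul (μ := μ) (toLex (0, 1)) νx
  obtain ⟨ez1, ez2⟩ := ofLex_add_nsmul (μ := μ) (toLex (-1, 0)) νz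
  rw [hβ] at ex1 ex2
  rw [hβ'] at ez1 ez2
  simp only [lexWeight, ofLex_toLex] at ex1 ex2 ez1 ez2
  set μ₁ := (ofLex μ).1
  set μ₂ := (ofLex μ).2
  set p := r * s with hp
  set q := d * s + e with hq
  have hp2 : 2 ≤ p := by
    calc 2 ≤ r := hr
      _ ≤ r * s := Nat.le_mul_of_pos_right r hs
  have hq2 : 2 ≤ q := by
    have := Nat.mul_pos hd hs
    omega
  have hre2 : 2 ≤ r * e := hr.trans (Nat.le_mul_of_pos_right r he)
  have hpq : (p : ℚ) = r * s := by rw [hp]; push_cast; ring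
  have hqq : (q : ℚ) = d * s + e := by rw [hq]; push_cast; ring
  have rel3 : p * νz = q * νx := by
    calc p * νz = s * (r * νz) := by rw [hp]; ring
      _ = d * s * νx + s * νy := by rw [rel1]; ring
      _ = q * νx := by rw [rel2, hνt0, hq]; ring
  have rel3q : (p : ℚ) * νz = q * νx := by exact_mod_cast rel3
  have hp0 : (p : ℚ) ≠ 0 := by
    have : p ≠ 0 := by omega
    exact_mod_cast this
  -- Both $\mathrm{wt}(x)+\nu_x\mu$ and $\mathrm{wt}(z)+\nu_z\mu$ are multiples of
  -- $\mathrm{wt}(t)=(-p,-q)$. Eliminating $\mu$ by means of $p\nu_z=q\nu_x$ leaves a Bézout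
  -- relation.
  have hcop : p * β' = q * β + 1 := by
    have h1 : (p : ℚ) * (p * β') = p * (q * β + 1) := by
      rw [← hpq] at ex1 ez1
      push_cast at ex1 ez1
      linear_combination (-(p : ℚ)) * ez1 + q * ex1 - μ₁ * rel3q
    exact_mod_cast mul_left_cancel₀ hp0 h1
  obtain ⟨N, hN⟩ : p ∣ νx := by
    have hc : Nat.Coprime p q := by
      rw [Nat.coprime_iff_gcd_eq_one, ← Nat.dvd_one]
      have h1 : p.gcd q ∣ q * β + 1 := hcop ▸ (Nat.gcd_dvd_left p q).mul_right β'
      exact (Nat.dvd_add_right ((Nat.gcd_dvd_right p q).mul_right β)).1 h1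
    exact hc.dvd_of_dvd_mul_left ⟨νz, rel3.symm⟩
  have hN' : νz = q * N := by
    refine Nat.eq_of_mul_eq_mul_left (by omega : 0 < p) ?_
    rw [rel3, hN]; ring
  have hN0 : 0 < N := by
    rcases Nat.eq_zero_or_pos N with rfl | h0
    · omega
    · exact h0
  -- The linear form $L(u,v)=pv-qu$ vanishes on the weight of $t$ and equals $p$ on that of $x$;
  -- since $\nu_x=pN$, it takes the value $-1/N$ on $\mu$.
  have hform : (N : ℚ) * (p * μ₂ - q * μ₁) = -1 := by
    have h1 : (p : ℚ) * (N * (p * μ₂ - q * μ₁)) = p * (-1) := by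
      have hNq : (νx : ℚ) = p * N := by exact_mod_cast hN
      rw [← hpq] at ex1
      rw [← hqq] at ex2
      push_cast at ex1 ex2
      rw [hNq] at ex1 ex2
      linear_combination q * ex1 - p * ex2
    exact mul_left_cancel₀ hp0 h1
  -- the leading forms at `x` and `z` are powers of a common polynomial
  have hassoc : Associated (M.leadPoly φ μ M.z ^ p) (M.leadPoly φ μ M.x ^ q) := by
    have h1 := h.associated_leadPoly_monomial hφ (pow_ne_zero p hz0)
      (l := q) (i := 0) (j := 0) (m := 1) (by
        rw [wt_pow, wt_z, lex_nsmul, lexWeight]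
        congr 2
        · rw [hpq]; simp
        · rw [hqq]; simp)
    rw [leadPoly_pow] at h1
    simp only [pow_zero, mul_one, pow_one] at h1
    refine h1.trans (associated_mul_unit_left _ _ ?_)
    rw [Polynomial.isUnit_iff_degree_eq_zero, degree_eq_natDegree (h.leadPoly_ne_zero hφ ht0)]
    exact_mod_cast hνt0
  obtain ⟨E, hE1, hE2⟩ := exists_associated_pow_of_coprime (h.leadPoly_ne_zero hφ hx0)
    (h.leadPoly_ne_zero hφ hz0) (by omega) hcop hassoc
  have hEN : E.natDegree = N := by
    have h1 := natDegree_eq_of_degree_eq (degree_eq_degree_of_associated hE1)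
    rw [natDegree_pow, ← hνx, hN] at h1
    exact (Nat.eq_of_mul_eq_mul_left (by omega : 0 < p) h1).symm
  have hE0 : E.coeff 0 ≠ 0 := by
    obtain ⟨u, hu⟩ := hE1
    have h1 := h.leadPoly_coeff_zero hφ hx0
    intro h0
    have h2 : (E ^ p).coeff 0 = 0 := by
      rw [coeff_zero_eq_eval_zero, eval_pow, ← coeff_zero_eq_eval_zero, h0, zero_pow (by omega)]
    rw [← hu, mul_coeff_zero] at h2
    obtain h3 | h3 := mul_eq_zero.1 h2
    · exact h1 h3
    · have h4 := u.isUnit.map (Polynomial.constantCoeff (R := k))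
      exact h4.ne_zero h3
  -- A nonzero coefficient of $E^l$ in degree $(l-1)N+i$ with $i<N$ yields a nonzero element on
  -- whose weight $L$ equals $l-(l-1)-i/N=1-i/N$. This is a nonnegative integer, hence $1$. But $L$
  -- is $p$, $q$, $re$, $0$ on the weights of $x,z,y,t$, and $p,q,re\ge2$.
  have hfinal : ∀ (g : A) (l : ℕ), g ≠ 0 → (l : k) ≠ 0 →
      (p : ℚ) * (ofLex (M.wt g)).2 - q * (ofLex (M.wt g)).1 = l →
      Associated (M.leadPoly φ μ g) (E ^ l) → False := by
    intro g l hg0 hl hwg hass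
    obtain ⟨i, hi, hci⟩ := exists_coeff_pow_ne_zero hEN hN0 hE0 hl
    obtain ⟨c, hc⟩ := hass.symm
    obtain ⟨c', hc', hcc⟩ := Polynomial.isUnit_iff.1 c.isUnit
    have h1 : (M.leadPoly φ μ g).coeff ((l - 1) * N + i) ≠ 0 := by
      rw [← hc, ← hcc, coeff_mul_C]
      exact mul_ne_zero hci hc'.ne_zero
    obtain ⟨h2, h3⟩ := h.wt_coeff hφ hg0 h1
    obtain ⟨l', i', j', m', -, -, hw⟩ := exists_wt_eq (M := M) h2
    have h4 := lexWeight_form (d := d) (e := e) (r := r) (s := s) l' i' j' m'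
    rw [← hw, h3, ← hpq, ← hqq] at h4
    obtain ⟨e1, e2⟩ := ofLex_add_nsmul (μ := μ) (M.wt g) ((l - 1) * N + i)
    rw [e1, e2] at h4
    have hl1 : 1 ≤ l := by
      rcases Nat.eq_zero_or_pos l with rfl | h
      · simp at hl
      · exact h
    set n := r * s * l' + (d * s + e) * i' + r * e * j' with hn
    have h5 : (N : ℚ) * n + i = N := by
      push_cast [Nat.cast_sub hl1] at h4
      linear_combination (-(N : ℚ)) * h4 + N * hwg + (((l : ℚ) - 1) * N + i) * hform
    have h6 : N * n + i = N := by exact_mod_cast h5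
    have hn1 : n = 1 := by
      rcases Nat.lt_or_ge n 1 with h7 | h7
      · have : n = 0 := by omega
        rw [this] at h6
        omega
      · refine le_antisymm ?_ h7
        by_contra h8
        have := Nat.mul_le_mul_left N (show 2 ≤ n by omega)
        omega
    rcases Nat.eq_zero_or_pos l' with rfl | h7
    · rcases Nat.eq_zero_or_pos i' with rfl | h7
      · rcases Nat.eq_zero_or_pos j' with rfl | h7
        · simp at hn; omega
        · have := Nat.le_mul_of_pos_right (r * e) h7
          omega
      · have := Nat.le_mul_of_pos_right (d * s + e) h7
        omega
    · have := Nat.le_mul_of_pos_right (r * s) h7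
      omega
  -- The Bézout relation prevents $p$ and $q$ from both vanishing in $k$, so one of $x$, $z$ gives
  -- the contradiction in every characteristic.
  by_cases hpk : (p : k) = 0
  · have hqk : (q : k) ≠ 0 := by
      intro h0
      have := congrArg (fun n : ℕ => (n : k)) hcop
      push_cast at this
      rw [hpk, h0] at this
      simp at this
    exact hfinal M.z q hz0 hqk (by rw [wt_z]; simp) hE2
  · exact hfinal M.x p hx0 hpk (by rw [wt_x]; simp) hE1

end LexModel

/-! ### The translation of z as an exponential map -/

section

open Polynomial

universe u

section Divisibility

variable {k A : Type*} [Field k] [CommRing A] [Algebra k A]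

theorem sub_dvd_evalXZ_sub (x z z' : A) (p : k[X][X]) :
    z' - z ∣ evalXZ x z' p - evalXZ x z p := by
  have := Polynomial.sub_dvd_eval_sub z' z (p.map (Polynomial.aeval (R := k) x).toRingHom)
  rwa [Polynomial.eval_map, Polynomial.eval_map] at this

theorem evalXYZ_eq_sum (x y z : A) (q : k[X][X][X]) : evalXYZ x y z q =
    ∑ j ∈ Finset.range (q.natDegree + 1), evalXZ x z (q.coeff j) * y ^ j :=
  Polynomial.eval₂_eq_sum_range _ _

theorem dvd_evalXYZ_sub {x y y' z z' u : A} (hy : u ∣ y' - y) (hz : u ∣ z' - z) (q : k[X][X][X]) :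
    u ∣ evalXYZ x y' z' q - evalXYZ x y z q := by
  rw [evalXYZ_eq_sum, evalXYZ_eq_sum, ← Finset.sum_sub_distrib]
  refine Finset.dvd_sum fun j _ => ?_
  rw [show evalXZ x z' (q.coeff j) * y' ^ j - evalXZ x z (q.coeff j) * y ^ j =
    (evalXZ x z' (q.coeff j) - evalXZ x z (q.coeff j)) * y' ^ j +
      evalXZ x z (q.coeff j) * (y' ^ j - y ^ j) by ring]
  exact dvd_add ((hz.trans (sub_dvd_evalXZ_sub _ _ _ _)).mul_right _)
    ((hy.trans (sub_dvd_pow_sub_pow _ _ _)).mul_left _)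

end Divisibility

/-- An exponential map from the coassociativity of the coaction. -/
theorem IsExponential.of_map_eq {k A : Type*} [Field k] [CommRing A] [Algebra k A]
    {φ : A →ₐ[k] A[X]} (h0 : ∀ a, (φ a).coeff 0 = a)
    (h : ∀ a, (φ a).map φ.toRingHom = (φ a).eval₂ (C.comp C) (X + C X)) : IsExponential φ := by
  refine ⟨h0, fun b i j => ?_⟩
  have h := congrArg (fun q => (q.coeff i).coeff j) (h b)
  rw [eval₂_eq_sum, sum_def] at h
  simp only [Polynomial.coeff_map, RingHom.comp_apply, finsetSum_coeff, coeff_C_mul,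
    coeff_X_add_C_pow] at h
  have h2 : ∀ n ∈ (φ b).support, (φ b).coeff n * ((X : A[X]) ^ (n - i) *
      ((n.choose i : ℕ) : A[X])).coeff j =
        if i + j = n then (i + j).choose i • (φ b).coeff (i + j) else 0 := by
    intro n _
    rw [mul_comm (X ^ _), ← nsmul_eq_mul, coeff_smul, coeff_X_pow]
    split_ifs with h3 h4 h4
    · subst h4; simp [mul_comm]
    · rw [Nat.choose_eq_zero_of_lt (by omega)]; simp
    · omega
    · simp
  rw [Finset.sum_congr rfl h2, Finset.sum_ite_eq] at h
  refine h.trans ?_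
  split_ifs with h3
  · rfl
  · rw [notMem_support_iff.1 h3, smul_zero]

/-- A homomorphism `x ↦ x`, `z ↦ z + x ^ n U` is exponential if homomorphisms are determined by
their values at `x` and `z`. -/
theorem IsExponential.of_translation {k : Type*} {A : Type u} [Field k] [CommRing A] [IsDomain A]
    [Algebra k A] {x z : A} {n : ℕ} (hx : x ≠ 0) {φ : A →ₐ[k] A[X]} (φx : φ x = C x)
    (φz : φ z = C z + C (x ^ n) * X)
    (hext : ∀ (R : Type u) [CommRing R] [Algebra k R] (f g : A →ₐ[k] R),
      f x = g x → f z = g z → IsLeftRegular (f x) → f = g) : IsExponential φ := by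
  refine IsExponential.of_map_eq (fun b => ?_) (fun b => ?_)
  · have : ((Polynomial.aeval (R := A) (0 : A)).restrictScalars k).comp φ =
        AlgHom.id k A := by
      refine hext A _ _ ?_ ?_ ?_
      · simp [φx]
      · simp [φz]
      · simpa [φx] using (IsRegular.of_ne_zero hx).left
    have h := DFunLike.congr_fun this b
    simp only [AlgHom.comp_apply, AlgHom.restrictScalars_apply, AlgHom.id_apply] at h
    rw [coeff_zero_eq_aeval_zero]
    exact h
  · have key : (Polynomial.mapAlgHom φ).comp φ =
        (Polynomial.eval₂AlgHom ((CAlgHom (R := k) (A := A[X])).comp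
          (CAlgHom (R := k) (A := A))) (X + C X) fun _ => Commute.all _ _).comp φ := by
      refine hext _ _ _ ?_ ?_ ?_
      · simp only [AlgHom.comp_apply, φx, coe_mapAlgHom, map_C, RingHom.coe_coe]
        change _ = eval₂ _ _ (C x)
        rw [eval₂_C]
        rfl
      · simp only [AlgHom.comp_apply, φz]
        change map _ (_ + _) = eval₂ _ _ (_ + _)
        rw [eval₂_add, eval₂_mul, eval₂_C, eval₂_C, eval₂_X, Polynomial.map_add, Polynomial.map_mul,
          map_C, map_C, map_X]
        have φx' : φ.toRingHom x = C x := φx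
        have φz' : φ.toRingHom z = C z + C (x ^ n) * X := φz
        simp only [RingHom.coe_coe, map_pow, φx', φz', AlgHom.comp_apply, CAlgHom_apply,
          C_add, C_mul]
        ring
      · have : C (C x) ≠ 0 := by simpa using hx
        simp only [AlgHom.comp_apply, φx, coe_mapAlgHom, map_C, RingHom.coe_coe]
        exact (IsRegular.of_ne_zero this).left
    exact DFunLike.congr_fun key b

/-- A solution of the defining equations over `A` extends to one over `A[U]` with
`z` replaced by `z + x ^ (d + e) U`. -/
theorem exists_translated_solution {k A : Type*} [Field k] [CommRing A] [Algebra k A]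
    {x y z t : A} {d e : ℕ} {P : k[X][X]} {Q : k[X][X][X]} (h1 : x ^ d * y = evalXZ x z P)
    (h2 : x ^ e * t = evalXYZ x y z Q) : ∃ Y T : A[X],
      C x ^ d * Y = evalXZ (C x) (C z + C (x ^ (d + e)) * X) P ∧
      C x ^ e * T = evalXYZ (C x) Y (C z + C (x ^ (d + e)) * X) Q := by
  set Z : A[X] := C z + C (x ^ (d + e)) * X with hZ
  have hCxz : evalXZ (C x) (C z) P = C (evalXZ x z P) :=
    (algHom_evalXZ (CAlgHom (R := k) (A := A)) x z P).symm
  have hCxyz : evalXYZ (C x) (C y) (C z) Q = C (evalXYZ x y z Q) :=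
    (algHom_evalXYZ (CAlgHom (R := k) (A := A)) x y z Q).symm
  obtain ⟨p, hp⟩ := sub_dvd_evalXZ_sub (C x) (C z) Z P
  rw [hCxz, ← h1] at hp
  have hZ' : Z - C z = C x ^ d * (C x ^ e * X) := by
    rw [hZ, C_pow, pow_add]; ring
  -- Of the factor $x^{d+e}$, solving for $Y$ uses up $x^d$; the remaining $x^e$ divides the changes
  -- of both $y$ and $z$, so the second relation can be solved as well.
  obtain ⟨t', ht⟩ := dvd_evalXYZ_sub (x := C x) (y := C y)
    (y' := C y + C x ^ e * X * p) (z := C z) (z' := Z)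
    (u := C x ^ e * X) ⟨p, by ring⟩ ⟨C x ^ d, by rw [hZ', mul_comm]⟩ Q
  rw [hCxyz, ← h2] at ht
  rw [hZ', C_mul, C_pow] at hp
  rw [C_mul, C_pow] at ht
  exact ⟨C y + C x ^ e * X * p, C t + X * t', by linear_combination -hp, by linear_combination -ht⟩

/-- Transport of an exponential map along an isomorphism. -/
theorem IsExponential.conj {k A A' : Type*} [Field k] [CommRing A] [Algebra k A] [CommRing A']
    [Algebra k A'] {φ : A →ₐ[k] A[X]} (hφ : IsExponential φ) (ψ : A ≃ₐ[k] A') :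
    IsExponential ((Polynomial.mapAlgHom ψ.toAlgHom).comp (φ.comp ψ.symm.toAlgHom)) := by
  have h : ∀ a i, ((Polynomial.mapAlgHom ψ.toAlgHom).comp (φ.comp ψ.symm.toAlgHom) a).coeff i =
      ψ ((φ (ψ.symm a)).coeff i) := by
    intro a i
    simp
  refine ⟨fun a => ?_, fun a i j => ?_⟩
  · rw [h, hφ.coeff_zero, ψ.apply_symm_apply]
  · rw [h, h, h, ψ.symm_apply_apply, hφ.coeff_coeff, map_nsmul]

namespace DoubleDanielewski

variable {k : Type*} [Field k] (S : DoubleDanielewski k)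

theorem isDomain_B (hr : 0 < S.r) (hs : 0 < S.s) : IsDomain S.B := by
  obtain ⟨M, -⟩ := S.exists_lexModel hr hs
  exact M.isDomain

theorem x_ne_zero (hr : 0 < S.r) (hs : 0 < S.s) : S.x ≠ 0 := by
  obtain ⟨M, h, -⟩ := S.exists_lexModel hr hs
  exact h ▸ M.x_ne_zero

/-- The homomorphism `x ↦ x`, `z ↦ z + x ^ (d + e) U`. -/
theorem exists_translation : ∃ φ : S.B →ₐ[k] S.B[X], φ S.x = C S.x ∧
    φ S.z = C S.z + C (S.x ^ (S.d + S.e)) * X := by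
  obtain ⟨Y, T, h1, h2⟩ := exists_translated_solution S.x_pow_mul_y S.x_pow_mul_t
  exact ⟨S.lift _ Y _ T h1 h2, S.lift_x, S.lift_z⟩

theorem exists_isExponential (hr : 0 < S.r) (hs : 0 < S.s) :
    ∃ φ : S.B →ₐ[k] S.B[X], IsExponential φ ∧ φ S.x = C S.x ∧
      φ S.z = C S.z + C (S.x ^ (S.d + S.e)) * X := by
  have hdom := S.isDomain_B hr hs
  obtain ⟨φ, φx, φz⟩ := S.exists_translation
  exact ⟨φ, IsExponential.of_translation (S.x_ne_zero hr hs) φx φz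
    fun _ _ _ _ _ hx hz hreg => S.hom_ext hx hz hreg, φx, φz⟩

end DoubleDanielewski

end

/-! ### Rescaling of x, weights, and the image of x as a polynomial -/

section

open Polynomial

section Scaling

variable {k : Type*} [Field k]

/-- The substitution `X ↦ c X` in the coefficients. -/
noncomputable def scaleX (c : k) (p : k[X][X]) : k[X][X] :=
  p.map (Polynomial.compRingHom (C c * X))

theorem evalXZ_smul_left {A : Type*} [CommRing A] [Algebra k A] (c : k) (x z : A) (p : k[X][X]) :
    evalXZ (c • x) z p = evalXZ x z (scaleX c p) := by
  rw [evalXZ, evalXZ, scaleX, eval₂_map]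
  congr 1
  ext a
  · simp
  · simp [Algebra.smul_def]

theorem support_comp_C_mul_X {c : k} (hc : c ≠ 0) (p : k[X]) :
    (p.comp (C c * X)).support = p.support := by
  ext n
  simp [comp_C_mul_X_coeff, hc]

theorem comp_C_mul_X_injective {c : k} (hc : c ≠ 0) :
    Function.Injective (Polynomial.compRingHom (C c * X) : k[X] →+* k[X]) := by
  rw [injective_iff_map_eq_zero]
  intro p hp
  rw [← Polynomial.support_eq_empty, ← support_comp_C_mul_X hc, Polynomial.support_eq_empty]
  exact hp

theorem natTrailingDegree_comp_C_mul_X {c : k} (hc : c ≠ 0) (p : k[X]) :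
    (p.comp (C c * X)).natTrailingDegree = p.natTrailingDegree := by
  rw [natTrailingDegree, natTrailingDegree, trailingDegree, trailingDegree,
    support_comp_C_mul_X hc]

theorem natDegree_scaleX {c : k} (hc : c ≠ 0) (p : k[X][X]) :
    (scaleX c p).natDegree = p.natDegree :=
  natDegree_map_eq_of_injective (comp_C_mul_X_injective hc) p

theorem leadingCoeff_scaleX {c : k} (hc : c ≠ 0) (p : k[X][X]) :
    (scaleX c p).leadingCoeff = p.leadingCoeff.comp (C c * X) :=
  leadingCoeff_map_of_injective (comp_C_mul_X_injective hc) p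

theorem scaleX_ne_zero {c : k} (hc : c ≠ 0) {p : k[X][X]} (hp : p ≠ 0) : scaleX c p ≠ 0 :=
  (Polynomial.map_ne_zero_iff (comp_C_mul_X_injective hc)).2 hp

end Scaling

namespace LexModel

variable {k A : Type*} [Field k] [CommRing A] [Algebra k A] {d e r s : ℕ}
  (M : LexModel k A d e r s)

theorem toHahn_evalXZ (a : A) (p : k[X][X]) :
    M.toHahn (evalXZ M.x a p) = evalXZ (lexX k) (M.toHahn a) p := by
  rw [algHom_evalXZ, M.map_x]

theorem orderTop_toHahn_evalXZ {p : k[X][X]} (hp : p ≠ 0) :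
    (M.toHahn (evalXZ M.x M.z p)).orderTop =
      ((toLex (-(p.natDegree : ℚ), (p.leadingCoeff.natTrailingDegree : ℚ)) : ℚ ×ₗ ℚ) :
        WithTop (ℚ ×ₗ ℚ)) := by
  rw [toHahn_evalXZ, orderTop_evalXZ one_pos (by rw [M.orderTop_z]) hp]
  simp

theorem evalXZ_injective : Function.Injective (evalXZ M.x M.z : k[X][X] → A) := by
  refine (injective_iff_map_eq_zero (evalXZHom M.x M.z)).2 fun p hp => ?_
  by_contra h
  have := M.orderTop_toHahn_evalXZ h
  rw [← evalXZHom_apply, hp] at this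
  simp at this

theorem aeval_injective : Function.Injective (aeval M.x : k[X] → A) := by
  intro p q h
  refine C_injective (M.evalXZ_injective ?_)
  rwa [evalXZ_C, evalXZ_C]

theorem wt_mul {a b : A} (ha : a ≠ 0) (hb : b ≠ 0) : M.wt (a * b) = M.wt a + M.wt b := by
  rw [wt, map_mul, HahnSeries.order_mul]
  · rfl
  · exact (map_ne_zero_iff M.toHahn M.toHahn_injective).2 ha
  · exact (map_ne_zero_iff M.toHahn M.toHahn_injective).2 hb

theorem wt_smul {c : k} (hc : c ≠ 0) {a : A} (ha : a ≠ 0) : M.wt (c • a) = M.wt a := by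
  refine M.wt_eq_of_orderTop ?_
  rw [map_smul, orderTop_smul_of_ne_zero hc, M.orderTop_toHahn ha]
  rfl

theorem wt_x_pow (n : ℕ) : M.wt (M.x ^ n) = toLex (0, (n : ℚ)) := by
  rw [wt_pow, wt_x, lex_nsmul]
  simp

/-- In `z`-degree less than `r`, the second exponent is nonnegative. -/
theorem snd_wt_nonneg {a : A} (ha : a ≠ 0) {n : ℕ} (hn : n < r) {v : ℚ}
    (h : M.wt a = toLex (-(n : ℚ), v)) : 0 ≤ v := by
  obtain ⟨l, i, j, m, hi, hj, hw⟩ := exists_wt_eq (M := M) ha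
  rw [h, lexWeight] at hw
  obtain ⟨h1, h2⟩ := Prod.mk.inj (toLex_inj.1 hw)
  have h3 : n = i + r * (j + s * m) := by
    have : (n : ℚ) = ((i + r * (j + s * m) : ℕ) : ℚ) := by push_cast; linarith
    exact_mod_cast this
  have h4 : j + s * m = 0 := by
    by_contra h5
    have := Nat.le_mul_of_pos_right r (Nat.pos_of_ne_zero h5)
    omega
  have h5 : j = 0 := by omega
  have h6 : m = 0 := by
    rw [h5, zero_add] at h4
    exact (Nat.mul_eq_zero.1 h4).resolve_left (by omega)
  rw [h2, h5, h6]
  simp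

end LexModel

namespace DoubleDanielewski

variable {k : Type*} [Field k] {S₁ S₂ : DoubleDanielewski k}

/-- Every element becomes a polynomial in `x` and `z` after multiplication by a power of `x`. -/
theorem exists_pow_mul_eq_evalXZ (S : DoubleDanielewski k) (b : S.B) :
    ∃ (n : ℕ) (p : k[X][X]), S.x ^ n * b = evalXZ S.x S.z p := by
  have hmul : ∀ a b : S.B, (∃ (n : ℕ) (p : k[X][X]), S.x ^ n * a = evalXZ S.x S.z p) →
      (∃ (n : ℕ) (p : k[X][X]), S.x ^ n * b = evalXZ S.x S.z p) →
      ∃ (n : ℕ) (p : k[X][X]), S.x ^ n * (a * b) = evalXZ S.x S.z p := by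
    rintro a b ⟨n, p, hp⟩ ⟨m, q, hq⟩
    exact ⟨n + m, p * q, by rw [evalXZ_mul, ← hp, ← hq]; ring⟩
  have hadd : ∀ a b : S.B, (∃ (n : ℕ) (p : k[X][X]), S.x ^ n * a = evalXZ S.x S.z p) →
      (∃ (n : ℕ) (p : k[X][X]), S.x ^ n * b = evalXZ S.x S.z p) →
      ∃ (n : ℕ) (p : k[X][X]), S.x ^ n * (a + b) = evalXZ S.x S.z p := by
    rintro a b ⟨n, p, hp⟩ ⟨m, q, hq⟩
    refine ⟨n + m, C (X ^ m) * p + C (X ^ n) * q, ?_⟩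
    rw [evalXZ_add, evalXZ_mul, evalXZ_mul, ← hp, ← hq, evalXZ_C, evalXZ_C, map_pow, map_pow,
      aeval_X]
    ring
  have hx : ∃ (n : ℕ) (p : k[X][X]), S.x ^ n * S.x = evalXZ S.x S.z p :=
    ⟨0, C X, by rw [evalXZ_C, aeval_X]; ring⟩
  have hz : ∃ (n : ℕ) (p : k[X][X]), S.x ^ n * S.z = evalXZ S.x S.z p :=
    ⟨0, X, by rw [evalXZ_X]; ring⟩
  have hy : ∃ (n : ℕ) (p : k[X][X]), S.x ^ n * S.y = evalXZ S.x S.z p :=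
    ⟨S.d, S.P, S.x_pow_mul_y⟩
  set N : Subalgebra k S.B :=
    { carrier := {b | ∃ (n : ℕ) (p : k[X][X]), S.x ^ n * b = evalXZ S.x S.z p}
      mul_mem' := fun {a b} ha hb => hmul a b ha hb
      add_mem' := fun {a b} ha hb => hadd a b ha hb
      algebraMap_mem' := fun c => ⟨0, algebraMap k _ c, by
        rw [← evalXZHom_apply, AlgHom.commutes]; ring⟩ } with hN
  have ht : S.t ∈ N := by
    obtain ⟨n, p, hp⟩ : evalXYZ S.x S.y S.z S.Q ∈ N := evalXYZ_mem_subalgebra N hx hy hz S.Q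
    exact ⟨n + S.e, p, by rw [← hp, ← S.x_pow_mul_t]; ring⟩
  have : (⊤ : Subalgebra k S.B) ≤ N := by
    rw [← S.adjoin_eq_top]
    refine Algebra.adjoin_le ?_
    rintro _ (rfl | rfl | rfl | rfl)
    exacts [hx, hy, hz, ht]
  exact this (Algebra.mem_top : b ∈ ⊤)

/-- An isomorphism maps `x` to a polynomial in `x`. -/
theorem exists_map_x_eq_aeval (hr₁ : 2 ≤ S₁.r) (hs₁ : 0 < S₁.s) (hr₂ : 2 ≤ S₂.r) (hs₂ : 0 < S₂.s)
    (ψ : S₂.B ≃ₐ[k] S₁.B) : ∃ p : k[X], ψ S₂.x = aeval S₁.x p := by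
  obtain ⟨M, hMx, -, -⟩ := S₁.exists_lexModel (by omega) hs₁
  obtain ⟨φ, hφ, φx, φz⟩ := S₂.exists_isExponential (by omega) hs₂
  have hdom := S₂.isDomain_B (by omega) hs₂
  rw [← hMx]
  -- The translation on $B_2$, transported by $\psi$, is nontrivial and fixes $\psi(x_2)$.
  refine LexModel.exists_eq_aeval_of_invariant hr₁ hs₁ S₁.d_pos S₁.e_pos (hφ.conj ψ)
    ⟨ψ S₂.z, fun h => ?_⟩ ?_
  · have h1 := congrArg (fun q => q.coeff 1) h
    simp only [AlgHom.comp_apply, AlgEquiv.toAlgHom_apply, AlgEquiv.symm_apply_apply, φz,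
      coe_mapAlgHom, coeff_map, coeff_add, coeff_C_mul, coeff_X_one, mul_one, RingHom.coe_coe] at h1
    rw [coeff_C_of_ne_zero one_ne_zero, coeff_C_of_ne_zero one_ne_zero, zero_add] at h1
    have h2 : S₂.x ^ (S₂.d + S₂.e) = 0 := (map_eq_zero_iff ψ ψ.injective).1 h1
    exact S₂.x_ne_zero (by omega) hs₂ ((pow_eq_zero_iff (by have := S₂.d_pos; omega)).1 h2)
  · simp [φx]

end DoubleDanielewski

end

/-! ### Images of x and z under an isomorphism -/

section

open Polynomial

namespace DoubleDanielewski

variable {k : Type*} [Field k] {S₁ S₂ : DoubleDanielewski k}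

/-- The polynomials describing $\psi(x_2)$ and $\psi^{-1}(x_1)$ compose to $X$, so their degrees
multiply to $1$. -/
theorem exists_map_x_eq_linear (hr₁ : 2 ≤ S₁.r) (hs₁ : 0 < S₁.s) (hr₂ : 2 ≤ S₂.r)
    (hs₂ : 0 < S₂.s) (ψ : S₂.B ≃ₐ[k] S₁.B) :
    ∃ a b : k, a ≠ 0 ∧ ψ S₂.x = a • S₁.x + algebraMap k S₁.B b := by
  obtain ⟨p, hp⟩ := exists_map_x_eq_aeval hr₁ hs₁ hr₂ hs₂ ψ
  obtain ⟨q, hq⟩ := exists_map_x_eq_aeval hr₂ hs₂ hr₁ hs₁ ψ.symm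
  obtain ⟨M, hMx, -, -⟩ := S₁.exists_lexModel (by omega) hs₁
  have h : q.comp p = X := by
    refine M.aeval_injective ?_
    rw [hMx, aeval_comp, ← hp, aeval_X]
    have h1 := congrArg ψ hq
    rw [ψ.apply_symm_apply] at h1
    rw [h1]
    exact aeval_algHom_apply ψ.toAlgHom S₂.x q
  have hdeg : q.natDegree * p.natDegree = 1 := by
    rw [← natDegree_comp, h, natDegree_X]
  obtain ⟨a, b, hab⟩ := exists_eq_X_add_C_of_natDegree_le_one (Nat.eq_one_of_mul_eq_one_left hdeg).le
  refine ⟨a, b, ?_, ?_⟩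
  · rintro rfl
    have := Nat.eq_one_of_mul_eq_one_left hdeg
    rw [hab] at this
    simp at this
  · rw [hp, hab, map_add, map_mul, aeval_C, aeval_C, aeval_X]
    congr 1
    exact (Algebra.smul_def _ _).symm

section Fiber

variable (S : DoubleDanielewski k)

/-- The fibre of `x` over `c ≠ 0` is an affine line with coordinate `z`. -/
theorem exists_fiber_hom {c : k} (hc : c ≠ 0) : ∃ θ : S.B →ₐ[k] k[X], θ S.x = C c ∧ θ S.z = X ∧
    ∀ b, θ b = 0 → S.x - algebraMap k S.B c ∣ b := by
  have hcan : ∀ (n : ℕ) (p : k[X]), C c ^ n * (C (c ^ n)⁻¹ * p) = p := by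
    intro n p
    rw [← mul_assoc, ← C_pow, ← C_mul, mul_inv_cancel₀ (pow_ne_zero _ hc), C_1, one_mul]
  refine ⟨S.lift (C c) (C (c ^ S.d)⁻¹ * evalXZ (C c) X S.P) X
    (C (c ^ S.e)⁻¹ * evalXYZ (C c) (C (c ^ S.d)⁻¹ * evalXZ (C c) X S.P) X S.Q)
    (hcan _ _) (hcan _ _), S.lift_x, S.lift_z, fun b hb => ?_⟩
  obtain ⟨n, p, hp⟩ := S.exists_pow_mul_eq_evalXZ b
  have h1 := congrArg (S.lift (C c) (C (c ^ S.d)⁻¹ * evalXZ (C c) X S.P) X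
    (C (c ^ S.e)⁻¹ * evalXYZ (C c) (C (c ^ S.d)⁻¹ * evalXZ (C c) X S.P) X S.Q)
    (hcan _ _) (hcan _ _)) hp
  rw [map_mul, hb, mul_zero, algHom_evalXZ, lift_x, lift_z] at h1
  have h2 : C (X - C c) ∣ p := by
    rw [C_dvd_iff_dvd_coeff]
    intro i
    rw [dvd_iff_isRoot, IsRoot.def]
    have h3 : p.map (Polynomial.evalRingHom c) = 0 := by
      have h4 : (aeval (R := k) (C c : k[X])).toRingHom = C.comp (Polynomial.evalRingHom c) := by
        ext <;> simp
      rw [h1, evalXZ, h4, ← eval₂_map, eval₂_C_X]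
    have := congrArg (fun q => q.coeff i) h3
    simpa using this
  obtain ⟨q, rfl⟩ := h2
  rw [evalXZ_mul, evalXZ_C, map_sub, aeval_X, aeval_C] at hp
  -- Modulo $x-c$ the power $x^n$ is the unit $c^n$, so the denominator $x^n$ can be discarded.
  have h4 : S.x - algebraMap k S.B c ∣ algebraMap k S.B (c ^ n) * b := by
    have h5 : S.x - algebraMap k S.B c ∣ S.x ^ n - algebraMap k S.B (c ^ n) := by
      rw [map_pow]; exact sub_dvd_pow_sub_pow _ _ _
    have h6 : algebraMap k S.B (c ^ n) * b =
        S.x ^ n * b - (S.x ^ n - algebraMap k S.B (c ^ n)) * b := by ring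
    rw [h6, hp]
    exact dvd_sub (dvd_mul_right _ _) (h5.mul_right _)
  exact ((pow_ne_zero n hc).isUnit.map (algebraMap k S.B)).dvd_mul_left.1 h4

end Fiber

/-- A quotient $(z-a)/x$ would have weight $(-1,-1)$, whereas below $z$-degree $r$ second exponents
are nonnegative; here $r\ge2$ enters. -/
theorem not_x_dvd_z_sub (S : DoubleDanielewski k) (hr : 2 ≤ S.r) (hs : 0 < S.s) (a : k) :
    ¬ S.x ∣ S.z - algebraMap k S.B a := by
  rintro ⟨w, hw⟩
  obtain ⟨M, hMx, -, hMz⟩ := S.exists_lexModel (by omega) hs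
  rw [← hMx, ← hMz] at hw
  have h1 : M.z - algebraMap k S.B a = evalXZ M.x M.z (X - C (C a)) := by
    rw [evalXZ_sub, evalXZ_X, evalXZ_C, aeval_C]
  have h2 := M.orderTop_toHahn_evalXZ (X_sub_C_ne_zero (C a))
  rw [← h1, natDegree_X_sub_C, (monic_X_sub_C (C a)).leadingCoeff, natTrailingDegree_one] at h2
  have h3 := M.wt_eq_of_orderTop h2
  have hw0 : w ≠ 0 := by
    rintro rfl
    rw [hw, mul_zero, map_zero] at h2
    simp at h2
  rw [hw, M.wt_mul M.x_ne_zero hw0, LexModel.wt_x] at h3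
  have h4 : M.wt w = toLex (-((1 : ℕ) : ℚ), -1) := by
    refine add_left_cancel (h3.trans ?_)
    rw [lex_add]
    simp
  have := M.snd_wt_nonneg hw0 (by omega) h4
  norm_num at this

/-- A root in `k[X]` of a monic polynomial over `k` is constant. -/
theorem exists_eq_C_of_evalXZ_zero {P : k[X][X]} (hP : P.Monic) (hr : 0 < P.natDegree) {v : k[X]}
    (h : evalXZ 0 v P = 0) : ∃ a : k, v = C a := by
  have h0 : (aeval (R := k) (0 : k[X])).toRingHom = C.comp (Polynomial.evalRingHom 0) := by
    ext <;> simp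
  rw [evalXZ, h0, ← eval₂_map] at h
  change (P.map (Polynomial.evalRingHom 0)).comp v = 0 at h
  have h1 := natDegree_comp (p := P.map (Polynomial.evalRingHom 0)) (q := v)
  rw [h, natDegree_zero, hP.natDegree_map] at h1
  exact ⟨_, eq_C_of_natDegree_eq_zero ((Nat.mul_eq_zero.1 h1.symm).resolve_left hr.ne')⟩

/-- If $b\ne0$, then $x_2$ vanishes on a fibre of $x_1$ over a nonzero point, which is a line. There
$P_2(0,z_2)=0$ makes $z_2$ constant, so $x_2$ divides some $z_2-c$, which is impossible. -/
theorem exists_map_x_eq_smul (hr₁ : 2 ≤ S₁.r) (hs₁ : 0 < S₁.s) (hr₂ : 2 ≤ S₂.r)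
    (hs₂ : 0 < S₂.s) (ψ : S₂.B ≃ₐ[k] S₁.B) : ∃ a : k, a ≠ 0 ∧ ψ S₂.x = a • S₁.x := by
  obtain ⟨a, b, ha, h⟩ := exists_map_x_eq_linear hr₁ hs₁ hr₂ hs₂ ψ
  refine ⟨a, ha, ?_⟩
  suffices hb : b = 0 by rw [h, hb, map_zero, add_zero]
  by_contra hb
  have hc : -(b / a) ≠ 0 := neg_ne_zero.2 (div_ne_zero hb ha)
  obtain ⟨θ, θx, θz, hker⟩ := S₁.exists_fiber_hom hc
  have h' : ψ S₂.x = algebraMap k S₁.B a * (S₁.x - algebraMap k S₁.B (-(b / a))) := by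
    rw [h, mul_sub, ← map_mul, show a * -(b / a) = -b by field_simp, map_neg, sub_neg_eq_add]
    congr 1
    exact Algebra.smul_def a S₁.x
  have h1 : θ (ψ S₂.x) = 0 := by
    rw [h', map_mul, map_sub, θx, AlgHom.commutes, AlgHom.commutes]
    simp
  have h2 : evalXZ 0 (θ (ψ S₂.z)) S₂.P = 0 := by
    have := congrArg (fun b => θ (ψ b)) S₂.x_pow_mul_y
    simp only [map_mul, map_pow, h1, zero_pow S₂.d_pos.ne', zero_mul] at this
    have h3 := algHom_evalXZ (θ.comp ψ.toAlgHom) S₂.x S₂.z S₂.P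
    simp only [AlgHom.comp_apply, AlgEquiv.toAlgHom_apply] at h3
    rw [h3, h1] at this
    exact this.symm
  obtain ⟨c, hc⟩ := exists_eq_C_of_evalXZ_zero S₂.P_monic
    (show 0 < S₂.P.natDegree from lt_of_lt_of_le (by norm_num) hr₂) h2
  have h3 : θ (ψ (S₂.z - algebraMap k S₂.B c)) = 0 := by
    rw [map_sub, map_sub, hc, AlgEquiv.commutes, AlgHom.commutes]
    simp
  obtain ⟨w, hw⟩ := hker _ h3
  refine S₂.not_x_dvd_z_sub hr₂ hs₂ c ?_
  have h4 : ψ S₂.x ∣ ψ (S₂.z - algebraMap k S₂.B c) := by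
    rw [h', hw, (ha.isUnit.map (algebraMap k S₁.B)).mul_left_dvd]
    exact dvd_mul_right _ _
  exact (map_dvd_iff ψ).1 h4

/-- An isomorphism maps `z` to an element that is linear in `z` over `k[x]`. -/
theorem exists_map_z_eq_linear (hr₁ : 2 ≤ S₁.r) (hs₁ : 0 < S₁.s) {a : k} (ha : a ≠ 0)
    (ψ : S₂.B ≃ₐ[k] S₁.B) (hx : ψ S₂.x = a • S₁.x) :
    ∃ p q : k[X], ψ S₂.z = aeval S₁.x p * S₁.z + aeval S₁.x q := by
  obtain ⟨M, hMx, -, hMz⟩ := S₁.exists_lexModel (by omega) hs₁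
  have hdom := M.isDomain
  obtain ⟨n, p, hp⟩ := S₂.exists_pow_mul_eq_evalXZ (ψ.symm S₁.z)
  set u := ψ S₂.z with hu
  -- A nonzero multiple of $x_1^nz_1$ is a polynomial in $x_1$ and $u$. Its first exponent is $-1$,
  -- so if $u$ has first exponent $-N<0$, then the degree of that polynomial times $N$ is $1$; the
  -- case $u\in k[x_1]$ is excluded because $z_1$ occurs.
  have hp' : evalXZ M.x u (scaleX a p) = evalXZ M.x M.z (C (C (a ^ n) * X ^ n) * X) := by
    have h1 := congrArg ψ hp
    rw [map_mul, map_pow, ψ.apply_symm_apply] at h1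
    have h2 := algHom_evalXZ ψ.toAlgHom S₂.x S₂.z p
    simp only [AlgEquiv.toAlgHom_apply] at h2
    rw [h2, hx, evalXZ_smul_left] at h1
    rw [hMx, hMz, hu, ← h1, evalXZ_mul, evalXZ_C, evalXZ_X, map_mul, aeval_C, map_pow, map_pow,
      aeval_X, ← mul_pow]
    congr 2
    exact Algebra.smul_def a S₁.x
  have hcoef : C (a ^ n) * (X : k[X]) ^ n ≠ 0 :=
    mul_ne_zero (C_ne_zero.2 (pow_ne_zero _ ha)) (pow_ne_zero _ X_ne_zero)
  have hlin : C (C (a ^ n) * (X : k[X]) ^ n) * X ≠ 0 :=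
    mul_ne_zero (C_ne_zero.2 hcoef) X_ne_zero
  have hdeg : (C (C (a ^ n) * (X : k[X]) ^ n) * X).natDegree = 1 := by
    rw [natDegree_C_mul hcoef, natDegree_X]
  by_cases hA : ∀ v : ℚ, ((toLex (-1, v) : ℚ ×ₗ ℚ) : WithTop (ℚ ×ₗ ℚ)) < (M.toHahn u).orderTop
  · exfalso
    obtain ⟨q, hq⟩ := LexModel.exists_eq_aeval_x (M := M) (by omega) hA
    have h1 : evalXZ M.x u (scaleX a p) =
        evalXZ M.x M.z (C (evalXZ X q (scaleX a p))) := by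
      rw [evalXZ_C, algHom_evalXZ, aeval_X, ← hq]
    have h2 := M.evalXZ_injective (h1.symm.trans hp')
    rw [← h2, natDegree_C] at hdeg
    exact zero_ne_one hdeg
  · have hu0 : u ≠ 0 := by
      rintro h0
      exact hA fun v => by rw [h0, map_zero, HahnSeries.orderTop_zero]; exact WithTop.coe_lt_top _
    obtain ⟨l, i, j, m, hi, hj, hw⟩ := M.exists_orderTop_eq hu0
    set N := i + S₁.r * j + S₁.r * S₁.s * m with hN
    obtain ⟨v, hv⟩ : ∃ v : ℚ, (M.toHahn u).orderTop =
        ((toLex (-(N : ℚ), v) : ℚ ×ₗ ℚ) : WithTop (ℚ ×ₗ ℚ)) := by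
      refine ⟨(l - S₁.d * j - (S₁.d * S₁.s + S₁.e) * m : ℚ), hw.trans ?_⟩
      rw [lexWeight, hN]
      push_cast
      rfl
    have hN0 : 0 < N := by
      rcases Nat.eq_zero_or_pos N with h0 | h0
      · refine absurd (fun v' => ?_) hA
        rw [hv, h0, WithTop.coe_lt_coe, Prod.Lex.toLex_lt_toLex]
        left
        simp
      · exact h0
    have hp0 : scaleX a p ≠ 0 := by
      intro h0
      rw [h0] at hp'
      have : (0 : k[X][X]) = C (C (a ^ n) * (X : k[X]) ^ n) * X := by
        refine M.evalXZ_injective (Eq.trans ?_ hp')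
        simp [← evalXZHom_apply]
      exact hlin this.symm
    have h1 := orderTop_evalXZ (by exact_mod_cast hN0 : (0 : ℚ) < N) hv hp0
    rw [← M.toHahn_evalXZ, hp', M.orderTop_toHahn_evalXZ hlin, hdeg, WithTop.coe_inj] at h1
    have h2 := (Prod.mk.inj (toLex_inj.1 h1)).1
    have h3 : (scaleX a p).natDegree * N = 1 := by
      have : (((scaleX a p).natDegree * N : ℕ) : ℚ) = (1 : ℕ) := by push_cast at h2 ⊢; linarith
      exact_mod_cast this
    have hN1 := Nat.eq_one_of_mul_eq_one_left h3
    obtain ⟨f, hf, hfu⟩ := M.exists_eq_evalXZ (n := 2) hr₁ (a := u) fun v' => by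
      rw [hv, hN1, WithTop.coe_lt_coe, Prod.Lex.toLex_lt_toLex]
      left
      norm_num
    have hf1 : f.natDegree ≤ 1 := by
      rw [natDegree_le_iff_coeff_eq_zero]
      intro N' hN'
      exact coeff_eq_zero_of_degree_lt (hf.trans_le (by exact_mod_cast hN'))
    obtain ⟨p', q', rfl⟩ := exists_eq_X_add_C_of_natDegree_le_one hf1
    refine ⟨p', q', ?_⟩
    rw [hfu, evalXZ_add, evalXZ_mul, evalXZ_C, evalXZ_C, evalXZ_X, hMx, hMz]

theorem symm_map_x {a : k} (ha : a ≠ 0) (ψ : S₂.B ≃ₐ[k] S₁.B) (hx : ψ S₂.x = a • S₁.x) :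
    ψ.symm S₁.x = a⁻¹ • S₂.x := by
  rw [ψ.symm_apply_eq, map_smul, hx, smul_smul, inv_mul_cancel₀ ha, one_smul]

/-- Both $\psi$ and $\psi^{-1}$ are linear in $z$; composing them and comparing coefficients of $Z$
shows that the leading coefficient is a unit of $k[X]$, hence a constant. -/
theorem exists_map_z_eq (hr₁ : 2 ≤ S₁.r) (hs₁ : 0 < S₁.s) (hr₂ : 2 ≤ S₂.r) (hs₂ : 0 < S₂.s)
    {a : k} (ha : a ≠ 0) (ψ : S₂.B ≃ₐ[k] S₁.B) (hx : ψ S₂.x = a • S₁.x) :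
    ∃ (c : k) (δ : k[X]), c ≠ 0 ∧ ψ S₂.z = c • S₁.z + aeval S₁.x δ := by
  obtain ⟨M, hMx, -, hMz⟩ := S₁.exists_lexModel (by omega) hs₁
  obtain ⟨p, q, hpq⟩ := exists_map_z_eq_linear hr₁ hs₁ ha ψ hx
  obtain ⟨p', q', hpq'⟩ := exists_map_z_eq_linear hr₂ hs₂ (inv_ne_zero ha) ψ.symm
    (symm_map_x ha ψ hx)
  have haev : ∀ f : k[X], ψ (aeval S₂.x f) = aeval S₁.x (f.comp (C a * X)) := by
    intro f
    rw [aeval_comp, map_mul, aeval_C, aeval_X]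
    refine (aeval_algHom_apply ψ.toAlgHom S₂.x f).symm.trans ?_
    congr 2
    exact hx.trans (Algebra.smul_def a S₁.x)
  have h1 := congrArg ψ hpq'
  rw [ψ.apply_symm_apply, map_add, map_mul, haev, haev, hpq] at h1
  have h2 : (X : k[X][X]) = C (p'.comp (C a * X) * p) * X +
      C (p'.comp (C a * X) * q + q'.comp (C a * X)) := by
    refine M.evalXZ_injective ?_
    rw [evalXZ_X, evalXZ_add, evalXZ_mul, evalXZ_C, evalXZ_C, evalXZ_X, hMx, hMz, map_mul, map_add,
      map_mul]
    rw [mul_add, ← mul_assoc, add_assoc] at h1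
    exact h1
  have h3 := congrArg (fun f => f.coeff 1) h2
  simp only [coeff_X_one, coeff_add, coeff_C_mul, mul_one, coeff_C_succ, add_zero] at h3
  have hpu : IsUnit p := IsUnit.of_mul_eq_one _ (by rw [mul_comm]; exact h3.symm)
  obtain ⟨c, hc, rfl⟩ := Polynomial.isUnit_iff.1 hpu
  refine ⟨c, q, hc.ne_zero, ?_⟩
  rw [hpq, aeval_C]
  congr 1
  exact (Algebra.smul_def c S₁.z).symm

end DoubleDanielewski

end

/-! ### Numerical invariants from the set of weights -/

section WeightComparison

/-- The orders of `y ^ j * t ^ m` for the parameters with index `2` are orders of monomials for the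
parameters with index `1`. -/
def WeightsDominated (d₁ e₁ r₁ s₁ d₂ e₂ r₂ s₂ : ℕ) : Prop :=
  ∀ j m : ℕ, ∃ i' j' m' : ℕ, i' < r₁ ∧ j' < s₁ ∧ r₂ * (j + s₂ * m) = i' + r₁ * (j' + s₁ * m') ∧
    d₂ * j + (d₂ * s₂ + e₂) * m ≤ d₁ * j' + (d₁ * s₁ + e₁) * m'

variable {d₁ e₁ r₁ s₁ d₂ e₂ r₂ s₂ r : ℕ}

/-- The weight of $y_2$ has negative second exponent. In the first model this requires a factor
$y_1$ or $t_1$, whose first exponent is at most $-r_1$. -/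
theorem WeightsDominated.r_le (h : WeightsDominated d₁ e₁ r₁ s₁ d₂ e₂ r₂ s₂) (hd : 0 < d₂) :
    r₁ ≤ r₂ := by
  obtain ⟨i, j, m, hi, hj, h1, h2⟩ := h 1 0
  have h3 : 0 < j + s₁ * m := by
    by_contra h3
    have hj0 : j = 0 := by omega
    have hm : m = 0 := (Nat.mul_eq_zero.1 (by omega : s₁ * m = 0)).resolve_left (by omega)
    subst hj0 hm
    simp at h2
    omega
  have := Nat.le_mul_of_pos_right r₁ h3
  omega

theorem WeightsDominated.of_same_r (h : WeightsDominated d₁ e₁ r s₁ d₂ e₂ r s₂) (j m : ℕ) :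
    ∃ j' m' : ℕ, j' < s₁ ∧ j + s₂ * m = j' + s₁ * m' ∧
      d₂ * j + (d₂ * s₂ + e₂) * m ≤ d₁ * j' + (d₁ * s₁ + e₁) * m' := by
  obtain ⟨i', j', m', hi, hj, h1, h2⟩ := h j m
  refine ⟨j', m', hj, ?_, h2⟩
  have h3 := congrArg (· / r) h1
  have hr : 0 < r := by omega
  simpa [Nat.add_mul_div_left _ _ hr, Nat.div_eq_of_lt hi, Nat.mul_div_cancel_left _ hr] using h3

/-- With $r_1=r_2$ and $s_1>1$, the weight of $y_2$ can only come from $x_1^ly_1$. -/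
theorem WeightsDominated.d_le (h : WeightsDominated d₁ e₁ r s₁ d₂ e₂ r s₂) (hs : 1 < s₁) :
    d₂ ≤ d₁ := by
  obtain ⟨j, m, hj, h1, h2⟩ := h.of_same_r 1 0
  have hm : m = 0 := by
    by_contra hm
    have := Nat.le_mul_of_pos_right s₁ (Nat.pos_of_ne_zero hm)
    omega
  subst hm
  have : j = 1 := by omega
  subst this
  simpa using h2

/-- If $s_2<s_1$, the weight of $t_2$ would come from a monomial without $t_1$, whose second
exponent is at least $-d_1s_2>-(d_2s_2+e_2)$. -/
theorem WeightsDominated.s_le (h : WeightsDominated d₁ e₁ r s₁ d₂ e₂ r s₂) (hd : d₁ ≤ d₂)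
    (he : 0 < e₂) : s₁ ≤ s₂ := by
  obtain ⟨j, m, hj, h1, h2⟩ := h.of_same_r 0 1
  have hm : 0 < m := by
    by_contra hm
    have hm : m = 0 := by omega
    subst hm
    have : j = s₂ := by omega
    subst this
    have := Nat.mul_le_mul_right j hd
    simp at h2
    omega
  have := Nat.le_mul_of_pos_right s₁ hm
  omega

theorem WeightsDominated.e_le {d s : ℕ} (h : WeightsDominated d e₁ r s d e₂ r s) : e₂ ≤ e₁ := by
  obtain ⟨j, m, hj, h1, h2⟩ := h.of_same_r 0 1
  have hs : 0 < s := by omega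
  have hm : m = 1 := by
    have h3 := congrArg (· / s) h1
    simpa [Nat.add_mul_div_left _ _ hs, Nat.div_eq_of_lt hj, Nat.div_self hs, eq_comm] using h3
  subst hm
  have : j = 0 := by omega
  subst this
  simpa using h2

/-- If $s_2>1$, then $t_1$ must have the weight of some $x_2^ly_2$, so $d_1+e_1\le d_2$. The weight
of $t_2$ then gives $d_2s_2+e_2\le(d_1+e_1)s_2\le d_2s_2$, a contradiction. -/
theorem WeightsDominated.s_eq_one (h : WeightsDominated d₁ e₁ r 1 d₂ e₂ r s₂)
    (h' : WeightsDominated d₂ e₂ r s₂ d₁ e₁ r 1) (he : 0 < e₂) : s₂ ≤ 1 := by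
  by_contra! hs
  obtain ⟨j, m, hj, h1, h2⟩ := h'.of_same_r 0 1
  have hm : m = 0 := by
    by_contra hm
    have := Nat.le_mul_of_pos_right s₂ (Nat.pos_of_ne_zero hm)
    omega
  subst hm
  have : j = 1 := by omega
  subst this
  obtain ⟨j, m, hj, h3, h4⟩ := h.of_same_r 0 1
  have hj0 : j = 0 := by omega
  subst hj0
  have : m = s₂ := by omega
  subst this
  have h5 := Nat.mul_le_mul_right m (by simpa using h2 : d₁ + e₁ ≤ d₂)
  simp at h4
  omega

theorem WeightsDominated.antisymm (h : WeightsDominated d₁ e₁ r₁ s₁ d₂ e₂ r₂ s₂)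
    (h' : WeightsDominated d₂ e₂ r₂ s₂ d₁ e₁ r₁ s₁) (hd₁ : 0 < d₁) (hd₂ : 0 < d₂) (he₁ : 0 < e₁)
    (he₂ : 0 < e₂) : r₁ = r₂ ∧ s₁ = s₂ ∧ (1 < s₁ → d₁ = d₂ ∧ e₁ = e₂) := by
  obtain rfl : r₁ = r₂ := le_antisymm (h.r_le hd₂) (h'.r_le hd₁)
  have hs₁ : 0 < s₁ := by obtain ⟨j, -, hj, -⟩ := h.of_same_r 0 0; omega
  have hs₂ : 0 < s₂ := by obtain ⟨j, -, hj, -⟩ := h'.of_same_r 0 0; omega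
  refine ⟨rfl, ?_⟩
  rcases (by omega : s₁ = 1 ∨ 1 < s₁) with rfl | h₁
  · have := h.s_eq_one h' he₂
    omega
  rcases (by omega : s₂ = 1 ∨ 1 < s₂) with rfl | h₂
  · have := h'.s_eq_one h he₁
    omega
  obtain rfl : d₁ = d₂ := le_antisymm (h'.d_le h₂) (h.d_le h₁)
  obtain rfl : s₁ = s₂ := le_antisymm (h.s_le le_rfl he₂) (h'.s_le le_rfl he₁)
  exact ⟨rfl, fun _ => ⟨rfl, le_antisymm h'.e_le h.e_le⟩⟩

end WeightComparison

/-! ### Isomorphisms preserve weights -/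

section

open Polynomial

namespace LexModel

variable {k A₁ A₂ : Type*} [Field k] [CommRing A₁] [Algebra k A₁] [CommRing A₂] [Algebra k A₂]
  {d₁ e₁ r₁ s₁ d₂ e₂ r₂ s₂ : ℕ} (M₁ : LexModel k A₁ d₁ e₁ r₁ s₁) (M₂ : LexModel k A₂ d₂ e₂ r₂ s₂)
  {a c : k} {δ : k[X]}

theorem orderTop_linear (hc : c ≠ 0) : (M₁.toHahn (c • M₁.z + aeval M₁.x δ)).orderTop =
    ((toLex (-1, 0) : ℚ ×ₗ ℚ) : WithTop (ℚ ×ₗ ℚ)) := by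
  have h : c • M₁.z + aeval M₁.x δ = evalXZ M₁.x M₁.z (C (C c) * X + C δ) := by
    rw [evalXZ_add, evalXZ_mul, evalXZ_C, evalXZ_C, evalXZ_X, aeval_C, Algebra.smul_def]
  have hC : (C c : k[X]) ≠ 0 := C_ne_zero.2 hc
  have hd : (C (C c) * X + C δ : k[X][X]).natDegree = 1 := natDegree_linear hC
  have hl : (C (C c) * X + C δ : k[X][X]).leadingCoeff = C c := leadingCoeff_linear hC
  rw [h, M₁.orderTop_toHahn_evalXZ (fun h0 => by simp [h0] at hd), hd, hl]
  simp

/-- A homomorphism that is linear on `x` and `z` preserves orders. -/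
theorem wt_map (ψ : A₂ →ₐ[k] A₁) (ha : a ≠ 0) (hc : c ≠ 0) (hx : ψ M₂.x = a • M₁.x)
    (hz : ψ M₂.z = c • M₁.z + aeval M₁.x δ) {b : A₂} (hb : b ≠ 0) (hψb : ψ b ≠ 0) {n : ℕ}
    {p : k[X][X]} (hp : M₂.x ^ n * b = evalXZ M₂.x M₂.z p) : M₁.wt (ψ b) = M₂.wt b := by
  have := M₁.isDomain
  have := M₂.isDomain
  have hp0 : p ≠ 0 := by
    rintro rfl
    rw [← evalXZHom_apply, map_zero] at hp
    exact mul_ne_zero (pow_ne_zero _ M₂.x_ne_zero) hb hp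
  have h2 : M₂.wt (M₂.x ^ n) + M₂.wt b =
      toLex (-(p.natDegree : ℚ), (p.leadingCoeff.natTrailingDegree : ℚ)) := by
    rw [← M₂.wt_mul (pow_ne_zero _ M₂.x_ne_zero) hb, hp]
    exact M₂.wt_eq_of_orderTop (M₂.orderTop_toHahn_evalXZ hp0)
  -- The substitution $x\mapsto ax$, $z\mapsto cz+\delta$ changes neither the $Z$-degree of $p$ nor
  -- the trailing degree of its leading coefficient, and these two numbers give the weight.
  have h3 : a ^ n • (M₁.x ^ n * ψ b) = evalXZ M₁.x (ψ M₂.z) (scaleX a p) := by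
    rw [← evalXZ_smul_left, ← hx, ← algHom_evalXZ, ← hp, map_mul, map_pow, hx, _root_.smul_pow,
      smul_mul_assoc]
  have h4 : M₁.wt (M₁.x ^ n) + M₁.wt (ψ b) =
      toLex (-(p.natDegree : ℚ), (p.leadingCoeff.natTrailingDegree : ℚ)) := by
    have h0 : M₁.x ^ n * ψ b ≠ 0 := mul_ne_zero (pow_ne_zero _ M₁.x_ne_zero) hψb
    rw [← M₁.wt_mul (pow_ne_zero _ M₁.x_ne_zero) hψb, ← M₁.wt_smul (pow_ne_zero n ha) h0, h3]
    refine M₁.wt_eq_of_orderTop ?_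
    rw [M₁.toHahn_evalXZ, orderTop_evalXZ one_pos (by rw [hz]; exact M₁.orderTop_linear hc)
      (scaleX_ne_zero ha hp0), natDegree_scaleX ha, leadingCoeff_scaleX ha,
      natTrailingDegree_comp_C_mul_X ha]
    simp
  rw [wt_x_pow] at h2 h4
  exact add_left_cancel (h4.trans h2.symm)

/-- The weight of $y_2^jt_2^m$ is that of a basis monomial of $A_1$; dropping the factor $x_1^{l'}$,
with $l'\ge0$, leaves the inequality. -/
theorem weightsDominated (ψ : A₂ ≃ₐ[k] A₁) (hψ : ∀ b, b ≠ 0 → M₁.wt (ψ b) = M₂.wt b) :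
    WeightsDominated d₁ e₁ r₁ s₁ d₂ e₂ r₂ s₂ := by
  intro j m
  have h0 := M₂.monomial_ne_zero 0 0 j m
  obtain ⟨l', i', j', m', hi, hj, hw⟩ := exists_wt_eq (M := M₁)
    ((map_ne_zero_iff ψ ψ.injective).2 h0)
  rw [hψ _ h0, M₂.wt_monomial, lexWeight, lexWeight] at hw
  obtain ⟨h1, h2⟩ := Prod.mk.inj (toLex_inj.1 hw)
  refine ⟨i', j', m', hi, hj, ?_, ?_⟩
  · have : ((r₂ * (j + s₂ * m) : ℕ) : ℚ) = ((i' + r₁ * (j' + s₁ * m') : ℕ) : ℚ) := by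
      push_cast at h1 ⊢; linarith
    exact_mod_cast this
  · have : ((d₂ * j + (d₂ * s₂ + e₂) * m : ℕ) : ℚ) ≤
        ((d₁ * j' + (d₁ * s₁ + e₁) * m' : ℕ) : ℚ) := by
      have := (Nat.cast_nonneg l' : (0 : ℚ) ≤ l')
      push_cast at h2 ⊢; linarith
    exact_mod_cast this

end LexModel

namespace DoubleDanielewski

variable {k : Type*} [Field k] {S₁ S₂ : DoubleDanielewski k}

theorem weightsDominated (hr₁ : 2 ≤ S₁.r) (hs₁ : 0 < S₁.s) (hr₂ : 2 ≤ S₂.r) (hs₂ : 0 < S₂.s)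
    (ψ : S₂.B ≃ₐ[k] S₁.B) :
    WeightsDominated S₁.d S₁.e S₁.r S₁.s S₂.d S₂.e S₂.r S₂.s := by
  obtain ⟨a, ha, hx⟩ := exists_map_x_eq_smul hr₁ hs₁ hr₂ hs₂ ψ
  obtain ⟨c, δ, hc, hz⟩ := exists_map_z_eq hr₁ hs₁ hr₂ hs₂ ha ψ hx
  obtain ⟨M₁, hx₁, -, hz₁⟩ := S₁.exists_lexModel (by omega) hs₁
  obtain ⟨M₂, hx₂, -, hz₂⟩ := S₂.exists_lexModel (by omega) hs₂
  rw [← hx₁, ← hx₂] at hx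
  rw [← hx₁, ← hz₁, ← hz₂] at hz
  refine M₁.weightsDominated M₂ ψ fun b hb => ?_
  obtain ⟨n, p, hp⟩ := S₂.exists_pow_mul_eq_evalXZ b
  rw [← hx₂, ← hz₂] at hp
  exact M₁.wt_map M₂ ψ.toAlgHom ha hc hx hz hb ((map_ne_zero_iff ψ ψ.injective).2 hb) hp

/-- The numerical invariants of isomorphic algebras agree. -/
theorem invariants_eq (hr₁ : 2 ≤ S₁.r) (hs₁ : 0 < S₁.s) (hr₂ : 2 ≤ S₂.r) (hs₂ : 0 < S₂.s)
    (ψ : S₂.B ≃ₐ[k] S₁.B) :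
    S₁.r = S₂.r ∧ S₁.s = S₂.s ∧ (1 < S₁.s → S₁.d = S₂.d ∧ S₁.e = S₂.e) :=
  (weightsDominated hr₁ hs₁ hr₂ hs₂ ψ).antisymm (weightsDominated hr₂ hs₂ hr₁ hs₁ ψ.symm)
    S₁.d_pos S₂.d_pos S₁.e_pos S₂.e_pos

end DoubleDanielewski

end

/-! ### The image of y and the identity for P -/

section

open Polynomial

section Substitution

variable {k : Type*} [Field k]

theorem evalXZ_C_X_eq_comp (w p : k[X][X]) : evalXZ (C X : k[X][X]) w p = p.comp w := by
  rw [evalXZ, comp]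
  congr 1
  ext a <;> simp [Polynomial.algebraMap_apply]

theorem evalXZ_eq_comp (a : k) (w p : k[X][X]) :
    evalXZ (a • C X : k[X][X]) w p = (scaleX a p).comp w := by
  rw [evalXZ_smul_left, evalXZ_C_X_eq_comp]

/-- A linear substitution multiplies the leading term of a monic polynomial by a power. -/
theorem degree_comp_sub_lt {R : Type*} [CommRing R] [IsDomain R] [Algebra k R] {p q : R[X]}
    (hp : p.Monic) (hq : q.Monic) (hpq : p.natDegree = q.natDegree) {c : k} (hc : c ≠ 0) (b : R) :
    (p.comp (c • X + C b) - c ^ q.natDegree • q).degree < q.natDegree := by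
  have hcR : algebraMap k R c ≠ 0 := (map_ne_zero_iff _ (algebraMap k R).injective).2 hc
  have hlin : (c • X + C b : R[X]) = C (algebraMap k R c) * X + C b := by
    rw [← algebraMap_smul R c (X : R[X]), smul_eq_C_mul]
  have hsm : c ^ q.natDegree • q = C (algebraMap k R c ^ q.natDegree) * q := by
    rw [← map_pow, ← algebraMap_smul R (c ^ q.natDegree) q, smul_eq_C_mul]
  have hpow : algebraMap k R c ^ q.natDegree ≠ 0 := pow_ne_zero _ hcR
  have hl : (p.comp (c • X + C b)).leadingCoeff = algebraMap k R c ^ q.natDegree := by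
    rw [hlin, leadingCoeff_comp (by rw [natDegree_linear hcR]; exact one_ne_zero),
      hp.leadingCoeff, leadingCoeff_linear hcR, one_mul, hpq]
  have h0 : p.comp (c • X + C b) ≠ 0 := leadingCoeff_ne_zero.1 (hl ▸ hpow)
  have hd : (p.comp (c • X + C b)).degree = q.natDegree := by
    rw [degree_eq_natDegree h0, natDegree_comp, hlin, natDegree_linear hcR, mul_one, hpq]
  rw [← hd]
  refine degree_sub_lt_left ?_ h0 ?_
  · rw [hd, hsm, degree_C_mul hpow, degree_eq_natDegree hq.ne_zero]
  · rw [hl, hsm, leadingCoeff_mul, leadingCoeff_C, hq.leadingCoeff, mul_one]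

/-- Replacing $\beta$ by its remainder modulo $q$ leaves a difference divisible by $q$ and of
smaller degree, hence zero. -/
theorem exists_eq_mul_C_of_eq_add {R : Type*} [CommRing R] [IsDomain R] {q D α β : R[X]} {c : R}
    (hq : q.Monic) (hD : D.degree < q.degree) (h : D = α * q + β * C c) :
    ∃ f : R[X], f.degree < q.degree ∧ D = f * C c := by
  have hlt : (β %ₘ q).degree < q.degree := degree_modByMonic_lt _ hq
  refine ⟨β %ₘ q, hlt, ?_⟩
  have h1 : D - β %ₘ q * C c = q * (α + β /ₘ q * C c) := by
    rw [h]
    nth_rw 1 [← modByMonic_add_div β q]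
    ring
  have h2 : (D - β %ₘ q * C c).degree < q.degree := by
    refine (degree_sub_le _ _).trans_lt (max_lt hD (lt_of_le_of_lt ?_ hlt))
    rw [mul_comm, ← smul_eq_C_mul]
    exact degree_smul_le _ _
  exact sub_eq_zero.1 (eq_zero_of_dvd_of_degree_lt ⟨_, h1⟩ h2)

end Substitution

namespace LexModel

variable {k A : Type*} [Field k] [CommRing A] [Algebra k A] {d e r s : ℕ}
  (M : LexModel k A d e r s)

/-- A polynomial in `x`, `z` of `z`-degree less than `r` is divisible by `x ^ n` in `A` only if it is
so in `k[x, z]`. -/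
theorem exists_eq_evalXZ_of_pow_mul {n : ℕ} {b : A} {p : k[X][X]} (hp : p.degree < r)
    (h : M.x ^ n * b = evalXZ M.x M.z p) :
    ∃ f : k[X][X], f.degree < r ∧ b = evalXZ M.x M.z f ∧ p = C X ^ n * f := by
  have := M.isDomain
  obtain ⟨f, hf, hb⟩ : ∃ f : k[X][X], f.degree < r ∧ b = evalXZ M.x M.z f := by
    by_cases hb : b = 0
    · exact ⟨0, by simp, by simp [hb, ← evalXZHom_apply]⟩
    refine M.exists_eq_evalXZ le_rfl fun v => ?_
    have hp0 : p ≠ 0 := by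
      rintro rfl
      rw [← evalXZHom_apply, map_zero] at h
      exact mul_ne_zero (pow_ne_zero _ M.x_ne_zero) hb h
    have h1 : M.wt (M.x ^ n) + M.wt b =
        toLex (-(p.natDegree : ℚ), (p.leadingCoeff.natTrailingDegree : ℚ)) := by
      rw [← M.wt_mul (pow_ne_zero _ M.x_ne_zero) hb, h]
      exact M.wt_eq_of_orderTop (M.orderTop_toHahn_evalXZ hp0)
    rw [wt_x_pow] at h1
    have h2 : (ofLex (M.wt b)).1 = -(p.natDegree : ℚ) := by
      have := congrArg (fun γ => (ofLex γ).1) h1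
      simpa using this
    have h3 : (p.natDegree : ℚ) < r := by
      exact_mod_cast (natDegree_lt_iff_degree_lt hp0).2 hp
    rw [M.orderTop_toHahn hb, WithTop.coe_lt_coe, Prod.Lex.lt_iff]
    left
    change -(r : ℚ) < (ofLex (M.wt b)).1
    rw [h2]
    linarith
  refine ⟨f, hf, hb, M.evalXZ_injective ?_⟩
  rw [← h, hb, evalXZ_mul, evalXZ_pow, evalXZ_C, aeval_X]

end LexModel

namespace DoubleDanielewski

variable {k : Type*} [Field k] {S₁ S₂ : DoubleDanielewski k}

theorem scaleX_P_monic (S : DoubleDanielewski k) (a : k) : (scaleX a S.P).Monic :=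
  S.P_monic.map _

/-- The image of `y` under an isomorphism that is linear on `x` and `z`. -/
theorem exists_map_y_eq (hr₁ : 0 < S₁.r) (hs₁ : 0 < S₁.s) (hr : S₁.r = S₂.r) (hd : S₁.d = S₂.d)
    {a c : k} {δ : k[X]} (ha : a ≠ 0) (hc : c ≠ 0) (ψ : S₂.B →ₐ[k] S₁.B)
    (hx : ψ S₂.x = a • S₁.x) (hz : ψ S₂.z = c • S₁.z + aeval S₁.x δ) :
    ∃ f : k[X][X], f.degree < S₁.r ∧
      a ^ S₁.d • ψ S₂.y = c ^ S₁.r • S₁.y + evalXZ S₁.x S₁.z f ∧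
      evalXZ (a • C X : k[X][X]) (c • X + C δ) S₂.P =
        c ^ S₁.r • S₁.P + C X ^ S₁.d * f := by
  obtain ⟨M, hMx, -, hMz⟩ := S₁.exists_lexModel hr₁ hs₁
  -- The terms of $Z$-degree $r$ cancel. The value of this difference at $(x_1,z_1)$ is divisible by
  -- $x_1^d$ in $B_1$, and in $Z$-degree below $r$ this means divisibility in $k[X,Z]$; the quotient
  -- is $f$.
  have hdeg : (evalXZ (a • C X : k[X][X]) (c • X + C δ) S₂.P - c ^ S₁.r • S₁.P).degree
      < S₁.r := by
    rw [evalXZ_eq_comp]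
    exact degree_comp_sub_lt (S₂.scaleX_P_monic a) S₁.P_monic
      ((natDegree_scaleX ha _).trans hr.symm) hc δ
  have h1 : evalXZ S₁.x S₁.z (evalXZ (a • C X : k[X][X]) (c • X + C δ) S₂.P) =
      S₁.x ^ S₁.d * (a ^ S₁.d • ψ S₂.y) := by
    have h2 : evalXZ S₁.x S₁.z (evalXZ (a • C X : k[X][X]) (c • X + C δ) S₂.P) =
        evalXZ (ψ S₂.x) (ψ S₂.z) S₂.P := by
      rw [← evalXZHom_apply, algHom_evalXZ, map_smul, map_add, map_smul, evalXZHom_apply,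
        evalXZHom_apply, evalXZHom_apply, evalXZ_C, evalXZ_C, evalXZ_X, aeval_X, hx, hz]
    rw [h2, ← algHom_evalXZ, ← S₂.x_pow_mul_y, map_mul, map_pow, hx, ← hd, _root_.smul_pow]
    exact (smul_mul_assoc _ _ _).trans (mul_smul_comm _ _ _).symm
  have h3 : M.x ^ S₁.d * (a ^ S₁.d • ψ S₂.y - c ^ S₁.r • S₁.y) = evalXZ M.x M.z
      (evalXZ (a • C X : k[X][X]) (c • X + C δ) S₂.P - c ^ S₁.r • S₁.P) := by
    rw [evalXZ_sub, evalXZ_smul, hMx, hMz, h1, mul_sub, ← S₁.x_pow_mul_y]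
    congr 1
    exact mul_smul_comm _ _ _
  obtain ⟨f, hf, hb, hp⟩ := M.exists_eq_evalXZ_of_pow_mul hdeg h3
  refine ⟨f, hf, ?_, ?_⟩
  · rw [← hMx, ← hMz, ← hb]
    abel
  · rw [← hp]
    abel

/-- The substitution identity for `P` restricted to `X = 0`. -/
theorem evalXZ_zero_eq {a c : k} {δ : k[X]} {f : k[X][X]}
    (h : evalXZ (a • C X : k[X][X]) (c • X + C δ) S₂.P = c ^ S₁.r • S₁.P + C X ^ S₁.d * f) :
    evalXZ (0 : k[X]) (c • X + C (δ.eval 0)) S₂.P = c ^ S₁.r • evalXZ (0 : k[X]) X S₁.P := by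
  have h1 := congrArg (evalXZHom (0 : k[X]) X) h
  rw [algHom_evalXZ] at h1
  simp only [map_add, map_mul, map_pow, map_smul] at h1
  simp only [evalXZHom_apply, evalXZ_C, evalXZ_X, aeval_X, smul_zero] at h1
  rw [zero_pow S₁.d_pos.ne', zero_mul, add_zero] at h1
  rw [← h1]
  congr 2
  rw [← coeff_zero_eq_aeval_zero', coeff_zero_eq_eval_zero]
  rfl

theorem evalXYZ_zero_eq_map (S : DoubleDanielewski k) (w v : k[X][X]) (z : k[X]) (hv : v = C z) :
    evalXYZ (0 : k[X][X]) w v S.Q =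
      (S.Q.map (evalXZHom (0 : k[X]) z).toRingHom).comp w := by
  rw [evalXYZ, comp, eval₂_map, hv]
  congr 1
  refine RingHom.ext fun p => ?_
  have := algHom_evalXZ (CAlgHom : k[X] →ₐ[k] k[X][X]) 0 z p
  rw [map_zero] at this
  exact this.symm

end DoubleDanielewski

end

/-! ### Coordinate changes, the ideal of (c), and the converse -/

section

open Polynomial

namespace NewCoord

variable {k : Type*} [Field k]

/-- The substitution `(X, Y, Z) ↦ (X₂, Y₂, Z₂)`. -/
noncomputable def substHom (a c u : k) (δ : k[X]) (g : k[X][X]) :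
    MvPolynomial (Fin 3) k →ₐ[k] MvPolynomial (Fin 3) k :=
  MvPolynomial.aeval ![X₂ a, Y₂ u g, Z₂ c δ]

@[simp] theorem substHom_X_zero (a c u : k) (δ : k[X]) (g : k[X][X]) :
    substHom a c u δ g (MvPolynomial.X 0) = X₂ a := by simp [substHom]

@[simp] theorem substHom_X_one (a c u : k) (δ : k[X]) (g : k[X][X]) :
    substHom a c u δ g (MvPolynomial.X 1) = Y₂ u g := by simp [substHom]

@[simp] theorem substHom_X_two (a c u : k) (δ : k[X]) (g : k[X][X]) :
    substHom a c u δ g (MvPolynomial.X 2) = Z₂ c δ := by simp [substHom]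

/-- The inverse of `substHom`. -/
noncomputable def invHom (a c u : k) (δ : k[X]) (g : k[X][X]) :
    MvPolynomial (Fin 3) k →ₐ[k] MvPolynomial (Fin 3) k :=
  MvPolynomial.aeval ![a⁻¹ • MvPolynomial.X 0,
    u⁻¹ • (MvPolynomial.X 1 - evalXZ (a⁻¹ • MvPolynomial.X 0)
      (c⁻¹ • (MvPolynomial.X 2 - aeval (a⁻¹ • MvPolynomial.X 0) δ)) g),
    c⁻¹ • (MvPolynomial.X 2 - aeval (a⁻¹ • MvPolynomial.X 0) δ)]

theorem substHom_comp_invHom {a c u : k} (ha : a ≠ 0) (hc : c ≠ 0) (hu : u ≠ 0) (δ : k[X])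
    (g : k[X][X]) :
    (substHom a c u δ g).comp (invHom a c u δ g) = AlgHom.id k (MvPolynomial (Fin 3) k) := by
  have h0 : a⁻¹ • X₂ a = MvPolynomial.X 0 := by
    rw [X₂, smul_smul, inv_mul_cancel₀ ha, one_smul]
  have h2 : c⁻¹ • (Z₂ c δ - aeval (MvPolynomial.X 0) δ) = MvPolynomial.X 2 := by
    rw [Z₂, add_sub_cancel_right, smul_smul, inv_mul_cancel₀ hc, one_smul]
  have h1 : u⁻¹ • (Y₂ u g - evalXZ (MvPolynomial.X 0) (MvPolynomial.X 2) g) =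
      MvPolynomial.X 1 := by
    rw [Y₂, add_sub_cancel_right, smul_smul, inv_mul_cancel₀ hu, one_smul]
  refine MvPolynomial.algHom_ext fun i => ?_
  fin_cases i <;>
    simp [invHom, algHom_evalXZ, ← aeval_algHom_apply, h0, h1, h2]

theorem invHom_comp_substHom {a c u : k} (ha : a ≠ 0) (hc : c ≠ 0) (hu : u ≠ 0) (δ : k[X])
    (g : k[X][X]) :
    (invHom a c u δ g).comp (substHom a c u δ g) = AlgHom.id k (MvPolynomial (Fin 3) k) := by
  refine MvPolynomial.algHom_ext fun i => ?_
  fin_cases i <;>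
    simp [invHom, X₂, Y₂, Z₂, algHom_evalXZ, ← aeval_algHom_apply, ha, hc, hu]

theorem substHom_surjective {a c u : k} (ha : a ≠ 0) (hc : c ≠ 0) (hu : u ≠ 0) (δ : k[X])
    (g : k[X][X]) : Function.Surjective (substHom a c u δ g) := fun p =>
  ⟨invHom a c u δ g p, DFunLike.congr_fun (substHom_comp_invHom ha hc hu δ g) p⟩

theorem adjoin_eq_top {a c u : k} (ha : a ≠ 0) (hc : c ≠ 0) (hu : u ≠ 0) (δ : k[X])
    (g : k[X][X]) : Algebra.adjoin k {X₂ a, Y₂ u g, Z₂ c δ} = ⊤ := by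
  have h : ({X₂ a, Y₂ u g, Z₂ c δ} : Set (MvPolynomial (Fin 3) k)) =
      Set.range ![X₂ a, Y₂ u g, Z₂ c δ] := by
    ext p
    simp
    tauto
  rw [h, Algebra.adjoin_range_eq_range_aeval]
  exact (AlgHom.range_eq_top _).2 (substHom_surjective ha hc hu δ g)

end NewCoord

namespace DoubleDanielewski

open NewCoord

variable {k : Type*} [Field k]

section Maps

variable (S : DoubleDanielewski k) {A A' : Type*} [CommRing A] [Algebra k A] [CommRing A']
  [Algebra k A']

theorem algHom_polyG (f : A →ₐ[k] A') (a b c : A) :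
    f (S.polyG a b c) = S.polyG (f a) (f b) (f c) := by
  simp [polyG, algHom_evalXZ]

theorem map_tripleIdeal (f : A →ₐ[k] A') (a b c : A) :
    (S.tripleIdeal a b c).map f = S.tripleIdeal (f a) (f b) (f c) := by
  rw [tripleIdeal, tripleIdeal, Ideal.map_span]
  simp [Set.image_insert_eq, algHom_evalXYZ, algHom_polyG]

/-- The homomorphism `k[X, Y, Z] → B`. -/
noncomputable def coordHom : MvPolynomial (Fin 3) k →ₐ[k] S.B := MvPolynomial.aeval ![S.x, S.y, S.z]

@[simp] theorem coordHom_X_zero : S.coordHom (MvPolynomial.X 0) = S.x := by simp [coordHom]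

@[simp] theorem coordHom_X_one : S.coordHom (MvPolynomial.X 1) = S.y := by simp [coordHom]

@[simp] theorem coordHom_X_two : S.coordHom (MvPolynomial.X 2) = S.z := by simp [coordHom]

theorem polyG_eq_zero : S.polyG S.x S.y S.z = 0 := by
  rw [polyG, ← S.x_pow_mul_y, sub_self]

/-- The kernel of `k[X, Y, Z] → B / (x ^ e)`. -/
theorem x_pow_dvd_coordHom_iff (p : MvPolynomial (Fin 3) k) :
    S.x ^ S.e ∣ S.coordHom p ↔
      p ∈ S.tripleIdeal (MvPolynomial.X 0) (MvPolynomial.X 1) (MvPolynomial.X 2) := by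
  constructor
  · rintro ⟨b, hb⟩
    obtain ⟨b, rfl⟩ := Ideal.Quotient.mk_surjective b
    set ι : MvPolynomial (Fin 3) k →ₐ[k] MvPolynomial (Fin 4) k :=
      MvPolynomial.aeval ![MvPolynomial.X 0, MvPolynomial.X 1, MvPolynomial.X 2] with hι
    -- Setting $T=0$ sends the two relations to $-G$ and $-Q$, so a congruence $p\equiv X^eb$ in
    -- $k[X,Y,Z,T]$ becomes membership of $p$ in $(Q,G,X^e)$.
    set θ : MvPolynomial (Fin 4) k →ₐ[k] MvPolynomial (Fin 3) k :=
      MvPolynomial.aeval ![MvPolynomial.X 0, MvPolynomial.X 1, MvPolynomial.X 2, 0] with hθ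
    have h1 : ∀ q, Ideal.Quotient.mk S.relIdeal (ι q) = S.coordHom q := by
      intro q
      have : (Ideal.Quotient.mkₐ k S.relIdeal).comp ι = S.coordHom := by
        refine MvPolynomial.algHom_ext fun i => ?_
        fin_cases i <;> simp [hι] <;> rfl
      exact DFunLike.congr_fun this q
    have h2 : ι p - MvPolynomial.X 0 ^ S.e * b ∈ S.relIdeal := by
      rw [← Ideal.Quotient.eq, h1, hb]
      rfl
    have h3 : S.relIdeal ≤ (S.tripleIdeal (MvPolynomial.X 0) (MvPolynomial.X 1)
        (MvPolynomial.X 2)).comap θ := by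
      rw [relIdeal, Ideal.span_le]
      rintro _ (rfl | rfl)
      · have : θ (MvPolynomial.X 0 ^ S.d * MvPolynomial.X 1 -
            evalXZ (MvPolynomial.X 0) (MvPolynomial.X 2) S.P) =
            -S.polyG (MvPolynomial.X 0) (MvPolynomial.X 1) (MvPolynomial.X 2) := by
          simp [hθ, algHom_evalXZ, polyG]
        rw [SetLike.mem_coe, Ideal.mem_comap, this]
        exact neg_mem (Ideal.subset_span (by simp))
      · have : θ (MvPolynomial.X 0 ^ S.e * MvPolynomial.X 3 -
            evalXYZ (MvPolynomial.X 0) (MvPolynomial.X 1) (MvPolynomial.X 2) S.Q) =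
            -evalXYZ (MvPolynomial.X 0) (MvPolynomial.X 1) (MvPolynomial.X 2) S.Q := by
          simp [hθ, algHom_evalXYZ]
        rw [SetLike.mem_coe, Ideal.mem_comap, this]
        exact neg_mem (Ideal.subset_span (by simp))
    have h4 : θ (ι p) = p := by
      have : θ.comp ι = AlgHom.id k _ := by
        refine MvPolynomial.algHom_ext fun i => ?_
        fin_cases i <;> simp [hι, hθ]
      exact DFunLike.congr_fun this p
    have h5 := h3 h2
    rw [Ideal.mem_comap, map_sub, h4, map_mul, map_pow] at h5
    have h6 : θ (MvPolynomial.X 0) = MvPolynomial.X 0 := by simp [hθ]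
    rw [h6] at h5
    refine (Submodule.sub_mem_iff_left _ ?_).1 h5
    exact Ideal.mul_mem_right _ _ (Ideal.subset_span (by simp))
  · intro hp
    have : S.tripleIdeal (MvPolynomial.X 0) (MvPolynomial.X 1) (MvPolynomial.X 2) ≤
        (Ideal.span {S.x ^ S.e}).comap S.coordHom := by
      rw [tripleIdeal, Ideal.span_le]
      rintro _ (rfl | rfl | rfl)
      · rw [SetLike.mem_coe, Ideal.mem_comap, algHom_evalXYZ, coordHom_X_zero, coordHom_X_one,
          coordHom_X_two, ← S.x_pow_mul_t]
        exact Ideal.mul_mem_right _ _ (Ideal.mem_span_singleton_self _)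
      · rw [SetLike.mem_coe, Ideal.mem_comap, algHom_polyG, coordHom_X_zero, coordHom_X_one,
          coordHom_X_two, S.polyG_eq_zero]
        exact Ideal.zero_mem _
      · rw [SetLike.mem_coe, Ideal.mem_comap, map_pow, coordHom_X_zero]
        exact Ideal.mem_span_singleton_self _
    exact Ideal.mem_span_singleton.1 (this hp)

/-- A homomorphism from `k[X, Y, Z]` that factors through `B`. -/
theorem exists_hom_of_dvd (η : MvPolynomial (Fin 3) k →ₐ[k] A)
    (hG : η (S.polyG (MvPolynomial.X 0) (MvPolynomial.X 1) (MvPolynomial.X 2)) = 0)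
    (hQ : η (MvPolynomial.X 0) ^ S.e ∣
      η (evalXYZ (MvPolynomial.X 0) (MvPolynomial.X 1) (MvPolynomial.X 2) S.Q)) :
    ∃ f : S.B →ₐ[k] A, f.comp S.coordHom = η := by
  obtain ⟨w, hw⟩ := hQ
  rw [algHom_evalXYZ] at hw
  rw [algHom_polyG, polyG, sub_eq_zero] at hG
  refine ⟨S.lift _ _ _ w hG.symm hw.symm, MvPolynomial.algHom_ext fun i => ?_⟩
  fin_cases i <;> simp

end Maps

variable {S₁ S₂ : DoubleDanielewski k} {a c : k} {δ : k[X]} {f : k[X][X]}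

theorem polyG_newCoord (hd : S₁.d = S₂.d) (ha : a ≠ 0)
    (h : evalXZ (a • C X : k[X][X]) (c • X + C δ) S₂.P = c ^ S₁.r • S₁.P + C X ^ S₁.d * f) :
    S₂.polyG (X₂ a) (Y₂ ((a ^ S₁.d)⁻¹ * c ^ S₁.r) ((a ^ S₁.d)⁻¹ • f)) (Z₂ c δ) =
      c ^ S₁.r • S₁.polyG (MvPolynomial.X 0) (MvPolynomial.X 1) (MvPolynomial.X 2) := by
  have h1 := congrArg (evalXZHom (MvPolynomial.X 0 : MvPolynomial (Fin 3) k)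
    (MvPolynomial.X 2)) h
  rw [algHom_evalXZ] at h1
  simp only [map_add, map_mul, map_pow, map_smul, evalXZHom_apply, evalXZ_C, evalXZ_X,
    aeval_X] at h1
  have h2 : (a ^ S₁.d)⁻¹ • (a ^ S₁.d • (MvPolynomial.X 0 : MvPolynomial (Fin 3) k) ^ S₁.d) =
      MvPolynomial.X 0 ^ S₁.d := inv_smul_smul₀ (pow_ne_zero _ ha) _
  rw [polyG, polyG, X₂, Z₂, h1, Y₂, ← hd, evalXZ_smul, _root_.smul_pow, mul_smul, ← smul_add,
    mul_smul_comm, ← smul_mul_assoc, h2, mul_add, smul_sub, mul_smul_comm]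
  ring

/-- An isomorphism that lifts to a substitution in `k[X, Y, Z]` identifies the ideals. -/
theorem tripleIdeal_newCoord (he : S₁.e = S₂.e) {u : k} {g : k[X][X]} (ha : a ≠ 0) (hc : c ≠ 0)
    (hu : u ≠ 0) (ψ : S₂.B ≃ₐ[k] S₁.B) (hx : ψ S₂.x = a • S₁.x)
    (hy : ψ S₂.y = u • S₁.y + evalXZ S₁.x S₁.z g) (hz : ψ S₂.z = c • S₁.z + aeval S₁.x δ) :
    S₂.tripleIdeal (X₂ a) (Y₂ u g) (Z₂ c δ) =
      S₁.tripleIdeal (MvPolynomial.X 0) (MvPolynomial.X 1) (MvPolynomial.X 2) := by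
  have hcomm : ∀ p, S₁.coordHom (substHom a c u δ g p) = ψ (S₂.coordHom p) := by
    intro p
    have : S₁.coordHom.comp (substHom a c u δ g) = ψ.toAlgHom.comp S₂.coordHom := by
      refine MvPolynomial.algHom_ext fun i => ?_
      fin_cases i
      · simp [X₂, hx]
      · simp [Y₂, hy, algHom_evalXZ]
      · simp [Z₂, hz, ← aeval_algHom_apply]
    exact DFunLike.congr_fun this p
  -- Each ideal is the preimage of $(x^e)$ under the map to its $B$, and $\psi$ carries $(x_2^e)$ to
  -- $(x_1^e)$ because $a$ is a unit.
  have hiff : ∀ p, substHom a c u δ g p ∈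
      S₁.tripleIdeal (MvPolynomial.X 0) (MvPolynomial.X 1) (MvPolynomial.X 2) ↔
      p ∈ S₂.tripleIdeal (MvPolynomial.X 0) (MvPolynomial.X 1) (MvPolynomial.X 2) := by
    intro p
    rw [← x_pow_dvd_coordHom_iff, ← x_pow_dvd_coordHom_iff, hcomm, he]
    have h1 : ψ (S₂.x ^ S₂.e) = a ^ S₂.e • S₁.x ^ S₂.e := by
      rw [map_pow, hx, _root_.smul_pow]
    rw [← map_dvd_iff ψ (a := S₂.x ^ S₂.e), h1]
    have hunit : Associated (S₁.x ^ S₂.e) (a ^ S₂.e • S₁.x ^ S₂.e) := by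
      refine ⟨(Units.mk0 (a ^ S₂.e) (pow_ne_zero _ ha)).map (algebraMap k S₁.B).toMonoidHom, ?_⟩
      rw [mul_comm]
      exact (Algebra.smul_def _ _).symm
    exact hunit.dvd_iff_dvd_left
  have hmap := S₂.map_tripleIdeal (substHom a c u δ g) (MvPolynomial.X 0) (MvPolynomial.X 1)
    (MvPolynomial.X 2)
  rw [substHom_X_zero, substHom_X_one, substHom_X_two] at hmap
  rw [← hmap]
  ext q
  have hsurj := substHom_surjective ha hc hu δ g
  rw [Ideal.mem_map_iff_of_surjective _ hsurj]
  constructor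
  · rintro ⟨p, hp, rfl⟩
    exact (hiff p).2 hp
  · intro hq
    obtain ⟨p, rfl⟩ := hsurj q
    exact ⟨p, (hiff p).1 hq, rfl⟩

/-- The membership of `Q₂` in the ideal of `Q₁`, restricted to `X = 0`. -/
theorem exists_evalXYZ_zero_eq (hs : S₁.s = S₂.s) {u : k} {g : k[X][X]} (hu : u ≠ 0)
    (h : S₂.tripleIdeal (X₂ a) (Y₂ u g) (Z₂ c δ) =
      S₁.tripleIdeal (MvPolynomial.X 0) (MvPolynomial.X 1) (MvPolynomial.X 2)) :
    ∃ h : k[X][X], h.degree < S₁.s ∧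
      evalXYZ (0 : k[X][X]) (u • X + C (evalXZ (0 : k[X]) X g))
          (c • C X + C (C (δ.eval 0))) S₂.Q =
        u ^ S₁.s • evalXYZ (0 : k[X][X]) X (C X) S₁.Q + h * C (evalXZ (0 : k[X]) X S₁.P) := by
  have hC : ∀ p : k[X][X], evalXZ (0 : k[X][X]) (C X) p = C (evalXZ (0 : k[X]) X p) := by
    intro p
    have := algHom_evalXZ (CAlgHom : k[X] →ₐ[k] k[X][X]) 0 X p
    rw [map_zero] at this
    exact this.symm
  have hmem : evalXYZ (X₂ a) (Y₂ u g) (Z₂ c δ) S₂.Q ∈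
      S₁.tripleIdeal (MvPolynomial.X 0) (MvPolynomial.X 1) (MvPolynomial.X 2) := by
    rw [← h]
    exact Ideal.subset_span (by simp)
  set π : MvPolynomial (Fin 3) k →ₐ[k] k[X][X] := MvPolynomial.aeval ![0, X, C X] with hπ
  have hπ0 : π (MvPolynomial.X 0) = 0 := by simp [hπ]
  have hπ1 : π (MvPolynomial.X 1) = X := by simp [hπ]
  have hπ2 : π (MvPolynomial.X 2) = C X := by simp [hπ]
  have hmem' := Ideal.mem_map_of_mem π hmem
  have hδ : aeval (0 : k[X][X]) δ = C (C (δ.eval 0)) := by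
    rw [← coeff_zero_eq_aeval_zero', coeff_zero_eq_eval_zero]
    rfl
  rw [map_tripleIdeal, algHom_evalXYZ, X₂, Y₂, Z₂, map_add, map_add, map_smul, map_smul, map_smul,
    algHom_evalXZ, ← aeval_algHom_apply, hπ0, hπ1, hπ2, hC, hδ, smul_zero, tripleIdeal, polyG,
    zero_pow S₁.d_pos.ne', zero_pow S₁.e_pos.ne', zero_mul, sub_zero, hC] at hmem'
  obtain ⟨α, b, hb, hαb⟩ := Ideal.mem_span_insert.1 hmem'
  obtain ⟨β, b', hb', rfl⟩ := Ideal.mem_span_insert.1 hb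
  rw [Ideal.mem_span_singleton, zero_dvd_iff] at hb'
  subst hb'
  set q₁ : k[X][X] := S₁.Q.map (evalXZHom (0 : k[X]) X).toRingHom with hq₁
  have hq₁m : q₁.Monic := S₁.Q_monic.map _
  have hq₁d : q₁.natDegree = S₁.s := S₁.Q_monic.natDegree_map _
  have hz : c • C X + C (C (δ.eval 0)) = (C (c • X + C (δ.eval 0)) : k[X][X]) := by
    rw [map_add, smul_C]
  have e₁ : evalXYZ (0 : k[X][X]) X (C X) S₁.Q = q₁ := by
    rw [S₁.evalXYZ_zero_eq_map _ _ X rfl, comp_X]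
  set q₂ : k[X][X] := S₂.Q.map (evalXZHom (0 : k[X]) (c • X + C (δ.eval 0))).toRingHom with hq₂
  have e₂ : evalXYZ (0 : k[X][X]) (u • X + C (evalXZ (0 : k[X]) X g))
      (c • C X + C (C (δ.eval 0))) S₂.Q = q₂.comp (u • X + C (evalXZ (0 : k[X]) X g)) :=
    S₂.evalXYZ_zero_eq_map _ _ _ hz
  rw [e₁, e₂] at hαb ⊢
  have hdeg := degree_comp_sub_lt (S₂.Q_monic.map _ : q₂.Monic) hq₁m
    ((S₂.Q_monic.natDegree_map _).trans (hs.symm.trans hq₁d.symm)) hu (evalXZ (0 : k[X]) X g)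
  rw [← degree_eq_natDegree hq₁m.ne_zero, hq₁d] at hdeg
  -- At $X=0$ membership reads $Q_2=\alpha Q_1+\beta P_1(0,Z)$. Subtracting $u^sQ_1$ lowers the
  -- $Y$-degree below $s$, and reducing $\beta$ modulo the monic $Q_1$ removes the remaining
  -- multiple of $Q_1$.
  obtain ⟨h', hh, hD⟩ := exists_eq_mul_C_of_eq_add (α := α - C (C (u ^ S₁.s))) (β := β)
    (c := evalXZ (0 : k[X]) X S₁.P) hq₁m hdeg (by
      rw [hαb, Algebra.smul_def]
      change _ - C (C (u ^ S₁.s)) * _ = _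
      ring)
  refine ⟨h', ?_, ?_⟩
  · rwa [degree_eq_natDegree hq₁m.ne_zero, hq₁d] at hh
  · rw [← hD]
    abel

/-- The substitution preserves $G$ up to a unit, and equality of the ideals makes the image of $Q_2$
divisible by $x_1^e$ in $B_1$; the quotient gives an image for $t_2$. The inverse substitution is
treated in the same way, and the two composites need checking only on $x$ and $z$. -/
theorem nonempty_algEquiv (hr₁ : 0 < S₁.r) (hs₁ : 0 < S₁.s) (hr₂ : 0 < S₂.r) (hs₂ : 0 < S₂.s)
    (hd : S₁.d = S₂.d) (he : S₁.e = S₂.e) (ha : a ≠ 0) (hc : c ≠ 0)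
    (hP : evalXZ (a • C X : k[X][X]) (c • X + C δ) S₂.P = c ^ S₁.r • S₁.P + C X ^ S₁.d * f)
    (hI : S₂.tripleIdeal (X₂ a) (Y₂ ((a ^ S₁.d)⁻¹ * c ^ S₁.r) ((a ^ S₁.d)⁻¹ • f)) (Z₂ c δ) =
      S₁.tripleIdeal (MvPolynomial.X 0) (MvPolynomial.X 1) (MvPolynomial.X 2)) :
    Nonempty (S₁.B ≃ₐ[k] S₂.B) := by
  have hG := polyG_newCoord hd ha hP
  set u := (a ^ S₁.d)⁻¹ * c ^ S₁.r
  set g := (a ^ S₁.d)⁻¹ • f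
  have hu : u ≠ 0 := mul_ne_zero (inv_ne_zero (pow_ne_zero _ ha)) (pow_ne_zero _ hc)
  set σ := substHom a c u δ g with hσ
  set τ := invHom a c u δ g with hτ
  have hστ : ∀ p, σ (τ p) = p := DFunLike.congr_fun (substHom_comp_invHom ha hc hu δ g)
  have hτσ : ∀ p, τ (σ p) = p := DFunLike.congr_fun (invHom_comp_substHom ha hc hu δ g)
  have hσG : σ (S₂.polyG (MvPolynomial.X 0) (MvPolynomial.X 1) (MvPolynomial.X 2)) =
      c ^ S₁.r • S₁.polyG (MvPolynomial.X 0) (MvPolynomial.X 1) (MvPolynomial.X 2) := by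
    rw [algHom_polyG, hσ, substHom_X_zero, substHom_X_one, substHom_X_two, hG]
  have hσI : (S₂.tripleIdeal (MvPolynomial.X 0) (MvPolynomial.X 1) (MvPolynomial.X 2)).map σ =
      S₁.tripleIdeal (MvPolynomial.X 0) (MvPolynomial.X 1) (MvPolynomial.X 2) := by
    rw [map_tripleIdeal, hσ, substHom_X_zero, substHom_X_one, substHom_X_two, hI]
  have hG₁ : S₁.coordHom (S₁.polyG (MvPolynomial.X 0) (MvPolynomial.X 1) (MvPolynomial.X 2)) =
      0 := by
    rw [algHom_polyG, coordHom_X_zero, coordHom_X_one, coordHom_X_two, polyG_eq_zero]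
  have hG₂ : S₂.coordHom (S₂.polyG (MvPolynomial.X 0) (MvPolynomial.X 1) (MvPolynomial.X 2)) =
      0 := by
    rw [algHom_polyG, coordHom_X_zero, coordHom_X_one, coordHom_X_two, polyG_eq_zero]
  have hunit : ∀ {A : Type _} [CommRing A] [Algebra k A] (v : A) {b : k} (_ : b ≠ 0) (n : ℕ)
      {w : A}, v ^ n ∣ w → (b • v) ^ n ∣ w := by
    rintro A _ _ v b hb n _ ⟨w, rfl⟩
    refine ⟨(b ^ n)⁻¹ • w, ?_⟩
    rw [_root_.smul_pow, smul_mul_smul_comm, mul_inv_cancel₀ (pow_ne_zero _ hb), one_smul]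
  obtain ⟨F, hF⟩ := S₂.exists_hom_of_dvd (S₁.coordHom.comp σ)
    (by rw [AlgHom.comp_apply, hσG, map_smul, hG₁, smul_zero]) (by
      rw [AlgHom.comp_apply, AlgHom.comp_apply, hσ, substHom_X_zero, X₂, map_smul,
        coordHom_X_zero]
      refine hunit S₁.x ha _ ?_
      rw [← he, x_pow_dvd_coordHom_iff, ← hσI]
      exact Ideal.mem_map_of_mem _ (Ideal.subset_span (by simp)))
  obtain ⟨G, hG'⟩ := S₁.exists_hom_of_dvd (S₂.coordHom.comp τ) (by
      have : S₁.polyG (MvPolynomial.X 0) (MvPolynomial.X 1) (MvPolynomial.X 2) =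
          (c ^ S₁.r)⁻¹ •
            σ (S₂.polyG (MvPolynomial.X 0) (MvPolynomial.X 1) (MvPolynomial.X 2)) := by
        rw [hσG, inv_smul_smul₀ (pow_ne_zero _ hc)]
      rw [AlgHom.comp_apply, this, map_smul, hτσ, map_smul, hG₂, smul_zero]) (by
      have h0 : τ (MvPolynomial.X 0) = a⁻¹ • MvPolynomial.X 0 := by simp [hτ, invHom]
      rw [AlgHom.comp_apply, AlgHom.comp_apply, h0, map_smul, coordHom_X_zero]
      refine hunit S₂.x (inv_ne_zero ha) _ ?_
      rw [he, x_pow_dvd_coordHom_iff]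
      have hQ : evalXYZ (MvPolynomial.X 0) (MvPolynomial.X 1) (MvPolynomial.X 2) S₁.Q ∈
          (S₂.tripleIdeal (MvPolynomial.X 0) (MvPolynomial.X 1) (MvPolynomial.X 2)).map σ := by
        rw [hσI]
        exact Ideal.subset_span (by simp)
      rw [Ideal.mem_map_iff_of_surjective σ fun p => ⟨τ p, hστ p⟩] at hQ
      obtain ⟨q, hq, hqσ⟩ := hQ
      rwa [← hqσ, hτσ])
  have hF' : ∀ p, F (S₂.coordHom p) = S₁.coordHom (σ p) := DFunLike.congr_fun hF
  have hG'' : ∀ p, G (S₁.coordHom p) = S₂.coordHom (τ p) := DFunLike.congr_fun hG'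
  have hFG : ∀ p, F (G (S₁.coordHom p)) = S₁.coordHom p := fun p => by rw [hG'', hF', hστ]
  have hGF : ∀ p, G (F (S₂.coordHom p)) = S₂.coordHom p := fun p => by rw [hF', hG'', hτσ]
  have d₁ := S₁.isDomain_B hr₁ hs₁
  have d₂ := S₂.isDomain_B hr₂ hs₂
  refine ⟨AlgEquiv.ofAlgHom G F ?_ ?_⟩
  · have hx := hGF (MvPolynomial.X 0)
    have hz := hGF (MvPolynomial.X 2)
    rw [coordHom_X_zero] at hx
    rw [coordHom_X_two] at hz
    refine S₂.hom_ext hx hz ?_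
    rw [AlgHom.comp_apply, hx]
    exact (IsRegular.of_ne_zero (S₂.x_ne_zero hr₂ hs₂)).left
  · have hx := hFG (MvPolynomial.X 0)
    have hz := hFG (MvPolynomial.X 2)
    rw [coordHom_X_zero] at hx
    rw [coordHom_X_two] at hz
    refine S₁.hom_ext hx hz ?_
    rw [AlgHom.comp_apply, hx]
    exact (IsRegular.of_ne_zero (S₁.x_ne_zero hr₁ hs₁)).left

end DoubleDanielewski

end

/-! ### The classification theorem -/

theorem mainTheorem1 {k : Type*} [Field k] (S₁ S₂ : DoubleDanielewski k)
    (hML₁ : S₁.MLCondition) (hML₂ : S₂.MLCondition) :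
    -- the conditions (I) and (II) are necessary
    (1 < S₁.r → 1 < S₂.r → ∀ ψ : S₂.B ≃ₐ[k] S₁.B,
      S₁.r = S₂.r ∧ S₁.s = S₂.s ∧
      ∃ (lam gam : k) (δ : Polynomial k), lam ≠ 0 ∧ gam ≠ 0 ∧
        ψ S₂.x = lam • S₁.x ∧
        ψ S₂.z = gam • S₁.z + Polynomial.aeval S₁.x δ ∧
        (1 < S₁.s →
          S₁.d = S₂.d ∧ S₁.e = S₂.e ∧
          ∃ f : Polynomial (Polynomial k), f.degree < (S₁.r : WithBot ℕ) ∧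
          ∃ (nu : k) (g : Polynomial (Polynomial k)),
            nu = (lam ^ S₁.d)⁻¹ * gam ^ S₁.r ∧ g = (lam ^ S₁.d)⁻¹ • f ∧
            -- (i)
            ψ S₂.y = nu • S₁.y + evalXZ S₁.x S₁.z g ∧
            -- (ii), an identity in `k[X, Z]`
            evalXZ (lam • Polynomial.C Polynomial.X : Polynomial (Polynomial k))
                (gam • Polynomial.X + Polynomial.C δ) S₂.P =
              gam ^ S₁.r • S₁.P + Polynomial.C Polynomial.X ^ S₁.d * f ∧
            -- its restriction to `X = 0`, an identity in `k[Z]`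
            evalXZ (0 : Polynomial k) (gam • Polynomial.X + Polynomial.C (δ.eval 0)) S₂.P =
              gam ^ S₁.r • evalXZ (0 : Polynomial k) Polynomial.X S₁.P ∧
            -- (a)
            Algebra.adjoin k {NewCoord.X₂ lam, NewCoord.Y₂ nu g, NewCoord.Z₂ gam δ} = ⊤ ∧
            -- (b)
            S₂.polyG (NewCoord.X₂ lam) (NewCoord.Y₂ nu g) (NewCoord.Z₂ gam δ) =
              gam ^ S₁.r •
                S₁.polyG (MvPolynomial.X 0) (MvPolynomial.X 1) (MvPolynomial.X 2) ∧
            -- (c)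
            S₂.tripleIdeal (NewCoord.X₂ lam) (NewCoord.Y₂ nu g) (NewCoord.Z₂ gam δ) =
              S₁.tripleIdeal (MvPolynomial.X 0) (MvPolynomial.X 1) (MvPolynomial.X 2) ∧
            -- the resulting identity at `X = 0`, in `k[Y, Z]` represented as `k[Z][Y]`
            ∃ h : Polynomial (Polynomial k), h.degree < (S₁.s : WithBot ℕ) ∧
              evalXYZ (0 : Polynomial (Polynomial k))
                  (nu • Polynomial.X + Polynomial.C (evalXZ (0 : Polynomial k) Polynomial.X g))
                  (gam • Polynomial.C Polynomial.X + Polynomial.C (Polynomial.C (δ.eval 0)))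
                  S₂.Q =
                nu ^ S₁.s • evalXYZ (0 : Polynomial (Polynomial k)) Polynomial.X
                    (Polynomial.C Polynomial.X) S₁.Q +
                  h * Polynomial.C (evalXZ (0 : Polynomial k) Polynomial.X S₁.P))) ∧
    -- and, when `s > 1`, sufficient
    (S₁.r = S₂.r → S₁.s = S₂.s → 1 < S₁.s → S₁.d = S₂.d → S₁.e = S₂.e →
      (∃ (lam gam : k) (δ : Polynomial k) (f : Polynomial (Polynomial k)),
        lam ≠ 0 ∧ gam ≠ 0 ∧ f.degree < (S₁.r : WithBot ℕ) ∧
        evalXZ (lam • Polynomial.C Polynomial.X : Polynomial (Polynomial k))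
                (gam • Polynomial.X + Polynomial.C δ) S₂.P =
          gam ^ S₁.r • S₁.P + Polynomial.C Polynomial.X ^ S₁.d * f ∧
        ∃ (nu : k) (g : Polynomial (Polynomial k)),
          nu = (lam ^ S₁.d)⁻¹ * gam ^ S₁.r ∧ g = (lam ^ S₁.d)⁻¹ • f ∧
          S₂.tripleIdeal (NewCoord.X₂ lam) (NewCoord.Y₂ nu g) (NewCoord.Z₂ gam δ) =
            S₁.tripleIdeal (MvPolynomial.X 0) (MvPolynomial.X 1) (MvPolynomial.X 2)) →
      Nonempty (S₁.B ≃ₐ[k] S₂.B)) := by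
  constructor
  · intro hr₁ hr₂ ψ
    have hs₁ : 0 < S₁.s := by rcases hML₁ with h | h | h <;> omega
    have hs₂ : 0 < S₂.s := by rcases hML₂ with h | h | h <;> omega
    obtain ⟨hr, hs, hde⟩ := DoubleDanielewski.invariants_eq hr₁ hs₁ hr₂ hs₂ ψ
    obtain ⟨a, ha, hx⟩ := DoubleDanielewski.exists_map_x_eq_smul hr₁ hs₁ hr₂ hs₂ ψ
    obtain ⟨c, δ, hc, hz⟩ := DoubleDanielewski.exists_map_z_eq hr₁ hs₁ hr₂ hs₂ ha ψ hx
    refine ⟨hr, hs, a, c, δ, ha, hc, hx, hz, fun h1 => ?_⟩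
    obtain ⟨hd, he⟩ := hde h1
    obtain ⟨f, hf, hy, hP⟩ := DoubleDanielewski.exists_map_y_eq (by omega) hs₁ hr hd ha hc
      ψ.toAlgHom hx hz
    have had : a ^ S₁.d ≠ 0 := pow_ne_zero _ ha
    have hu : (a ^ S₁.d)⁻¹ * c ^ S₁.r ≠ 0 := mul_ne_zero (inv_ne_zero had) (pow_ne_zero _ hc)
    have hy' : ψ S₂.y = ((a ^ S₁.d)⁻¹ * c ^ S₁.r) • S₁.y +
        evalXZ S₁.x S₁.z ((a ^ S₁.d)⁻¹ • f) := by
      rw [evalXZ_smul, mul_smul, ← smul_add]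
      exact (inv_smul_eq_iff₀ had).2 hy.symm |>.symm
    have hI := DoubleDanielewski.tripleIdeal_newCoord he ha hc hu ψ hx hy' hz
    exact ⟨hd, he, f, hf, _, _, rfl, rfl, hy', hP, DoubleDanielewski.evalXZ_zero_eq hP,
      NewCoord.adjoin_eq_top ha hc hu _ _, DoubleDanielewski.polyG_newCoord hd ha hP, hI,
      DoubleDanielewski.exists_evalXYZ_zero_eq hs hu hI⟩
  · rintro hr hs h1 hd he ⟨a, c, δ, f, ha, hc, -, hP, _, _, rfl, rfl, hI⟩
    have hr₁ : 0 < S₁.r := by rcases hML₁ with h | h | h <;> omega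
    exact DoubleDanielewski.nonempty_algEquiv hr₁ (by omega) (by omega) (by omega) hd he ha hc hP hI
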